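/- **Normal Form Lemma.** Let $d,N\in\mathbb N$, $0<\delta<\tfrac12$, $0<\beta<1$, $\varepsilon_0>0$, and put $a:=1-2\delta$, $\mathbb T^d:=\mathbb R^d/2\pi\mathbb Z^d$, $H_0(p):=\sum_{j=1}^d p_j^2/2$ and $K(\varepsilon):=\lfloor\varepsilon^{-\beta}\rfloor+1$. A family $f=\{f_\varepsilon\}_{0<\varepsilon<\varepsilon_0}$ of real functions $f_\varepsilon\in C^\infty(\mathbb R^d\times\mathbb T^d)$ is a *symbol of order* $m\in\mathbb R$, written $f\in\mathcal P^{m,\delta}$, if for all $\alpha,\gamma\in\mathbb N^d$ there is $C_{\alpha,\gamma}>0$ with $$\sup_{0<\varepsilon<\varepsilon_0}\ \sup_{(p,q)\in\mathbb R^d\times\mathbb T^d}\left|\frac{\partial_p^\alpha\partial_q^\gamma f_\varepsilon(p,q)}{\varepsilon^{m}}\,\varepsilon^{|\alpha|\delta}\right|\le C_{\alpha,\gamma}.$$ Let $\hat f_k(\varepsilon,p)=(2\pi)^{-d}\int_{\mathbb T^d}f_\varepsilon(p,q)e^{-\mathrm i k\cdot q}\,dq$. A family $Z_\varepsilon:\mathbb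 R^d\times\mathbb T^d\to\mathbb R$ is *in normal form* if, for all $0<\varepsilon<\varepsilon_0$, $Z_\varepsilon(p,q)=\sum_{|k|\le K(\varepsilon)}\hat Z_k(\varepsilon,p)e^{\mathrm i k\cdot q}$ (with $|k|$ the Euclidean length) and, for every $k\in\mathbb Z^d\setminus\{0\}$ and $p\in\mathbb R^d$, $\hat Z_k(\varepsilon,p)\ne0$ implies $|p\cdot k|\le\varepsilon^\delta$. The *Lie transform* generated by $g$ is the time-one map of the (globally defined) flow of the Hamiltonian vector field $\dot p=-\partial_q g$, $\dot q=\partial_p g$. Let $H_\varepsilon=H_0+P_\varepsilon$ with $P\in\mathcal P^{1,\delta}$. Then there exist canonical transformations ($C^\infty$ symplectic diffeomorphisms) $\mathcal T=\mathcal T_\varepsilon$ of $\mathbb R^d\times\mathbb T^d$, $0<\varepsilon<\varepsilon_0$, each a composition $\mathcal T_\varepsilon=\Phi^1_{g_{1,\varepsilon}}\circ\cdots\circ\Phi^1_{g_{N,\varepsilon}}$ of Lie transforms generated by symbols $g_j\in\mathcal P^{1+a(j-1)-\delta,\,\delta}$, such that $$H_\varepsilon\circ\mathcal T_\varepsilon=H_0+\sum_{j=1}^N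 Z_{j,\varepsilon}+\mathcal R^{(N)}_\varepsilon ,$$ where each $Z_j\in\mathcal P^{1+a(j-1),\delta}$ is in normal form and $\mathcal R^{(N)}_\varepsilon\in C^\infty(\mathbb R^d\times\mathbb T^d)$ satisfies, for all $\alpha,\gamma\in\mathbb N^d$ with $|\alpha|+|\gamma|\le1$, $$\sup_{0<\varepsilon<\varepsilon_0}\ \sup_{(p,q)}\left|\frac{\partial_p^\alpha\partial_q^\gamma\mathcal R^{(N)}_\varepsilon(p,q)}{\varepsilon^{1+Na}}\right|\varepsilon^{|\alpha|\delta}\le C_{\alpha,\gamma}<\infty .$$ Furthermore, for every $m\in\mathbb R$ and every $f\in\mathcal P^{m,\delta}$ there is $C>0$ such that, for all $0<\varepsilon<\varepsilon_0$, $$\sup_{(p,q)}\left|f_\varepsilon\circ\mathcal T_\varepsilon-f_\varepsilon\right|\le C\,\varepsilon^{m+1-2\delta},$$ and for every $j=1,\dots,d$ there is $C>0$ such that, for all $0<\varepsilon<\varepsilon_0$, $$\sup_{(p,q)}\left|p_j\circ\mathcal T_\varepsilon-p_j\right|\le C\,\varepsilon^{1-\delta}.$$ -/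

import Mathlib

/-!
The phase space is `ℝ^d × 𝕋^d` with `𝕋^d = ℝ^d / 2πℤ^d`. Functions on it are functions of
`(p, q) ∈ ℝ^d × ℝ^d` that are `2πℤ^d`-periodic in `q`; maps of it are represented by their lifts to
`ℝ^d × ℝ^d`. A point is `x = (p, q)`, so `x.1 = p` and `x.2 = q`.
-/

namespace NormalFormLemma

open scoped ContDiff

noncomputable section

/-- Universal cover of `ℝ^d × 𝕋^d`. -/
abbrev Phase (d : ℕ) : Type := (Fin d → ℝ) × (Fin d → ℝ)

/-- The vector `(0, 2πk)`. -/
def shift {d : ℕ} (k : Fin d → ℤ) : Phase d :=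
  (0, fun j => 2 * Real.pi * (k j : ℝ))

/-- `f` is a function on `ℝ^d × 𝕋^d`. -/
def IsPeriodic {d : ℕ} (f : Phase d → ℝ) : Prop :=
  ∀ (k : Fin d → ℤ) (x : Phase d), f (x + shift k) = f x

/-- `∂f/∂p_j`. -/
def partialP {d : ℕ} (j : Fin d) (f : Phase d → ℝ) : Phase d → ℝ :=
  fun x => fderiv ℝ f x (Pi.single j 1, 0)

/-- `∂f/∂q_j`. -/
def partialQ {d : ℕ} (j : Fin d) (f : Phase d → ℝ) : Phase d → ℝ :=
  fun x => fderiv ℝ f x (0, Pi.single j 1)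

/-- `∂_p^α f = ∂_{p_1}^{α_1} ⋯ ∂_{p_d}^{α_d} f`. -/
def multiP {d : ℕ} (α : Fin d → ℕ) (f : Phase d → ℝ) : Phase d → ℝ :=
  (List.finRange d).foldr (fun j g => (partialP j)^[α j] g) f

/-- `∂_q^β f = ∂_{q_1}^{β_1} ⋯ ∂_{q_d}^{β_d} f`. -/
def multiQ {d : ℕ} (β : Fin d → ℕ) (f : Phase d → ℝ) : Phase d → ℝ :=
  (List.finRange d).foldr (fun j g => (partialQ j)^[β j] g) f

/-- `∂_p^α ∂_q^β f`. -/
def mixedPartial {d : ℕ} (α β : Fin d → ℕ) (f : Phase d → ℝ) : Phase d → ℝ :=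
  multiP α (multiQ β f)

/-- The family `f ε`, `0 < ε < ε₀`, is a symbol of order `m`, that is, of class `𝒫^{m,δ}`. -/
structure IsSymbol {d : ℕ} (ε₀ δ m : ℝ) (f : ℝ → Phase d → ℝ) : Prop where
  smooth : ∀ ε ∈ Set.Ioo 0 ε₀, ContDiff ℝ ∞ (f ε)
  periodic : ∀ ε ∈ Set.Ioo 0 ε₀, IsPeriodic (f ε)
  bound : ∀ α β : Fin d → ℕ, ∃ C > 0, ∀ ε ∈ Set.Ioo 0 ε₀, ∀ x : Phase d,
    |mixedPartial α β (f ε) x / ε ^ m * ε ^ (((∑ j, α j : ℕ) : ℝ) * δ)| ≤ C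

/-- The family `R ε` is a remainder of order `N`: the symbol estimates of order `1 + N(1-2δ)` hold
for the derivatives of order at most one. -/
structure IsRemainder {d : ℕ} (ε₀ δ : ℝ) (N : ℕ) (R : ℝ → Phase d → ℝ) : Prop where
  smooth : ∀ ε ∈ Set.Ioo 0 ε₀, ContDiff ℝ ∞ (R ε)
  periodic : ∀ ε ∈ Set.Ioo 0 ε₀, IsPeriodic (R ε)
  bound : ∀ α β : Fin d → ℕ, ∑ j, α j + ∑ j, β j ≤ 1 →
    ∃ C > 0, ∀ ε ∈ Set.Ioo 0 ε₀, ∀ x : Phase d,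
      |mixedPartial α β (R ε) x / ε ^ (1 + N * (1 - 2 * δ))|
        * ε ^ (((∑ j, α j : ℕ) : ℝ) * δ) ≤ C

/-- `K(ε) = [ε^{-β}] + 1`. -/
def cutoff (β ε : ℝ) : ℕ := ⌊1 / ε ^ β⌋₊ + 1

/-- The integer vectors `k` of Euclidean length at most `K`. -/
def modes (d K : ℕ) : Finset (Fin d → ℤ) :=
  (Fintype.piFinset fun _ : Fin d => Finset.Icc (-(K : ℤ)) K).filter
    fun k => ∑ j, k j ^ 2 ≤ (K : ℤ) ^ 2

theorem mem_modes {d K : ℕ} {k : Fin d → ℤ} :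
    k ∈ modes d K ↔ ∑ j, k j ^ 2 ≤ (K : ℤ) ^ 2 := by
  simp only [modes, Finset.mem_filter, Fintype.mem_piFinset, Finset.mem_Icc, and_iff_right_iff_imp]
  intro h j
  have h1 : k j ^ 2 ≤ (K : ℤ) ^ 2 :=
    (Finset.single_le_sum (f := fun i => k i ^ 2) (fun i _ => sq_nonneg (k i))
      (Finset.mem_univ j)).trans h
  exact abs_le.mp (abs_le_of_sq_le_sq h1 (by positivity))

/-- `v · k`. -/
def dotInt {d : ℕ} (v : Fin d → ℝ) (k : Fin d → ℤ) : ℝ := ∑ j, v j * (k j : ℝ)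

/-- The Fourier coefficient `(2π)^{-d} ∫_{𝕋^d} f(p, q) e^{-i k·q} dq`. -/
def fourierCoef {d : ℕ} (f : Phase d → ℝ) (k : Fin d → ℤ) (p : Fin d → ℝ) : ℂ :=
  (1 / (2 * Real.pi) ^ d : ℝ) *
    ∫ q in Set.Icc (0 : Fin d → ℝ) (fun _ => 2 * Real.pi),
      (f (p, q) : ℂ) * Complex.exp (-Complex.I * (dotInt q k : ℂ))

/-- The family `Z ε` is in (resonant) normal form. -/
def IsNormalForm {d : ℕ} (ε₀ δ β : ℝ) (Z : ℝ → Phase d → ℝ) : Prop :=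
  ∀ ε ∈ Set.Ioo 0 ε₀,
    (∀ p q : Fin d → ℝ, (Z ε (p, q) : ℂ) =
      ∑ k ∈ modes d (cutoff β ε),
        fourierCoef (Z ε) k p * Complex.exp (Complex.I * (dotInt q k : ℂ))) ∧
    ∀ (k : Fin d → ℤ) (p : Fin d → ℝ), k ≠ 0 → fourierCoef (Z ε) k p ≠ 0 →
      |dotInt p k| ≤ ε ^ δ

/-- `H₀(p) = ∑ p_j² / 2`. -/
def freeHam {d : ℕ} (x : Phase d) : ℝ := ∑ j, x.1 j ^ 2 / 2

/-- The Hamiltonian vector field `X_g = (-∂g/∂q, ∂g/∂p)`. -/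
def hamVF {d : ℕ} (g : Phase d → ℝ) (x : Phase d) : Phase d :=
  (fun j => -partialQ j g x, fun j => partialP j g x)

/-- `Φ` is the globally defined flow of `X_g`. -/
def IsHamFlow {d : ℕ} (g : Phase d → ℝ) (Φ : ℝ → Phase d → Phase d) : Prop :=
  ∀ x, Φ 0 x = x ∧ ∀ t, HasDerivAt (fun s => Φ s x) (hamVF g (Φ t x)) t

/-- `L` is the Lie transform generated by `g`, i.e. the time-one flow of `X_g`. -/
def IsLieTransform {d : ℕ} (g : Phase d → ℝ) (L : Phase d → Phase d) : Prop :=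
  ∃ Φ : ℝ → Phase d → Phase d, IsHamFlow g Φ ∧ L = Φ 1

/-- The composition `L 1 ∘ L 2 ∘ ⋯ ∘ L n`. -/
def compUpTo {X : Type} (L : ℕ → X → X) : ℕ → X → X
  | 0 => id
  | n + 1 => compUpTo L n ∘ L (n + 1)

/-- The symplectic form `∑ dp_j ∧ dq_j`. -/
def symp {d : ℕ} (u v : Phase d) : ℝ := ∑ j, (u.1 j * v.2 j - u.2 j * v.1 j)

/-- `T` induces a map of `ℝ^d × 𝕋^d`. -/
def Descends {d : ℕ} (T : Phase d → Phase d) : Prop :=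
  ∀ (x : Phase d) (k : Fin d → ℤ), ∃ l : Fin d → ℤ, T (x + shift k) = T x + shift l

/-- `T` is (the lift of) a canonical transformation of `ℝ^d × 𝕋^d`: a smooth diffeomorphism which
preserves the symplectic form. -/
structure IsCanonical {d : ℕ} (T : Phase d → Phase d) : Prop where
  smooth : ContDiff ℝ ∞ T
  descends : Descends T
  exists_inverse : ∃ S : Phase d → Phase d, ContDiff ℝ ∞ S ∧ Descends S ∧
    Function.LeftInverse S T ∧ Function.RightInverse S T
  symplectic : ∀ x u v : Phase d, symp (fderiv ℝ T x u) (fderiv ℝ T x v) = symp u v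

end

end NormalFormLemma

namespace NormalFormLemma

open scoped ContDiff

noncomputable section

/-! The proof is a Lie-transform normalization carried out in the rescaled actions `y = ε^{-δ} p`.
In these variables the weight `ε^{|α|δ}` disappears: a symbol of order `m` becomes a family which,
divided by `ε^m`, is bounded together with each of its derivatives, uniformly in `ε`. The free
Hamiltonian becomes `ε^{2δ} H₀(y)`, and the resonant zone `|p·k| ≤ ε^δ` becomes `|y·k| ≤ 1`.

Suppose the Hamiltonian is `ε^{2δ} H₀ + W + F`, with `W` of order `1` already in normal form and `F`
of order `m ≥ 1`. Let `χ` be a smooth even cutoff, equal to `1` near `0` and supported in `[-1, 1]`.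
The function `(1 - χ(s))/s` is smooth with all derivatives bounded, so multiplying the modes of `F`
by its value at `s = y·k` solves the homological equation without small divisors. What is left of
`F` is the resonant part `∑ χ(y·k) F̂_k e^{ik·q}` over `|k| ≤ K(ε)`, which is in normal form, and
the Fourier tail `|k| > K(ε)`. The only loss is the factor `ε^{-2δ}`, so the generator `Γ` has order
`m - 2δ`. Derivatives of the multipliers cost powers of `k`, which the rapid decay of the Fourier
modes pays for. The tail is smaller than any power of `1/K(ε) ≤ ε^β`, so it also gains `ε^{1-2δ}`.

Along the flow of `Γ` the Hamiltonian changes at the rate `B + {W + F, Γ}`, where `B` is the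
resonant part plus the tail minus `F`. Replacing `B ∘ Ψ_t` by `B` costs the integral of `{B, Γ}`.
Both brackets have order at least `m + 1 - 2δ`. The unbounded `H₀` is never estimated: it enters
only through its bracket with `Γ`, which the homological equation evaluates exactly. Thus one step
(`exists_rescaled_step`, `exists_step`) gains `1 - 2δ`, and `N` steps give the theorem
(`exists_normal_form`).

Every generator has rescaled order at least `1 - 2δ`, which gives the deformation bounds; in the
original actions a displacement gains another `ε^δ`. The analytic support is uniform regularity of
flows up to time one (`flow_regularity`), decay of Fourier modes (`unifBdd_bracket_pow_modes`) and
the multiplier estimate `unifBdd_multiplier`. -/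

/-! ### Families of functions that are uniformly bounded in `C^{n,1}` -/

section UnifBdd

variable {ι κ : Type*} {E : Type} [NormedAddCommGroup E] [NormedSpace ℝ E]
  {V W U : Type} [NormedAddCommGroup V] [NormedSpace ℝ V] [NormedAddCommGroup W] [NormedSpace ℝ W]
  [NormedAddCommGroup U] [NormedSpace ℝ U]

/-- The family `F` is uniformly bounded in `C^{n,1}`: the derivatives of order at most `n` are
bounded, and the `n`-th derivative is Lipschitz, uniformly over the index. -/
def UnifBdd {ι : Type*} {E : Type} [NormedAddCommGroup E] [NormedSpace ℝ E] :
    ℕ → ∀ {V : Type} [NormedAddCommGroup V] [NormedSpace ℝ V], (ι → E → V) → Prop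
  | 0, _, _, _, F => ∃ C, (∀ i x, ‖F i x‖ ≤ C) ∧ ∀ i x y, ‖F i x - F i y‖ ≤ C * ‖x - y‖
  | n + 1, _, _, _, F => (∃ C, ∀ i x, ‖F i x‖ ≤ C) ∧ (∀ i, Differentiable ℝ (F i)) ∧
      UnifBdd n (fun i => fderiv ℝ (F i))

theorem UnifBdd.bounded {n : ℕ} {F : ι → E → V} (h : UnifBdd n F) :
    ∃ C, 0 ≤ C ∧ ∀ i x, ‖F i x‖ ≤ C := by
  obtain ⟨C, hC⟩ : ∃ C, ∀ i x, ‖F i x‖ ≤ C := by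
    cases n with
    | zero => exact ⟨h.choose, h.choose_spec.1⟩
    | succ n => exact h.1
  exact ⟨max C 0, le_max_right _ _, fun i x => (hC i x).trans (le_max_left _ _)⟩

theorem UnifBdd.lipschitz {n : ℕ} {F : ι → E → V} (h : UnifBdd n F) :
    ∃ C, 0 ≤ C ∧ ∀ i x y, ‖F i x - F i y‖ ≤ C * ‖x - y‖ := by
  cases n with
  | zero =>
    obtain ⟨C, -, hC⟩ := h
    exact ⟨max C 0, le_max_right _ _, fun i x y =>
      (hC i x y).trans (mul_le_mul_of_nonneg_right (le_max_left _ _) (norm_nonneg _))⟩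
  | succ n =>
    obtain ⟨C, hC0, hC⟩ := h.2.2.bounded
    refine ⟨C, hC0, fun i x y => ?_⟩
    exact Convex.norm_image_sub_le_of_norm_fderiv_le (s := Set.univ) (fun z _ => h.2.1 i z)
      (fun z _ => hC i z) convex_univ (Set.mem_univ y) (Set.mem_univ x)

theorem unifBdd_zero_of {F : ι → E → V} {C K : ℝ} (hC : ∀ i x, ‖F i x‖ ≤ C)
    (hK : ∀ i x y, ‖F i x - F i y‖ ≤ K * ‖x - y‖) : UnifBdd 0 F :=
  ⟨max C K, fun i x => (hC i x).trans (le_max_left _ _), fun i x y =>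
    (hK i x y).trans (mul_le_mul_of_nonneg_right (le_max_right _ _) (norm_nonneg _))⟩

theorem UnifBdd.to_zero {n : ℕ} {F : ι → E → V} (h : UnifBdd n F) : UnifBdd 0 F := by
  obtain ⟨C, -, hC⟩ := h.bounded
  obtain ⟨K, -, hK⟩ := h.lipschitz
  exact unifBdd_zero_of hC hK

theorem UnifBdd.of_succ {n : ℕ} : ∀ {V : Type} [NormedAddCommGroup V] [NormedSpace ℝ V]
    {F : ι → E → V}, UnifBdd (n + 1) F → UnifBdd n F := by
  induction n with
  | zero => intro V _ _ F h; exact h.to_zero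
  | succ n ih => intro V _ _ F h; exact ⟨h.1, h.2.1, ih h.2.2⟩

theorem UnifBdd.reindex {n : ℕ} (φ : κ → ι) : ∀ {V : Type} [NormedAddCommGroup V]
    [NormedSpace ℝ V] {F : ι → E → V}, UnifBdd n F → UnifBdd n (fun k => F (φ k)) := by
  induction n with
  | zero =>
    rintro V _ _ F ⟨C, h, h'⟩
    exact ⟨C, fun i x => h _ x, fun i x => h' _ x⟩
  | succ n ih =>
    rintro V _ _ F ⟨⟨C, h⟩, h', h''⟩
    exact ⟨⟨C, fun i => h _⟩, fun i => h' _, ih h''⟩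

theorem unifBdd_const {n : ℕ} : ∀ {V : Type} [NormedAddCommGroup V]
    [NormedSpace ℝ V] {c : ι → V} {C : ℝ}, (∀ i, ‖c i‖ ≤ C) →
    UnifBdd n (fun i (_ : E) => c i) := by
  induction n with
  | zero =>
    intro V _ _ c C h
    exact unifBdd_zero_of (C := C) (K := 0) (fun i _ => h i) (by simp)
  | succ n ih =>
    intro V _ _ c C h
    refine ⟨⟨C, fun i _ => h i⟩, fun i => differentiable_const _, ?_⟩
    have : (fun i => fderiv ℝ (fun _ : E => c i)) = fun i _ => (fun _ : ι => (0 : E →L[ℝ] V)) i := by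
      ext; simp
    rw [this]
    exact ih (C := 0) (by simp)

theorem UnifBdd.add {n : ℕ} : ∀ {V : Type} [NormedAddCommGroup V]
    [NormedSpace ℝ V] {F G : ι → E → V}, UnifBdd n F → UnifBdd n G →
    UnifBdd n (fun i x => F i x + G i x) := by
  induction n with
  | zero =>
    rintro V _ _ F G ⟨C, h, h'⟩ ⟨D, k, k'⟩
    refine ⟨C + D, fun i x => (norm_add_le _ _).trans (add_le_add (h i x) (k i x)), fun i x y => ?_⟩
    rw [add_sub_add_comm, add_mul]
    exact (norm_add_le _ _).trans (add_le_add (h' i x y) (k' i x y))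
  | succ n ih =>
    rintro V _ _ F G ⟨⟨C, h⟩, h', h''⟩ ⟨⟨D, k⟩, k', k''⟩
    refine ⟨⟨C + D, fun i x => (norm_add_le _ _).trans (add_le_add (h i x) (k i x))⟩,
      fun i => (h' i).add (k' i), ?_⟩
    have := ih h'' k''
    convert this using 3 with i x
    exact fderiv_fun_add (h' i x) (k' i x)

/-- By the product rule the derivative is a sum of two bilinear expressions, in `(F, DG)` and in
`(DF, G)`, with values in other spaces; hence the induction runs over all spaces at once. Products,
scalar multiples, evaluation and composition of linear maps are all instances. -/
theorem UnifBdd.bilin {n : ℕ} : ∀ {V W U : Type} [NormedAddCommGroup V] [NormedSpace ℝ V]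
    [NormedAddCommGroup W] [NormedSpace ℝ W] [NormedAddCommGroup U] [NormedSpace ℝ U]
    (B : V →L[ℝ] W →L[ℝ] U) {F : ι → E → V} {G : ι → E → W}, UnifBdd n F → UnifBdd n G →
    UnifBdd n (fun i x => B (F i x) (G i x)) := by
  have bd : ∀ {n : ℕ} {V W U : Type} [NormedAddCommGroup V] [NormedSpace ℝ V]
      [NormedAddCommGroup W] [NormedSpace ℝ W] [NormedAddCommGroup U] [NormedSpace ℝ U]
      (B : V →L[ℝ] W →L[ℝ] U) {F : ι → E → V} {G : ι → E → W}, UnifBdd n F → UnifBdd n G →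
      ∃ C, ∀ i x, ‖B (F i x) (G i x)‖ ≤ C := by
    intro n V W U _ _ _ _ _ _ B F G hF hG
    obtain ⟨C, hC0, hC⟩ := hF.bounded
    obtain ⟨D, hD0, hD⟩ := hG.bounded
    refine ⟨‖B‖ * C * D, fun i x => (B.le_opNorm₂ _ _).trans ?_⟩
    gcongr
    exacts [hC i x, hD i x]
  induction n with
  | zero =>
    intro V W U _ _ _ _ _ _ B F G hF hG
    obtain ⟨C, hC0, hC⟩ := hF.bounded
    obtain ⟨D, hD0, hD⟩ := hG.bounded
    obtain ⟨C', hC0', hC'⟩ := hF.lipschitz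
    obtain ⟨D', hD0', hD'⟩ := hG.lipschitz
    obtain ⟨M, hM⟩ := bd B hF hG
    refine unifBdd_zero_of (K := ‖B‖ * C' * D + ‖B‖ * C * D') hM fun i x y => ?_
    have e : B (F i x) (G i x) - B (F i y) (G i y) =
        B (F i x - F i y) (G i x) + B (F i y) (G i x - G i y) := by
      simp [map_sub]
    rw [e]
    refine (norm_add_le _ _).trans ?_
    rw [add_mul]
    refine add_le_add ((B.le_opNorm₂ _ _).trans ?_) ((B.le_opNorm₂ _ _).trans ?_)
    · calc ‖B‖ * ‖F i x - F i y‖ * ‖G i x‖ ≤ ‖B‖ * (C' * ‖x - y‖) * D := by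
            gcongr
            exacts [hC' i x y, hD i x]
        _ = _ := by ring
    · calc ‖B‖ * ‖F i y‖ * ‖G i x - G i y‖ ≤ ‖B‖ * C * (D' * ‖x - y‖) := by
            gcongr
            exacts [hC i y, hD' i x y]
        _ = _ := by ring
  | succ n ih =>
    intro V W U _ _ _ _ _ _ B F G hF hG
    refine ⟨bd B hF hG, fun i x => (B.hasFDerivAt_of_bilinear (hF.2.1 i x).hasFDerivAt
      (hG.2.1 i x).hasFDerivAt).differentiableAt, ?_⟩
    have := (ih (B.precompR E) hF.of_succ hG.2.2).add (ih (B.precompL E) hF.2.2 hG.of_succ)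
    convert this using 3 with i x
    exact B.fderiv_of_bilinear (hF.2.1 i x) (hG.2.1 i x)

theorem UnifBdd.clm {n : ℕ} {F : ι → E → V} (h : UnifBdd n F) (L : V →L[ℝ] W) :
    UnifBdd n (fun i x => L (F i x)) :=
  UnifBdd.bilin (ContinuousLinearMap.id ℝ (V →L[ℝ] W))
    (unifBdd_const (c := fun _ : ι => L) (C := ‖L‖) fun _ => le_rfl) h

theorem UnifBdd.const_smul {n : ℕ} {F : ι → E → V} (h : UnifBdd n F) {c : ι → ℝ} {C : ℝ}
    (hc : ∀ i, |c i| ≤ C) : UnifBdd n (fun i x => c i • F i x) :=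
  UnifBdd.bilin (ContinuousLinearMap.lsmul ℝ ℝ) (unifBdd_const (c := c) hc) h

theorem UnifBdd.smul {n : ℕ} {f : ι → E → ℝ} {F : ι → E → V} (hf : UnifBdd n f)
    (h : UnifBdd n F) : UnifBdd n (fun i x => f i x • F i x) :=
  UnifBdd.bilin (ContinuousLinearMap.lsmul ℝ ℝ) hf h

theorem UnifBdd.mul {n : ℕ} {f g : ι → E → ℝ} (hf : UnifBdd n f)
    (h : UnifBdd n g) : UnifBdd n (fun i x => f i x * g i x) := hf.smul h

theorem UnifBdd.neg {n : ℕ} {F : ι → E → V} (h : UnifBdd n F) : UnifBdd n (fun i x => -F i x) := by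
  simpa using h.clm (-ContinuousLinearMap.id ℝ V)

theorem UnifBdd.sub {n : ℕ} {F G : ι → E → V} (h : UnifBdd n F) (h' : UnifBdd n G) :
    UnifBdd n (fun i x => F i x - G i x) := by
  simpa [sub_eq_add_neg] using h.add h'.neg

/-- The weights pass through differentiation, so a bound on their absolute sum controls every order.
The range of summation may depend on the index, as it does for Fourier sums truncated at `K(ε)`. -/
theorem UnifBdd.finset_sum {n : ℕ} {s : ι → Finset κ} {c : κ → ℝ} {M : ℝ}
    (hM : ∀ i, ∑ k ∈ s i, |c k| ≤ M) : ∀ {V : Type} [NormedAddCommGroup V]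
    [NormedSpace ℝ V] {F : ι × κ → E → V}, UnifBdd n F →
    UnifBdd n (fun i x => ∑ k ∈ s i, c k • F (i, k) x) := by
  have key : ∀ {V : Type} [NormedAddCommGroup V] [NormedSpace ℝ V] (i : ι) (v : κ → V) (C : ℝ),
      0 ≤ C → (∀ k, ‖v k‖ ≤ C) → ‖∑ k ∈ s i, c k • v k‖ ≤ M * C := by
    intro V _ _ i v C hC0 hC
    calc ‖∑ k ∈ s i, c k • v k‖ ≤ ∑ k ∈ s i, |c k| * C := by
          refine norm_sum_le_of_le _ fun k _ => ?_
          rw [norm_smul, Real.norm_eq_abs]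
          exact mul_le_mul_of_nonneg_left (hC k) (abs_nonneg _)
      _ = (∑ k ∈ s i, |c k|) * C := by rw [Finset.sum_mul]
      _ ≤ M * C := mul_le_mul_of_nonneg_right (hM i) hC0
  induction n with
  | zero =>
    intro V _ _ F hF
    obtain ⟨C, hC0, hC⟩ := hF.bounded
    obtain ⟨C', hC0', hC'⟩ := hF.lipschitz
    refine unifBdd_zero_of (fun i x => key i _ C hC0 fun k => hC _ _) (K := M * C')
      fun i x y => ?_
    rw [← Finset.sum_sub_distrib]
    simp_rw [← smul_sub]
    rw [mul_assoc]
    exact key i _ _ (by positivity) fun k => hC' _ _ _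
  | succ n ih =>
    intro V _ _ F hF
    obtain ⟨C, hC0, hC⟩ := hF.bounded
    refine ⟨⟨M * C, fun i x => key i _ C hC0 fun k => hC _ _⟩, fun i =>
      Differentiable.fun_sum fun k _ => (hF.2.1 _).const_smul _, ?_⟩
    convert ih hF.2.2 using 3 with i x
    exact (HasFDerivAt.fun_sum fun k _ =>
      ((hF.2.1 (i, k) x).hasFDerivAt.const_smul (c k))).fderiv

theorem UnifBdd.sum {n : ℕ} {G : κ → ι → E → V} (s : Finset κ) (hG : ∀ k ∈ s, UnifBdd n (G k)) :
    UnifBdd n (fun i x => ∑ k ∈ s, G k i x) := by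
  induction s using Finset.cons_induction with
  | empty =>
    simpa using unifBdd_const (E := E) (c := fun _ : ι => (0 : V)) (C := 0) (by simp)
  | cons k s hk ih =>
    simp only [Finset.sum_cons]
    exact (hG k (Finset.mem_cons_self k s)).add
      (ih fun l hl => hG l (Finset.mem_cons_of_mem hl))

/-! ### Composition with maps that have bounded derivatives, and smoothness -/

/-- The family of maps `φ` has derivatives of order `1, …, n` uniformly bounded, and the `n`-th
derivative is uniformly Lipschitz. -/
def UnifMap : ℕ → (ι → E → V) → Prop
  | 0, φ => ∃ C, 0 ≤ C ∧ ∀ i x y, ‖φ i x - φ i y‖ ≤ C * ‖x - y‖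
  | n + 1, φ => (∀ i, Differentiable ℝ (φ i)) ∧ UnifBdd n (fun i => fderiv ℝ (φ i))

theorem UnifMap.of_succ {n : ℕ} {φ : ι → E → V} (h : UnifMap (n + 1) φ) : UnifMap n φ := by
  cases n with
  | zero =>
    obtain ⟨C, hC0, hC⟩ := h.2.bounded
    refine ⟨C, hC0, fun i x y => ?_⟩
    exact Convex.norm_image_sub_le_of_norm_fderiv_le (s := Set.univ) (fun z _ => h.1 i z)
      (fun z _ => hC i z) convex_univ (Set.mem_univ y) (Set.mem_univ x)
  | succ n => exact ⟨h.1, h.2.of_succ⟩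

/-- The chain rule expresses the derivative as a bilinear expression in `DF ∘ φ` and `Dφ`. Only
derivatives of `φ` enter, so `φ` may be unbounded, as a flow is. -/
theorem UnifBdd.comp {n : ℕ} : ∀ {V : Type} [NormedAddCommGroup V] [NormedSpace ℝ V]
    {F : ι → W → V} {φ : ι → E → W}, UnifBdd n F → UnifMap n φ →
    UnifBdd n (fun i x => F i (φ i x)) := by
  induction n with
  | zero =>
    rintro V _ _ F φ hF ⟨D, hD0, hD⟩
    obtain ⟨C, hC0, hC⟩ := hF.bounded
    obtain ⟨C', hC0', hC'⟩ := hF.lipschitz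
    refine unifBdd_zero_of (K := C' * D) (fun i x => hC i _) fun i x y => (hC' _ _ _).trans ?_
    rw [mul_assoc]
    exact mul_le_mul_of_nonneg_left (hD _ _ _) hC0'
  | succ n ih =>
    rintro V _ _ F φ hF hφ
    obtain ⟨C, hC0, hC⟩ := hF.bounded
    refine ⟨⟨C, fun i x => hC i _⟩, fun i => (hF.2.1 i).comp (hφ.1 i), ?_⟩
    have := UnifBdd.bilin (ContinuousLinearMap.compL ℝ E W V) (ih hF.2.2 hφ.of_succ) hφ.2
    convert this using 3 with i x
    exact fderiv_comp x (hF.2.1 i _) (hφ.1 i x)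

theorem UnifBdd.contDiff {n : ℕ} : ∀ {V : Type} [NormedAddCommGroup V] [NormedSpace ℝ V]
    {F : ι → E → V}, UnifBdd n F → ∀ i, ContDiff ℝ n (F i) := by
  induction n with
  | zero =>
    intro V _ _ F h i
    obtain ⟨C, hC0, hC⟩ := h.lipschitz
    have : LipschitzWith ⟨C, hC0⟩ (F i) := LipschitzWith.of_dist_le_mul fun x y => by
      rw [dist_eq_norm, dist_eq_norm]; exact hC i x y
    exact contDiff_zero.2 this.continuous
  | succ n ih =>
    intro V _ _ F h i
    have := (contDiff_succ_iff_fderiv (𝕜 := ℝ) (n := n) (f := F i)).2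
      ⟨h.2.1 i, by simp, ih h.2.2 i⟩
    exact_mod_cast this

theorem contDiff_of_unifBdd {F : ι → E → V} (h : ∀ n, UnifBdd n F) (i : ι) :
    ContDiff ℝ ∞ (F i) :=
  contDiff_infty.2 fun n => (h n).contDiff i

theorem fderiv_unifBdd {F : ι → E → V} (h : ∀ n, UnifBdd n F) (n : ℕ) :
    UnifBdd n (fun i => fderiv ℝ (F i)) := (h (n + 1)).2.2

end UnifBdd

/-! ### Ordinary differential equations -/

section ODE

open Set

variable {ι : Type*} {E : Type} [NormedAddCommGroup E] [NormedSpace ℝ E]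
  {V : Type} [NormedAddCommGroup V] [NormedSpace ℝ V]

theorem norm_le_of_norm_deriv_le {y y' : ℝ → V} {K c : ℝ} (hK : 0 ≤ K) (hc : 0 ≤ c)
    (hy : ∀ t ∈ Icc (0 : ℝ) 1, HasDerivWithinAt y (y' t) (Icc 0 1) t)
    (hb : ∀ t ∈ Icc (0 : ℝ) 1, ‖y' t‖ ≤ K * ‖y t‖ + c) {t : ℝ} (ht : t ∈ Icc (0 : ℝ) 1) :
    ‖y t‖ ≤ (‖y 0‖ + c) * Real.exp (K + 1) := by
  -- The rate `K + 1` instead of `K` excludes the degenerate case of the Grönwall bound and makes `c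
  -- / (K + 1) ≤ c`.
  have h1 := norm_le_gronwallBound_of_norm_deriv_right_le (f := y) (f' := y') (δ := ‖y 0‖)
    (K := K + 1) (ε := c) (a := 0) (b := 1) (fun t ht => (hy t ht).continuousWithinAt)
    (fun t ht => (hy t (Ico_subset_Icc_self ht)).mono_of_mem_nhdsWithin
      (Icc_mem_nhdsGE_of_mem ht)) le_rfl
    (fun t ht => (hb t (Ico_subset_Icc_self ht)).trans (by nlinarith [norm_nonneg (y t)])) t ht
  refine h1.trans ?_
  rw [gronwallBound_of_K_ne_0 (by positivity)]
  simp only [sub_zero]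
  have h2 : Real.exp ((K + 1) * t) ≤ Real.exp (K + 1) :=
    Real.exp_le_exp.2 (by nlinarith [ht.1, ht.2])
  have h3 : c / (K + 1) ≤ c := div_le_self hc (by linarith)
  have h4 : 0 ≤ c / (K + 1) := by positivity
  have h5 : 1 ≤ Real.exp ((K + 1) * t) := Real.one_le_exp (mul_nonneg (by positivity) ht.1)
  calc ‖y 0‖ * Real.exp ((K + 1) * t) + c / (K + 1) * (Real.exp ((K + 1) * t) - 1)
      ≤ ‖y 0‖ * Real.exp (K + 1) + c * Real.exp (K + 1) := by
        gcongr
        linarith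
    _ = _ := by ring

/-- A Lipschitz map that is the identity on the ball of radius `R` and vanishes outside of the
ball of radius `2R`. -/
def radialCutoff (R : ℝ) (w : V) : V := (max 0 (min 1 (2 - ‖w‖ / R))) • w

theorem radialCutoff_eq_self {R : ℝ} (hR : 0 < R) {w : V} (hw : ‖w‖ ≤ R) :
    radialCutoff R w = w := by
  have : ‖w‖ / R ≤ 1 := (div_le_one hR).2 hw
  rw [radialCutoff, min_eq_left (by linarith), max_eq_right zero_le_one, one_smul]

theorem norm_radialCutoff_le (R : ℝ) (w : V) : ‖radialCutoff R w‖ ≤ ‖w‖ := by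
  rw [radialCutoff, norm_smul, Real.norm_eq_abs, abs_of_nonneg (le_max_left _ _)]
  exact mul_le_of_le_one_left (norm_nonneg _) (max_le zero_le_one (min_le_left _ _))

theorem radialCutoff_eq_zero {R : ℝ} (hR : 0 < R) {w : V} (hw : 2 * R ≤ ‖w‖) :
    radialCutoff R w = 0 := by
  have : 2 ≤ ‖w‖ / R := (le_div_iff₀ hR).2 hw
  rw [radialCutoff, max_eq_left ((min_le_right _ _).trans (by linarith)), zero_smul]

theorem norm_radialCutoff_le_radius {R : ℝ} (hR : 0 < R) (w : V) :
    ‖radialCutoff R w‖ ≤ 2 * R := by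
  rcases le_total (2 * R) ‖w‖ with h | h
  · rw [radialCutoff_eq_zero hR h, norm_zero]; positivity
  · exact (norm_radialCutoff_le R w).trans h

/-- The constant is `3 = 1 + 2`: the scalar factor is at most `1`, and its own Lipschitz constant `1
/ R` multiplies the shorter of the two vectors, whose norm may be taken below `2R` because otherwise
both values vanish. -/
theorem norm_radialCutoff_sub_le {R : ℝ} (hR : 0 < R) (x y : V) :
    ‖radialCutoff R x - radialCutoff R y‖ ≤ 3 * ‖x - y‖ := by
  wlog hxy : ‖y‖ ≤ ‖x‖ generalizing x y
  · rw [norm_sub_rev, norm_sub_rev x y]; exact this y x (le_of_not_ge hxy)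
  rcases le_total (2 * R) ‖y‖ with h | h
  · rw [radialCutoff_eq_zero hR h, radialCutoff_eq_zero hR (h.trans hxy)]
    simp
  set a := max 0 (min 1 (2 - ‖x‖ / R)) with ha
  set b := max 0 (min 1 (2 - ‖y‖ / R)) with hb
  have h1 : |a - b| ≤ ‖x - y‖ / R := by
    have e1 : |a - b| ≤ |(2 - ‖x‖ / R) - (2 - ‖y‖ / R)| :=
      (abs_max_sub_max_le_max _ _ _ _).trans (max_le (by simp)
        ((abs_min_sub_min_le_max _ _ _ _).trans (max_le (by simp) le_rfl)))
    refine e1.trans ?_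
    rw [sub_sub_sub_cancel_left, ← sub_div, abs_div, abs_of_pos hR]
    gcongr
    rw [norm_sub_rev]
    exact abs_norm_sub_norm_le _ _
  have ha0 : 0 ≤ a := le_max_left _ _
  have ha1 : a ≤ 1 := max_le zero_le_one (min_le_left _ _)
  have e : radialCutoff R x - radialCutoff R y = a • (x - y) + (a - b) • y := by
    simp only [radialCutoff, smul_sub, sub_smul, ha, hb]; abel
  rw [e]
  refine (norm_add_le _ _).trans ?_
  rw [norm_smul, norm_smul, Real.norm_eq_abs, Real.norm_eq_abs, abs_of_nonneg ha0]
  have h2 : |a - b| * ‖y‖ ≤ ‖x - y‖ / R * (2 * R) := by gcongr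
  have h3 : ‖x - y‖ / R * (2 * R) = 2 * ‖x - y‖ := by field_simp
  nlinarith [norm_nonneg (x - y)]

/-- A linear field is unbounded, so a direct Picard–Lindelöf argument would only reach short times.
The truncated field is bounded and Lipschitz, hence solvable on all of `[0, 1]`, and an a priori
bound shows that its solution never meets the truncation. -/
theorem exists_linear_solution [CompleteSpace V] {A : ℝ → V →L[ℝ] V} {b : ℝ → V}
    (hA : ContinuousOn A (Icc 0 1)) (hb : ContinuousOn b (Icc 0 1)) (w₀ : V) :
    ∃ w : ℝ → V, w 0 = w₀ ∧
      ∀ t ∈ Icc (0 : ℝ) 1, HasDerivWithinAt w (A t (w t) + b t) (Icc 0 1) t := by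
  obtain ⟨M, hM⟩ := isCompact_Icc.exists_bound_of_continuousOn hA
  obtain ⟨B, hB⟩ := isCompact_Icc.exists_bound_of_continuousOn hb
  have h0 : (0 : ℝ) ∈ Icc (0 : ℝ) 1 := ⟨le_rfl, zero_le_one⟩
  have hM0 : 0 ≤ M := (norm_nonneg _).trans (hM 0 h0)
  have hB0 : 0 ≤ B := (norm_nonneg _).trans (hB 0 h0)
  -- `R` exceeds the Grönwall bound, which holds for the truncated equation too because truncation
  -- does not increase norms.
  set R : ℝ := (‖w₀‖ + B) * Real.exp (M + 1) + 1 with hR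
  have hR0 : 0 < R := by positivity
  set f : ℝ → V → V := fun t w => A t (radialCutoff R w) + b t with hf
  have hL0 : 0 ≤ M * (2 * R) + B := by positivity
  have hK0 : 0 ≤ 3 * M := by positivity
  have hpl : IsPicardLindelof f (tmin := 0) (tmax := 1) ⟨0, h0⟩ w₀ ⟨_, hL0⟩ 0 ⟨_, hL0⟩
      ⟨_, hK0⟩ := by
    refine ⟨fun t ht => LipschitzOnWith.of_dist_le_mul fun x _ y _ => ?_, fun x _ => ?_,
      fun t ht x _ => ?_, ?_⟩
    · rw [dist_eq_norm, dist_eq_norm, hf]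
      simp only [add_sub_add_right_eq_sub, ← map_sub]
      calc _ ≤ M * (3 * ‖x - y‖) := (A t).le_of_opNorm_le_of_le (hM t ht)
            (norm_radialCutoff_sub_le hR0 x y)
        _ = 3 * M * ‖x - y‖ := by ring
    · exact (hA.clm_apply continuousOn_const).add hb
    · exact (norm_add_le _ _).trans (add_le_add ((A t).le_of_opNorm_le_of_le (hM t ht)
        (norm_radialCutoff_le_radius hR0 x)) (hB t ht))
    · simp
  obtain ⟨w, hw0, hw⟩ := hpl.exists_eq_forall_mem_Icc_hasDerivWithinAt₀
  refine ⟨w, hw0, fun t ht => ?_⟩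
  have hle : ‖w t‖ ≤ R := by
    refine (norm_le_of_norm_deriv_le hM0 hB0 hw (fun t ht => ?_) ht).trans ?_
    · exact (norm_add_le _ _).trans (add_le_add ((A t).le_of_opNorm_le_of_le (hM t ht)
        (norm_radialCutoff_le R _)) (hB t ht))
    · have : w 0 = w₀ := hw0
      rw [this, hR]; linarith
  have h := hw t ht
  simp only [hf, radialCutoff_eq_self hR0 hle] at h
  exact h

/-- A bounded Lipschitz vector field has a global flow. -/
theorem exists_global_flow [CompleteSpace V] {X : V → V} {L K : ℝ} (hL : ∀ x, ‖X x‖ ≤ L)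
    (hK0 : 0 ≤ K) (hK : ∀ x y, ‖X x - X y‖ ≤ K * ‖x - y‖) :
    ∃ Φ : ℝ → V → V, ∀ x, Φ 0 x = x ∧ ∀ t, HasDerivAt (fun s => Φ s x) (X (Φ t x)) t := by
  have hL0 : 0 ≤ L := (norm_nonneg _).trans (hL 0)
  have hlip : LipschitzWith ⟨K, hK0⟩ X := LipschitzWith.of_dist_le_mul fun x y => by
    rw [dist_eq_norm, dist_eq_norm]; exact hK x y
  -- The bound `L` on the field keeps a solution in the ball of radius `L (n + 1)` for times up to
  -- `n + 1`, so each window is reached in one application.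
  have hex : ∀ (x : V) (n : ℕ), ∃ α : ℝ → V, α 0 = x ∧
      ∀ t ∈ Ioo (-(n + 1 : ℝ)) (n + 1), HasDerivAt α (X (α t)) t := by
    intro x n
    have hn : (0 : ℝ) ∈ Icc (-(n + 1 : ℝ)) (n + 1) := by
      constructor <;> linarith [n.cast_nonneg (α := ℝ)]
    have ha0 : 0 ≤ L * (n + 1) := by positivity
    have hpl : IsPicardLindelof (fun _ => X) ⟨0, hn⟩ x ⟨_, ha0⟩ 0 ⟨_, hL0⟩ ⟨_, hK0⟩ := by
      refine ⟨fun t ht => hlip.lipschitzOnWith, fun x _ => continuousOn_const,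
        fun t ht x _ => hL x, ?_⟩
      simp only [sub_zero, zero_sub, neg_neg, max_self, NNReal.coe_zero]
      exact le_rfl
    obtain ⟨α, h1, h2⟩ := hpl.exists_eq_forall_mem_Icc_hasDerivWithinAt₀
    exact ⟨α, h1, fun t ht => (h2 t (Ioo_subset_Icc_self ht)).hasDerivAt (Icc_mem_nhds ht.1 ht.2)⟩
  choose α hα0 hα using hex
  have huniq : ∀ (x : V) (n m : ℕ), n ≤ m → EqOn (α x n) (α x m) (Ioo (-(n + 1 : ℝ)) (n + 1)) := by
    intro x n m hnm
    have hnm' : (n : ℝ) ≤ m := by exact_mod_cast hnm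
    have hn0 : (0 : ℝ) ≤ n := n.cast_nonneg
    refine ODE_solution_unique_of_mem_Ioo (v := fun _ => X) (s := fun _ => univ)
      (t₀ := 0) (fun t _ => hlip.lipschitzOnWith) (by constructor <;> linarith)
      (fun t ht => ⟨hα x n t ht, trivial⟩)
      (fun t ht => ⟨hα x m t ⟨by linarith [ht.1], by linarith [ht.2]⟩, trivial⟩) ?_
    rw [hα0, hα0]
  refine ⟨fun t x => α x ⌈|t|⌉₊ t, fun x => ⟨by simp [hα0], fun t => ?_⟩⟩
  have hmem : ∀ s : ℝ, ∀ n : ℕ, |s| ≤ n → s ∈ Ioo (-(n + 1 : ℝ)) (n + 1) := fun s n h => by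
    rw [abs_le] at h; constructor <;> linarith [h.1, h.2]
  -- One unit more than the window used at time `t`: this single solution agrees with the glued
  -- curve for all `|s| < |t| + 1`, hence near `t`.
  set N := ⌈|t|⌉₊ + 1 with hN
  have ht : |t| ≤ N := (Nat.le_ceil _).trans (by simp [hN])
  have hev : (fun s => α x ⌈|s|⌉₊ s) =ᶠ[nhds t] α x N := by
    have : ∀ᶠ s in nhds t, |s| < |t| + 1 :=
      continuous_abs.continuousAt.eventually_lt continuousAt_const (by simp)
    filter_upwards [this] with s hs
    refine huniq x _ _ ?_ (hmem s _ (Nat.le_ceil _))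
    refine Nat.ceil_le.2 (hs.le.trans ?_)
    rw [hN]; push_cast; gcongr; exact Nat.le_ceil _
  have h1 := (hα x N t (hmem t N ht)).congr_of_eventuallyEq hev
  rwa [← hev.self_of_nhds] at h1

/-- Second-order Taylor estimate. -/
theorem UnifBdd.taylor {F : ι → E → V} {n : ℕ} (h : UnifBdd (n + 1) F) :
    ∃ C, 0 ≤ C ∧ ∀ i x z, ‖F i z - F i x - fderiv ℝ (F i) x (z - x)‖ ≤ C * ‖z - x‖ ^ 2 := by
  obtain ⟨C, hC0, hC⟩ := h.2.2.lipschitz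
  refine ⟨C, hC0, fun i x z => ?_⟩
  have := (convex_segment x z).norm_image_sub_le_of_norm_fderiv_le' (𝕜 := ℝ) (f := F i)
    (φ := fderiv ℝ (F i) x) (C := C * ‖z - x‖) (fun y _ => h.2.1 i y) (fun y hy => ?_)
    (left_mem_segment ℝ x z) (right_mem_segment ℝ x z)
  · rwa [mul_assoc, ← sq] at this
  · refine (hC i y x).trans (mul_le_mul_of_nonneg_left ?_ hC0)
    obtain ⟨a, b, ha, hb, hab, rfl⟩ := hy
    have : a • x + b • z - x = b • (z - x) := by
      rw [← eq_sub_iff_add_eq] at hab; subst hab; module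
    rw [this, norm_smul, Real.norm_eq_abs, abs_of_nonneg hb]
    exact mul_le_of_le_one_left (norm_nonneg _) (by linarith)

/-- If a family is pointwise continuous in a parameter and uniformly bounded in `C^{1,1}`, then
its derivative is pointwise continuous in the parameter. -/
theorem UnifBdd.continuous_fderiv [FiniteDimensional ℝ E] {T : Type*} [TopologicalSpace T]
    {F : T → E → V} {n : ℕ} (h : UnifBdd (n + 1) F) (hc : ∀ x, Continuous fun t => F t x) (x : E) :
    Continuous fun t => fderiv ℝ (F t) x := by
  rw [continuous_clm_apply]
  intro v
  obtain ⟨C, hC0, hC⟩ := h.taylor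
  refine continuous_of_uniform_approx_of_continuous fun u hu => ?_
  obtain ⟨e, he, hu⟩ := Metric.mem_uniformity_dist.1 hu
  -- The difference quotient with step `r` differs from the derivative by at most `r C ‖v‖²`,
  -- uniformly in `t`, and this `r` makes that less than the tolerance. The derivative is thus a
  -- uniform limit of functions continuous in `t`.
  set r : ℝ := e / (C * ‖v‖ ^ 2 + 1) / 2 with hr
  have hr0 : 0 < r := by positivity
  refine ⟨fun t => r⁻¹ • (F t (x + r • v) - F t x), ((hc _).sub (hc _)).const_smul _,
    fun t => hu ?_⟩
  have h1 := hC t x (x + r • v)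
  rw [add_sub_cancel_left, map_smul] at h1
  rw [dist_eq_norm, norm_sub_rev]
  have e1 : r⁻¹ • (F t (x + r • v) - F t x) - fderiv ℝ (F t) x v =
      r⁻¹ • (F t (x + r • v) - F t x - r • fderiv ℝ (F t) x v) := by
    rw [smul_sub _ _ (r • _), inv_smul_smul₀ hr0.ne']
  rw [e1, norm_smul, norm_inv, Real.norm_eq_abs, abs_of_pos hr0]
  rw [norm_smul, Real.norm_eq_abs, abs_of_pos hr0] at h1
  calc r⁻¹ * ‖F t (x + r • v) - F t x - r • fderiv ℝ (F t) x v‖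
      ≤ r⁻¹ * (C * (r * ‖v‖) ^ 2) := by gcongr
    _ = r * (C * ‖v‖ ^ 2) := by field_simp
    _ < r * (C * ‖v‖ ^ 2 + 1) := by gcongr; linarith
    _ = e / 2 := by rw [hr]; field_simp
    _ < e := by linarith

/-- Differentiability of solutions with respect to a parameter: a solution of the variational
equation is the derivative of the solution. -/
theorem hasFDerivAt_of_variation {y y' : ℝ → E → V} {v : ℝ → E →L[ℝ] V} {A : ℝ → V →L[ℝ] V}
    {B : ℝ → E →L[ℝ] V} {x : E} {K C : ℝ} (hK0 : 0 ≤ K) (hC0 : 0 ≤ C)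
    (hy : ∀ z, ∀ t ∈ Icc (0 : ℝ) 1, HasDerivWithinAt (fun s => y s z) (y' t z) (Icc 0 1) t)
    (hv : ∀ t ∈ Icc (0 : ℝ) 1, HasDerivWithinAt v ((A t).comp (v t) + B t) (Icc 0 1) t)
    (hA : ∀ t ∈ Icc (0 : ℝ) 1, ‖A t‖ ≤ K)
    (h : ∀ t ∈ Icc (0 : ℝ) 1, ∀ z,
      ‖y' t z - y' t x - A t (y t z - y t x) - B t (z - x)‖ ≤ C * ‖z - x‖ ^ 2)
    (h0 : ∀ z, ‖y 0 z - y 0 x - v 0 (z - x)‖ ≤ C * ‖z - x‖ ^ 2) {t : ℝ}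
    (ht : t ∈ Icc (0 : ℝ) 1) : HasFDerivAt (y t) (v t) x := by
  -- The error of the linear approximation satisfies the linear equation up to a forcing term
  -- quadratic in `z - x`, so Grönwall keeps it quadratic.
  have key : ∀ z, ‖y t z - y t x - v t (z - x)‖ ≤
      2 * C * Real.exp (K + 1) * ‖z - x‖ ^ 2 := by
    intro z
    have h1 := norm_le_of_norm_deriv_le (y := fun s => y s z - y s x - v s (z - x))
      (y' := fun s => y' s z - y' s x - ((A s).comp (v s) + B s) (z - x)) (K := K)
      (c := C * ‖z - x‖ ^ 2) hK0 (by positivity)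
      (fun t ht => ((hy z t ht).sub (hy x t ht)).sub
        ((ContinuousLinearMap.apply ℝ V (z - x)).hasFDerivAt.comp_hasDerivWithinAt t (hv t ht)))
      (fun t ht => ?_) ht
    · refine h1.trans ?_
      have := mul_le_mul_of_nonneg_right (h0 z) (Real.exp_pos (K + 1)).le
      rw [add_mul]
      linarith
    · have e : y' t z - y' t x - ((A t).comp (v t) + B t) (z - x) =
          A t (y t z - y t x - v t (z - x)) +
            (y' t z - y' t x - A t (y t z - y t x) - B t (z - x)) := by
        simp [map_sub]; abel
      rw [e]
      exact (norm_add_le _ _).trans (add_le_add ((A t).le_of_opNorm_le (hA t ht) _) (h t ht z))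
  rw [hasFDerivAt_iff_isLittleO]
  refine Asymptotics.IsBigO.trans_isLittleO (g := fun z => ‖z - x‖ ^ 2)
    (Asymptotics.IsBigO.of_bound (2 * C * Real.exp (K + 1)) ?_) ?_
  · filter_upwards with z
    simpa using key z
  · have := Asymptotics.isLittleO_norm_pow_id (E' := E) one_lt_two
    have h2 : Filter.Tendsto (fun z => z - x) (nhds x) (nhds 0) := by
      have h3 : Continuous fun z : E => z - x := by fun_prop
      simpa using h3.tendsto x
    exact this.comp_tendsto h2

/-- Regularity of solutions of linear equations with respect to a parameter. -/
theorem unifBdd_linear_ode [FiniteDimensional ℝ E] {n : ℕ} :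
    ∀ {V : Type} [NormedAddCommGroup V] [NormedSpace ℝ V] [CompleteSpace V]
    {A : ι → ℝ → E → V →L[ℝ] V} {b w : ι → ℝ → E → V},
    UnifBdd n (fun (a : ι × Icc (0 : ℝ) 1) x => A a.1 a.2 x) →
    UnifBdd n (fun (a : ι × Icc (0 : ℝ) 1) x => b a.1 a.2 x) →
    UnifBdd n (fun i x => w i 0 x) →
    (∀ i x, ContinuousOn (fun t => A i t x) (Icc 0 1)) →
    (∀ i x, ContinuousOn (fun t => b i t x) (Icc 0 1)) →
    (∀ i x, ∀ t ∈ Icc (0 : ℝ) 1,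
      HasDerivWithinAt (fun s => w i s x) (A i t x (w i t x) + b i t x) (Icc 0 1) t) →
    UnifBdd n (fun (a : ι × Icc (0 : ℝ) 1) x => w a.1 a.2 x) := by
  have bdd : ∀ {n : ℕ} {V : Type} [NormedAddCommGroup V] [NormedSpace ℝ V]
      {A : ι → ℝ → E → V →L[ℝ] V} {b w : ι → ℝ → E → V},
      UnifBdd n (fun (a : ι × Icc (0 : ℝ) 1) x => A a.1 a.2 x) →
      UnifBdd n (fun (a : ι × Icc (0 : ℝ) 1) x => b a.1 a.2 x) →
      UnifBdd n (fun i x => w i 0 x) →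
      (∀ i x, ∀ t ∈ Icc (0 : ℝ) 1,
        HasDerivWithinAt (fun s => w i s x) (A i t x (w i t x) + b i t x) (Icc 0 1) t) →
      ∃ C, 0 ≤ C ∧ ∀ (a : ι × Icc (0 : ℝ) 1) x, ‖w a.1 a.2 x‖ ≤ C := by
    intro n V _ _ A b w hA hb hw0 hw
    obtain ⟨CA, hCA0, hCA⟩ := hA.bounded
    obtain ⟨Cb, hCb0, hCb⟩ := hb.bounded
    obtain ⟨C0, hC00, hC0⟩ := hw0.bounded
    refine ⟨(C0 + Cb) * Real.exp (CA + 1), by positivity, fun a x => ?_⟩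
    refine (norm_le_of_norm_deriv_le hCA0 hCb0 (hw a.1 x) (fun t ht => ?_) a.2.2).trans ?_
    · exact (norm_add_le _ _).trans (add_le_add ((A a.1 t x).le_of_opNorm_le
        (hCA (a.1, ⟨t, ht⟩) x) _) (hCb (a.1, ⟨t, ht⟩) x))
    · gcongr
      exact hC0 _ _
  induction n with
  | zero =>
    intro V _ _ _ A b w hA hb hw0 hAc hbc hw
    obtain ⟨CA, hCA0, hCA⟩ := hA.bounded
    obtain ⟨KA, hKA0, hKA⟩ := hA.lipschitz
    obtain ⟨Kb, hKb0, hKb⟩ := hb.lipschitz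
    obtain ⟨K0, hK00, hK0⟩ := hw0.lipschitz
    obtain ⟨M, hM0, hM⟩ := bdd hA hb hw0 hw
    refine unifBdd_zero_of (K := (K0 + (KA * M + Kb)) * Real.exp (CA + 1)) hM fun a x z => ?_
    have h1 := norm_le_of_norm_deriv_le (K := CA) (c := (KA * M + Kb) * ‖x - z‖) hCA0
      (by positivity) (fun t ht => (hw a.1 x t ht).sub (hw a.1 z t ht)) (fun t ht => ?_) a.2.2
    · refine h1.trans ?_
      have := hK0 a.1 x z
      calc _ ≤ (K0 * ‖x - z‖ + (KA * M + Kb) * ‖x - z‖) * Real.exp (CA + 1) := by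
            gcongr
            simpa using this
        _ = _ := by ring
    · have e : A a.1 t x (w a.1 t x) + b a.1 t x - (A a.1 t z (w a.1 t z) + b a.1 t z) =
          A a.1 t x (w a.1 t x - w a.1 t z) + ((A a.1 t x - A a.1 t z) (w a.1 t z) +
            (b a.1 t x - b a.1 t z)) := by
        simp [map_sub]; abel
      rw [e]
      refine (norm_add_le _ _).trans (add_le_add ((A a.1 t x).le_of_opNorm_le
        (hCA (a.1, ⟨t, ht⟩) x) _) ((norm_add_le _ _).trans ?_))
      rw [add_mul]
      refine add_le_add ?_ (hKb (a.1, ⟨t, ht⟩) x z)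
      calc _ ≤ KA * ‖x - z‖ * M := ContinuousLinearMap.le_of_opNorm_le_of_le _
            (hKA (a.1, ⟨t, ht⟩) x z) (hM (a.1, ⟨t, ht⟩) z)
        _ = _ := by ring
  | succ n ih =>
    intro V _ _ _ A b w hA hb hw0 hAc hbc hw
    -- The induction hypothesis is used twice: here for `w`, which enters the inhomogeneity of the
    -- differentiated equation, and at the end for the derivative of `w` itself.
    have hwn := ih hA.of_succ hb.of_succ hw0.of_succ hAc hbc hw
    have hAc' : ∀ i x, ContinuousOn (fun t => fderiv ℝ (A i t) x) (Icc 0 1) := fun i x => by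
      rw [continuousOn_iff_continuous_domRestrict]
      exact (hA.reindex fun t : Icc (0 : ℝ) 1 => (i, t)).continuous_fderiv
        (fun x => continuousOn_iff_continuous_domRestrict.1 (hAc i x)) x
    have hbc' : ∀ i x, ContinuousOn (fun t => fderiv ℝ (b i t) x) (Icc 0 1) := fun i x => by
      rw [continuousOn_iff_continuous_domRestrict]
      exact (hb.reindex fun t : Icc (0 : ℝ) 1 => (i, t)).continuous_fderiv
        (fun x => continuousOn_iff_continuous_domRestrict.1 (hbc i x)) x
    have hwc : ∀ i x, ContinuousOn (fun t => w i t x) (Icc 0 1) := fun i x t ht =>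
      (hw i x t ht).continuousWithinAt
    -- Differentiating the equation in `x` gives again a linear equation, with coefficient `A`
    -- acting by composition and inhomogeneity `(DA) w + Db`. Its solution `v` is constructed
    -- independently and afterwards identified with the derivative.
    set A' : ι → ℝ → E → (E →L[ℝ] V) →L[ℝ] (E →L[ℝ] V) := fun i t x =>
      ContinuousLinearMap.compL ℝ E V V (A i t x) with hA'
    set B : ι → ℝ → E → E →L[ℝ] V := fun i t x =>
      (ContinuousLinearMap.flipₗᵢ ℝ E V V (fderiv ℝ (A i t) x)) (w i t x) + fderiv ℝ (b i t) x
      with hB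
    have hA'c : ∀ i x, ContinuousOn (fun t => A' i t x) (Icc 0 1) := fun i x =>
      (ContinuousLinearMap.compL ℝ E V V).continuous.comp_continuousOn (hAc i x)
    have hBc : ∀ i x, ContinuousOn (fun t => B i t x) (Icc 0 1) := fun i x =>
      (((ContinuousLinearMap.flipₗᵢ ℝ E V V).continuous.comp_continuousOn
        (hAc' i x)).clm_apply (hwc i x)).add (hbc' i x)
    have hex : ∀ i x, ∃ v : ℝ → E →L[ℝ] V, v 0 = fderiv ℝ (w i 0) x ∧ ∀ t ∈ Icc (0 : ℝ) 1,
        HasDerivWithinAt v (A' i t x (v t) + B i t x) (Icc 0 1) t := fun i x =>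
      exists_linear_solution (hA'c i x) (hBc i x) _
    choose v hv0 hv using hex
    obtain ⟨CA, hCA0, hCA⟩ := hA.bounded
    obtain ⟨KA, hKA0, hKA⟩ := hA.lipschitz
    obtain ⟨TA, hTA0, hTA⟩ := hA.taylor
    obtain ⟨Tb, hTb0, hTb⟩ := hb.taylor
    obtain ⟨T0, hT00, hT0⟩ := hw0.taylor
    obtain ⟨M, hM0, hM⟩ := hwn.bounded
    obtain ⟨Kw, hKw0, hKw⟩ := hwn.lipschitz
    have hder : ∀ i x, ∀ t ∈ Icc (0 : ℝ) 1, HasFDerivAt (w i t) (v i x t) x := by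
      intro i x t ht
      refine hasFDerivAt_of_variation (K := CA) (C := KA * Kw + TA * M + Tb + T0) hCA0
        (by positivity) (hw i) (hv i x) (fun t ht => hCA (i, ⟨t, ht⟩) x) (fun t ht z => ?_)
        (fun z => ?_) ht
      -- The linearization error is a product of two first-order increments plus the Taylor
      -- remainders of `A` and `b`; all three are quadratic.
      · have e : A i t z (w i t z) + b i t z - (A i t x (w i t x) + b i t x) -
            A i t x (w i t z - w i t x) - B i t x (z - x) =
            (A i t z - A i t x) (w i t z - w i t x) +
            (A i t z - A i t x - fderiv ℝ (A i t) x (z - x)) (w i t x) +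
            (b i t z - b i t x - fderiv ℝ (b i t) x (z - x)) := by
          simp [hB, map_sub]; abel
        rw [e]
        have e1 : ‖(A i t z - A i t x) (w i t z - w i t x)‖ ≤ KA * Kw * ‖z - x‖ ^ 2 := by
          calc _ ≤ (KA * ‖z - x‖) * (Kw * ‖z - x‖) :=
                ContinuousLinearMap.le_of_opNorm_le_of_le _ (hKA (i, ⟨t, ht⟩) z x)
                  (hKw (i, ⟨t, ht⟩) z x)
            _ = _ := by ring
        have e2 : ‖(A i t z - A i t x - fderiv ℝ (A i t) x (z - x)) (w i t x)‖ ≤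
            TA * M * ‖z - x‖ ^ 2 := by
          calc _ ≤ (TA * ‖z - x‖ ^ 2) * M :=
                ContinuousLinearMap.le_of_opNorm_le_of_le _ (hTA (i, ⟨t, ht⟩) x z)
                  (hM (i, ⟨t, ht⟩) x)
            _ = _ := by ring
        have e3 := hTb (i, ⟨t, ht⟩) x z
        have e4 : 0 ≤ T0 * ‖z - x‖ ^ 2 := by positivity
        calc _ ≤ KA * Kw * ‖z - x‖ ^ 2 + TA * M * ‖z - x‖ ^ 2 + Tb * ‖z - x‖ ^ 2 :=
              (norm_add_le _ _).trans (add_le_add ((norm_add_le _ _).trans (add_le_add e1 e2)) e3)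
          _ ≤ _ := by linarith
      · rw [hv0]
        refine (hT0 i x z).trans ?_
        gcongr
        have : 0 ≤ KA * Kw + TA * M + Tb := by positivity
        linarith
    obtain ⟨C, -, hC⟩ := bdd hA hb hw0 hw
    refine ⟨⟨C, hC⟩, fun a x => (hder a.1 x a.2 a.2.2).differentiableAt, ?_⟩
    have hA'n : UnifBdd n (fun (a : ι × Icc (0 : ℝ) 1) x => A' a.1 a.2 x) :=
      hA.of_succ.clm (W := (E →L[ℝ] V) →L[ℝ] (E →L[ℝ] V)) (ContinuousLinearMap.compL ℝ E V V)
    have hBn : UnifBdd n (fun (a : ι × Icc (0 : ℝ) 1) x => B a.1 a.2 x) :=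
      (UnifBdd.bilin (ContinuousLinearMap.flipₗᵢ ℝ E V
        V).toContinuousLinearEquiv.toContinuousLinearMap hA.2.2 hwn).add hb.2.2
    have hfin := ih (A := A') (b := B) (w := fun i t x => v i x t) hA'n hBn (by simpa only [hv0] using hw0.2.2) hA'c hBc hv
    convert hfin using 3 with a x
    exact (hder a.1 x a.2 a.2.2).fderiv

/-- A time integral of a uniformly bounded family is uniformly bounded. -/
theorem unifBdd_of_hasDerivWithinAt [FiniteDimensional ℝ E] [CompleteSpace V] {n : ℕ}
    {b w : ι → ℝ → E → V}
    (hb : UnifBdd n (fun (a : ι × Icc (0 : ℝ) 1) x => b a.1 a.2 x))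
    (hbc : ∀ i x, ContinuousOn (fun t => b i t x) (Icc 0 1)) (hw0 : ∀ i x, w i 0 x = 0)
    (hw : ∀ i x, ∀ t ∈ Icc (0 : ℝ) 1,
      HasDerivWithinAt (fun s => w i s x) (b i t x) (Icc 0 1) t) :
    UnifBdd n (fun (a : ι × Icc (0 : ℝ) 1) x => w a.1 a.2 x) := by
  refine unifBdd_linear_ode (A := fun _ _ _ => 0) (unifBdd_const (C := 0) (by simp)) hb ?_
    (fun _ _ => continuousOn_const) hbc (by simpa using hw)
  simp only [hw0]
  exact unifBdd_const (c := fun _ : ι => (0 : V)) (C := 0) (by simp)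

/-- The flow of a uniformly bounded family of vector fields: the derivative in the initial point
solves the variational equation, and all derivatives are uniformly bounded up to time one. -/
theorem flow_regularity [FiniteDimensional ℝ E] {X : ι → E → E} (hX : ∀ n, UnifBdd n X)
    {Φ : ι → ℝ → E → E} (h0 : ∀ i x, Φ i 0 x = x)
    (hΦ : ∀ i x, ∀ t ∈ Icc (0 : ℝ) 1,
      HasDerivWithinAt (fun s => Φ i s x) (X i (Φ i t x)) (Icc 0 1) t) :
    (∀ n, UnifMap n (fun (a : ι × Icc (0 : ℝ) 1) x => Φ a.1 a.2 x)) ∧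
    ∀ i x, ∀ t ∈ Icc (0 : ℝ) 1, HasDerivWithinAt (fun s => fderiv ℝ (Φ i s) x)
      ((fderiv ℝ (X i) (Φ i t x)).comp (fderiv ℝ (Φ i t) x)) (Icc 0 1) t := by
  have : CompleteSpace E := FiniteDimensional.complete ℝ E
  obtain ⟨K, hK0, hK⟩ := (hX 0).lipschitz
  have hlip : UnifMap 0 (fun (a : ι × Icc (0 : ℝ) 1) x => Φ a.1 a.2 x) := by
    refine ⟨Real.exp (K + 1), (Real.exp_pos _).le, fun a x y => ?_⟩
    have := norm_le_of_norm_deriv_le (K := K) (c := 0) hK0 le_rfl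
      (fun t ht => (hΦ a.1 x t ht).sub (hΦ a.1 y t ht)) (fun t ht => by
        simpa using hK a.1 (Φ a.1 t x) (Φ a.1 t y)) a.2.2
    simpa [h0, mul_comm] using this
  have hXc : ∀ i, Continuous (fderiv ℝ (X i)) := fun i =>
    ((fderiv_unifBdd hX 0).contDiff i).continuous
  have hΦc : ∀ i x, ContinuousOn (fun t => Φ i t x) (Icc 0 1) := fun i x t ht =>
    (hΦ i x t ht).continuousWithinAt
  set A : ι → ℝ → E → E →L[ℝ] E := fun i t x => fderiv ℝ (X i) (Φ i t x) with hA
  have hAc : ∀ i x, ContinuousOn (fun t => A i t x) (Icc 0 1) := fun i x =>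
    (hXc i).comp_continuousOn (hΦc i x)
  have hex : ∀ i x, ∃ v : ℝ → E →L[ℝ] E, v 0 = ContinuousLinearMap.id ℝ E ∧
      ∀ t ∈ Icc (0 : ℝ) 1, HasDerivWithinAt v
        (ContinuousLinearMap.compL ℝ E E E (A i t x) (v t) + 0) (Icc 0 1) t := fun i x =>
    exists_linear_solution ((ContinuousLinearMap.compL ℝ E E E).continuous.comp_continuousOn
      (hAc i x)) continuousOn_const _
  choose v hv0 hv using hex
  obtain ⟨CA, hCA0, hCA⟩ := (fderiv_unifBdd hX 0).bounded
  obtain ⟨TX, hTX0, hTX⟩ := (hX 1).taylor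
  obtain ⟨KΦ, hKΦ0, hKΦ⟩ := hlip
  have hder : ∀ i x, ∀ t ∈ Icc (0 : ℝ) 1, HasFDerivAt (Φ i t) (v i x t) x := by
    intro i x t ht
    refine hasFDerivAt_of_variation (K := CA) (C := TX * KΦ ^ 2) (B := fun _ => 0) hCA0
      (by positivity) (hΦ i) (hv i x) (fun t ht => hCA i _) (fun t ht z => ?_) (fun z => ?_) ht
    · have e1 := hTX i (Φ i t x) (Φ i t z)
      have e2 := hKΦ (i, ⟨t, ht⟩) z x
      simp only [zero_apply, sub_zero]
      calc _ ≤ TX * (KΦ * ‖z - x‖) ^ 2 := e1.trans (by gcongr)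
        _ = _ := by ring
    · rw [hv0, h0, h0]
      simp only [ContinuousLinearMap.id_apply, sub_self, norm_zero]
      positivity
  have hfd : ∀ i x, ∀ t ∈ Icc (0 : ℝ) 1, fderiv ℝ (Φ i t) x = v i x t := fun i x t ht =>
    (hder i x t ht).fderiv
  constructor
  · intro n
    induction n with
    | zero => exact ⟨KΦ, hKΦ0, hKΦ⟩
    | succ n ih =>
      refine ⟨fun a x => (hder a.1 x a.2 a.2.2).differentiableAt, ?_⟩
      -- Bootstrap: order `n` for the flow gives order `n` for the coefficient `DX ∘ Φ` of the
      -- variational equation, hence order `n` for `DΦ`, which is order `n + 1` for the flow.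
      have hAn : UnifBdd n (fun (a : ι × Icc (0 : ℝ) 1) x => A a.1 a.2 x) :=
        ((fderiv_unifBdd hX n).reindex (fun a : ι × Icc (0 : ℝ) 1 => a.1)).comp ih
      have hvn := unifBdd_linear_ode (w := fun i t x => v i x t)
        (A := fun i t x => ContinuousLinearMap.compL ℝ E E E (A i t x))
        (b := fun _ _ _ => 0) (hAn.clm (ContinuousLinearMap.compL ℝ E E E))
        (unifBdd_const (C := 0) (by simp))
        (by
          simp only [hv0]
          exact unifBdd_const (c := fun _ : ι => ContinuousLinearMap.id ℝ E)
            (fun _ => le_rfl))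
        (fun i x => (ContinuousLinearMap.compL ℝ E E E).continuous.comp_continuousOn (hAc i x))
        (fun _ _ => continuousOn_const) hv
      convert hvn using 3 with a x
      exact hfd a.1 x a.2 a.2.2
  · intro i x t ht
    have := hv i x t ht
    rw [add_zero, ← hfd i x t ht] at this
    exact this.congr (fun s hs => hfd i x s hs) (hfd i x t ht)

end ODE

/-! ### Symbols as uniformly bounded families in rescaled variables -/

section Symbols

open Set

variable {ι : Type*} {d : ℕ}

instance lawfulBEqSum : LawfulBEq (Fin d ⊕ Fin d) where
  eq_of_beq := by
    rintro (a | a) (b | b) h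
    · exact congrArg _ (eq_of_beq (a := a) (b := b) h)
    · exact absurd h Bool.false_ne_true
    · exact absurd h Bool.false_ne_true
    · exact congrArg _ (eq_of_beq (a := a) (b := b) h)
  rfl := by
    rintro (a | a)
    · exact beq_self_eq_true a
    · exact beq_self_eq_true a

/-- The coordinate directions of `Phase d`: `Sum.inl j` is `p_j` and `Sum.inr j` is `q_j`. -/
def coordDir : Fin d ⊕ Fin d → Phase d
  | Sum.inl j => (Pi.single j 1, 0)
  | Sum.inr j => (0, Pi.single j 1)

/-- The partial derivative in the coordinate direction `a`. -/
def coordDeriv (a : Fin d ⊕ Fin d) (f : Phase d → ℝ) : Phase d → ℝ :=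
  fun x => fderiv ℝ f x (coordDir a)

/-- Iterated partial derivative along a word of coordinate directions. -/
def wordDeriv (w : List (Fin d ⊕ Fin d)) (f : Phase d → ℝ) : Phase d → ℝ :=
  w.foldr coordDeriv f

theorem wordDeriv_append (w w' : List (Fin d ⊕ Fin d)) (f : Phase d → ℝ) :
    wordDeriv (w ++ w') f = wordDeriv w (wordDeriv w' f) := List.foldr_append ..

theorem coordDeriv_contDiff (a : Fin d ⊕ Fin d) {f : Phase d → ℝ} (hf : ContDiff ℝ ∞ f) :
    ContDiff ℝ ∞ (coordDeriv a f) :=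
  (hf.fderiv_right (m := ∞) (by simp)).clm_apply contDiff_const

theorem wordDeriv_contDiff (w : List (Fin d ⊕ Fin d)) {f : Phase d → ℝ} (hf : ContDiff ℝ ∞ f) :
    ContDiff ℝ ∞ (wordDeriv w f) := by
  induction w with
  | nil => exact hf
  | cons a w ih => exact coordDeriv_contDiff a ih

theorem coordDeriv_comm (a b : Fin d ⊕ Fin d) {f : Phase d → ℝ} (hf : ContDiff ℝ ∞ f) :
    coordDeriv a (coordDeriv b f) = coordDeriv b (coordDeriv a f) := by
  have hd : Differentiable ℝ (fderiv ℝ f) :=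
    (hf.fderiv_right (m := ∞) (by simp)).differentiable (by simp)
  have key : ∀ (u v x : Phase d),
      fderiv ℝ (fun y => fderiv ℝ f y u) x v = fderiv ℝ (fderiv ℝ f) x v u := fun u v x => by
    rw [fderiv_clm_apply (hd x) (differentiableAt_const _)]
    simp
  ext x
  have hs : IsSymmSndFDerivAt ℝ f x := (hf.contDiffAt).isSymmSndFDerivAt
    (by
      rw [minSmoothness_of_isRCLikeNormedField]
      exact WithTop.coe_le_coe.2 le_top)
  change fderiv ℝ (fun y => fderiv ℝ f y _) x _ = fderiv ℝ (fun y => fderiv ℝ f y _) x _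
  rw [key, key]
  exact hs.eq _ _

/-- Second derivatives are symmetric, so adjacent letters may be exchanged. Together with
`multiWord_perm` this makes the estimates for `∂_p^α ∂_q^β`, in that fixed order, cover all iterated
partial derivatives. -/
theorem wordDeriv_perm {w w' : List (Fin d ⊕ Fin d)} (h : w.Perm w') {f : Phase d → ℝ}
    (hf : ContDiff ℝ ∞ f) : wordDeriv w f = wordDeriv w' f := by
  induction h with
  | nil => rfl
  | cons a _ ih => exact congrArg (coordDeriv a) ih
  | swap a b l => exact coordDeriv_comm b a (wordDeriv_contDiff l hf)
  | trans _ _ ih ih' => exact ih.trans ih'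

/-- The word of the derivative `∂_p^α ∂_q^β`. -/
def multiWord (α β : Fin d → ℕ) : List (Fin d ⊕ Fin d) :=
  ((List.finRange d).flatMap fun j => List.replicate (α j) (Sum.inl j)) ++
    (List.finRange d).flatMap fun j => List.replicate (β j) (Sum.inr j)

theorem mixedPartial_eq_wordDeriv (α β : Fin d → ℕ) (f : Phase d → ℝ) :
    mixedPartial α β f = wordDeriv (multiWord α β) f := by
  have hP : ∀ (l : List (Fin d)) (g : Phase d → ℝ),
      l.foldr (fun j g => (partialP j)^[α j] g) g =
        wordDeriv (l.flatMap fun j => List.replicate (α j) (Sum.inl j)) g := by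
    intro l g
    induction l with
    | nil => rfl
    | cons j l ih =>
      rw [List.foldr_cons, ih, List.flatMap_cons, wordDeriv_append]
      generalize α j = n
      induction n with
      | zero => rfl
      | succ n ihn => rw [Function.iterate_succ_apply', ihn]; rfl
  have hQ : ∀ (l : List (Fin d)) (g : Phase d → ℝ),
      l.foldr (fun j g => (partialQ j)^[β j] g) g =
        wordDeriv (l.flatMap fun j => List.replicate (β j) (Sum.inr j)) g := by
    intro l g
    induction l with
    | nil => rfl
    | cons j l ih =>
      rw [List.foldr_cons, ih, List.flatMap_cons, wordDeriv_append]
      generalize β j = n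
      induction n with
      | zero => rfl
      | succ n ihn => rw [Function.iterate_succ_apply', ihn]; rfl
  rw [mixedPartial, multiP, multiQ, hP, hQ, multiWord, wordDeriv_append]

theorem sum_finRange_single (j : Fin d) (n : Fin d → ℕ) :
    ((List.finRange d).map fun i => if i = j then n i else 0).sum = n j := by
  rw [← List.ofFn_eq_map, List.sum_ofFn]
  simp

theorem multiWord_perm (w : List (Fin d ⊕ Fin d)) :
    (multiWord (fun j => w.count (Sum.inl j)) fun j => w.count (Sum.inr j)).Perm w := by
  rw [List.perm_iff_count]
  intro a
  rw [multiWord, List.count_append, List.count_flatMap, List.count_flatMap]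
  cases a with
  | inl j =>
    have := sum_finRange_single j fun j => w.count (Sum.inl j)
    simpa [Function.comp_def, List.count_replicate, Sum.inl.injEq] using this
  | inr j =>
    have := sum_finRange_single j fun j => w.count (Sum.inr j)
    simpa [Function.comp_def, List.count_replicate, Sum.inr.injEq] using this

theorem sum_count_inl (w : List (Fin d ⊕ Fin d)) :
    ∑ j, w.count (Sum.inl j) = w.countP Sum.isLeft := by
  induction w with
  | nil => simp
  | cons a w ih =>
    cases a with
    | inl j => simp [List.count_cons, List.countP_cons, Finset.sum_add_distrib, ih]
    | inr j => simp [ih]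

/-- The linear functional reading off the coordinate `a`. -/
def coordProj : Fin d ⊕ Fin d → (Phase d →L[ℝ] ℝ)
  | Sum.inl j => (ContinuousLinearMap.proj j).comp (ContinuousLinearMap.fst ℝ _ _)
  | Sum.inr j => (ContinuousLinearMap.proj j).comp (ContinuousLinearMap.snd ℝ _ _)

theorem sum_coordProj_smul_coordDir (x : Phase d) : ∑ a, coordProj a x • coordDir a = x := by
  rw [Fintype.sum_sum_type]
  refine Prod.ext ?_ ?_ <;> ext j <;>
    simp [coordProj, coordDir, Finset.sum_apply, Pi.single_apply, Prod.fst_sum, Prod.snd_sum]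

theorem clm_eq_sum_coord {V : Type} [NormedAddCommGroup V] [NormedSpace ℝ V]
    (L : Phase d →L[ℝ] V) :
    L = ∑ a, (coordProj a).smulRight (L (coordDir a)) := by
  refine ContinuousLinearMap.ext fun x => ?_
  conv_lhs => rw [← sum_coordProj_smul_coordDir x]
  simp [map_sum]

universe v in
-- The Fréchet derivative is recovered from finitely many partial derivatives. Adjoining the
-- direction to the index turns these into one family that satisfies the same hypotheses, which is
-- why the index type varies in the induction.
theorem unifBdd_of_wordDeriv {n : ℕ} : ∀ {ι : Type v} {F : ι → Phase d → ℝ},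
    (∀ i, ContDiff ℝ ∞ (F i)) → (∀ w, ∃ C, ∀ i x, |wordDeriv w (F i) x| ≤ C) →
    UnifBdd n F := by
  have hsucc : ∀ {ι : Type v} {F : ι → Phase d → ℝ},
      (∀ i, ContDiff ℝ ∞ (F i)) → (∀ w, ∃ C, ∀ i x, |wordDeriv w (F i) x| ≤ C) →
      ∃ C, ∀ i x, ‖fderiv ℝ (F i) x‖ ≤ C := by
    intro ι F hF h
    choose C hC using h
    refine ⟨∑ a, ‖coordProj (d := d) a‖ * C [a], fun i x => ?_⟩
    rw [clm_eq_sum_coord (fderiv ℝ (F i) x)]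
    refine norm_sum_le_of_le _ fun a _ => ?_
    rw [ContinuousLinearMap.norm_smulRight_apply]
    exact mul_le_mul_of_nonneg_left (hC [a] i x) (norm_nonneg _)
  induction n with
  | zero =>
    intro ι F hF h
    obtain ⟨C, hC⟩ := h []
    obtain ⟨K, hK⟩ := hsucc hF h
    refine unifBdd_zero_of (K := K) hC fun i x y => ?_
    exact Convex.norm_image_sub_le_of_norm_fderiv_le (s := univ)
      (fun z _ => ((hF i).differentiable (by simp)) z)
      (fun z _ => hK i z) convex_univ (mem_univ y) (mem_univ x)
  | succ n ih =>
    intro ι F hF h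
    refine ⟨h [], fun i => (hF i).differentiable (by simp), ?_⟩
    have h1 : UnifBdd n (fun (k : ι × (Fin d ⊕ Fin d)) => coordDeriv k.2 (F k.1)) := by
      refine ih (fun k => coordDeriv_contDiff _ (hF k.1)) fun w => ?_
      choose C hC using h
      refine ⟨∑ a, |C (w ++ [a])|, fun k x => ?_⟩
      have := hC (w ++ [k.2]) k.1 x
      rw [wordDeriv_append] at this
      exact (this.trans (le_abs_self _)).trans (Finset.single_le_sum
        (f := fun a => |C (w ++ [a])|) (fun a _ => abs_nonneg _) (Finset.mem_univ k.2))
    have h2 : UnifBdd n (fun (k : ι × (Fin d ⊕ Fin d)) x =>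
        coordDeriv k.2 (F k.1) x • coordProj (d := d) k.2) :=
      h1.smul (unifBdd_const (C := ∑ a, ‖coordProj (d := d) a‖) fun k =>
        Finset.single_le_sum (f := fun a => ‖coordProj (d := d) a‖) (fun a _ => norm_nonneg _)
          (Finset.mem_univ k.2))
    have h3 := UnifBdd.finset_sum (s := fun _ : ι => Finset.univ) (c := fun _ => 1)
      (M := ∑ _a : Fin d ⊕ Fin d, |(1 : ℝ)|) (fun _ => le_rfl) h2
    convert h3 using 3 with i x
    rw [clm_eq_sum_coord (fderiv ℝ (F i) x)]
    refine Finset.sum_congr rfl fun a _ => ?_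
    refine ContinuousLinearMap.ext fun y => ?_
    simp [NormalFormLemma.coordDeriv, mul_comm]

theorem UnifBdd.coordDeriv {F : ι → Phase d → ℝ} (h : ∀ n, UnifBdd n F) (a : Fin d ⊕ Fin d)
    (n : ℕ) : UnifBdd n (fun i => coordDeriv a (F i)) :=
  (fderiv_unifBdd h n).clm (ContinuousLinearMap.apply ℝ ℝ (coordDir a))

theorem UnifBdd.wordDeriv {F : ι → Phase d → ℝ} (h : ∀ n, UnifBdd n F)
    (w : List (Fin d ⊕ Fin d)) (n : ℕ) : UnifBdd n (fun i => wordDeriv w (F i)) := by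
  induction w generalizing n with
  | nil => exact h n
  | cons a w ih => exact UnifBdd.coordDeriv ih a n

/-! ### Rescaling of the actions -/

/-- The rescaling `(p, q) ↦ (r p, q)`. -/
def scale (r : ℝ) : Phase d →L[ℝ] Phase d :=
  (r • ContinuousLinearMap.id ℝ (Fin d → ℝ)).prodMap (ContinuousLinearMap.id ℝ (Fin d → ℝ))

@[simp] theorem scale_apply (r : ℝ) (x : Phase d) : scale r x = (r • x.1, x.2) := rfl

theorem scale_scale {r s : ℝ} (h : r * s = 1) (x : Phase d) : scale r (scale s x) = x := by
  simp [smul_smul, h]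

theorem coordDeriv_const_mul_comp_scale (a : Fin d ⊕ Fin d) (c r : ℝ) {f : Phase d → ℝ}
    (hf : Differentiable ℝ f) :
    coordDeriv a (fun x => c * f (scale r x)) =
      fun x => c * r ^ (if a.isLeft then 1 else 0) * coordDeriv a f (scale r x) := by
  ext x
  have h1 : HasFDerivAt (fun x => c * f (scale r x)) (c • (fderiv ℝ f (scale r x)).comp (scale r))
      x := ((hf _).hasFDerivAt.comp x (scale r).hasFDerivAt).const_mul c
  rw [coordDeriv, h1.fderiv]
  cases a with
  | inl j =>
    have : scale r (coordDir (Sum.inl j)) = r • coordDir (d := d) (Sum.inl j) := by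
      simp [coordDir]
    simp only [coordDeriv, smul_apply, ContinuousLinearMap.comp_apply, this, map_smul,
      smul_eq_mul, Sum.isLeft_inl, if_true, pow_one]
    ring
  | inr j =>
    have : scale r (coordDir (Sum.inr j)) = coordDir (d := d) (Sum.inr j) := by
      simp [coordDir]
    simp only [coordDeriv, smul_apply, ContinuousLinearMap.comp_apply, this,
      smul_eq_mul, Sum.isLeft_inr]
    simp

theorem wordDeriv_const_mul_comp_scale (w : List (Fin d ⊕ Fin d)) (c r : ℝ) {f : Phase d → ℝ}
    (hf : ContDiff ℝ ∞ f) :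
    wordDeriv w (fun x => c * f (scale r x)) =
      fun x => c * r ^ w.countP Sum.isLeft * wordDeriv w f (scale r x) := by
  induction w with
  | nil => simp [wordDeriv]
  | cons a w ih =>
    change coordDeriv a (wordDeriv w _) = fun x => _ * coordDeriv a (wordDeriv w f) _
    rw [ih, coordDeriv_const_mul_comp_scale a _ _
      ((wordDeriv_contDiff w hf).differentiable (by simp)), List.countP_cons]
    ext x
    rw [pow_add]
    ring

/-- The family `F` satisfies the symbol estimates of order `m` in rescaled variables. -/
structure IsScaledSymbol (ε₀ m : ℝ) (F : ℝ → Phase d → ℝ) : Prop where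
  periodic : ∀ ε ∈ Ioo 0 ε₀, IsPeriodic (F ε)
  bound : ∀ n, UnifBdd n (fun (ε : Ioo 0 ε₀) y => (ε : ℝ) ^ (-m) * F ε y)

theorem isPeriodic_comp_scale {r : ℝ} {f : Phase d → ℝ} (hf : IsPeriodic f) :
    IsPeriodic (fun x => f (scale r x)) := by
  intro k x
  have : scale r (x + shift k) = scale r x + shift k := by
    simp [shift]
  simp only [this, hf k]

theorem IsScaledSymbol.contDiff {ε₀ m : ℝ} {F : ℝ → Phase d → ℝ} (h : IsScaledSymbol ε₀ m F)
    {ε : ℝ} (hε : ε ∈ Ioo 0 ε₀) : ContDiff ℝ ∞ (F ε) := by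
  have h1 := (contDiff_of_unifBdd h.bound ⟨ε, hε⟩).const_smul (ε ^ m)
  have : ε ^ m * ε ^ (-m) = 1 := by
    rw [← Real.rpow_add hε.1, add_neg_cancel, Real.rpow_zero]
  convert h1 using 2 with x
  simp [← mul_assoc, this]

/-- Each derivative in `p` of the rescaled function produces one factor `ε^δ`, so the weight
`ε^{|α|δ}` of the symbol estimates is exactly absorbed and `δ` leaves the bounds. -/
theorem isSymbol_iff_isScaledSymbol {ε₀ δ m : ℝ} {f : ℝ → Phase d → ℝ} :
    IsSymbol ε₀ δ m f ↔ IsScaledSymbol ε₀ m (fun ε y => f ε (scale (ε ^ δ) y)) := by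
  have key : ∀ ε ∈ Ioo 0 ε₀, ContDiff ℝ ∞ (f ε) → ∀ (w : List (Fin d ⊕ Fin d)) (y : Phase d),
      wordDeriv w (fun y => ε ^ (-m) * f ε (scale (ε ^ δ) y)) y =
        wordDeriv w (f ε) (scale (ε ^ δ) y) / ε ^ m *
          ε ^ (((w.countP Sum.isLeft : ℕ) : ℝ) * δ) := by
    intro ε hε hf w y
    rw [wordDeriv_const_mul_comp_scale w _ _ hf, Real.rpow_neg hε.1.le,
      mul_comm (_ : ℝ) δ, Real.rpow_mul hε.1.le, Real.rpow_natCast]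
    field_simp
  have hsc : ∀ ε ∈ Ioo 0 ε₀, ε ^ δ * ε ^ (-δ) = 1 := fun ε hε => by
    rw [← Real.rpow_add hε.1, add_neg_cancel, Real.rpow_zero]
  constructor
  · intro h
    refine ⟨fun ε hε => isPeriodic_comp_scale (h.periodic ε hε), fun n => ?_⟩
    refine unifBdd_of_wordDeriv (fun ε => contDiff_const.mul
      ((h.smooth ε ε.2).comp (scale _).contDiff)) fun w => ?_
    obtain ⟨C, -, hC⟩ := h.bound (fun j => w.count (Sum.inl j)) fun j => w.count (Sum.inr j)
    refine ⟨C, fun ε x => ?_⟩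
    rw [key ε ε.2 (h.smooth ε ε.2)]
    have := hC ε ε.2 (scale ((ε : ℝ) ^ δ) x)
    rwa [mixedPartial_eq_wordDeriv, wordDeriv_perm (multiWord_perm w) (h.smooth ε ε.2),
      sum_count_inl] at this
  · intro h
    have hs : ∀ ε ∈ Ioo 0 ε₀, ContDiff ℝ ∞ (f ε) := fun ε hε => by
      have := (h.contDiff hε).comp (scale (d := d) (ε ^ (-δ))).contDiff
      convert this using 1
      ext x
      simp only [Function.comp, scale_scale (hsc ε hε)]
    refine ⟨hs, fun ε hε => ?_, fun α β => ?_⟩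
    · have := isPeriodic_comp_scale (r := ε ^ (-δ)) (h.periodic ε hε)
      simpa only [scale_scale (hsc ε hε)] using this
    · obtain ⟨C, hC0, hC⟩ := (UnifBdd.wordDeriv h.bound (multiWord α β) 0).bounded
      refine ⟨C + 1, by positivity, fun ε hε x => ?_⟩
      have h1 := hC ⟨ε, hε⟩ (scale (ε ^ (-δ)) x)
      simp only [key ε hε (hs ε hε), scale_scale (hsc ε hε)] at h1
      have h2 : (multiWord α β).countP Sum.isLeft = ∑ j, α j := by
        rw [multiWord, List.countP_append, List.countP_flatMap, List.countP_flatMap]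
        have e1 : (List.countP Sum.isLeft ∘ fun j : Fin d =>
            List.replicate (α j) (Sum.inl j : Fin d ⊕ Fin d)) = α := by
          ext j; simp [List.countP_replicate]
        have e2 : (List.countP Sum.isLeft ∘ fun j : Fin d =>
            List.replicate (β j) (Sum.inr j : Fin d ⊕ Fin d)) = fun _ => 0 := by
          ext j; simp [List.countP_replicate]
        rw [e1, e2, ← List.ofFn_eq_map, List.sum_ofFn]
        simp
      rw [h2] at h1
      rw [mixedPartial_eq_wordDeriv]
      exact h1.trans (by linarith)

end Symbols

/-! ### Averages over the torus -/

section BoxAvg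

open Set MeasureTheory

open scoped Pointwise

attribute [local instance] instMeasureSpaceUnitAddCircle

variable {d : ℕ} {V : Type*} [NormedAddCommGroup V] [NormedSpace ℝ V]

/-- The mean of `f` over `[0, 2π]^d`. -/
def boxAvg (f : (Fin d → ℝ) → V) : V :=
  (1 / (2 * Real.pi) ^ d : ℝ) • ∫ q in Icc (0 : Fin d → ℝ) (fun _ => 2 * Real.pi), f q

/-- `f` is a function on `𝕋^d`. -/
def TorusPeriodic {V : Type*} (f : (Fin d → ℝ) → V) : Prop :=
  ∀ (k : Fin d → ℤ) (θ : Fin d → ℝ), f (θ + fun j => 2 * Real.pi * (k j : ℝ)) = f θ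

/-- The function on `(ℝ/ℤ)^d` induced by a function of `2πℤ^d`-periodic variables. -/
def torusLift {V : Type*} (f : (Fin d → ℝ) → V) : UnitAddTorus (Fin d) → V :=
  fun t => f (fun j => 2 * Real.pi * (AddCircle.equivIoc (1 : ℝ) 0 (t j)).1)

theorem torusLift_coe {V : Type*} {f : (Fin d → ℝ) → V} (hf : TorusPeriodic f) (u : Fin d → ℝ) :
    torusLift f (fun j => (u j : UnitAddCircle)) = f (fun j => 2 * Real.pi * u j) := by
  have h : ∀ j, ∃ k : ℤ, (AddCircle.equivIoc (1 : ℝ) 0 (u j : UnitAddCircle)).1 = u j + k := by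
    intro j
    have h1 : ((AddCircle.equivIoc (1 : ℝ) 0 (u j : UnitAddCircle)).1 : UnitAddCircle) = u j :=
      AddCircle.coe_equivIoc
    obtain ⟨k, hk⟩ := AddSubgroup.mem_zmultiples_iff.1 (QuotientAddGroup.eq.1 h1.symm)
    refine ⟨k, ?_⟩
    simp at hk
    linarith
  choose k hk using h
  rw [torusLift, ← hf k (fun j => 2 * Real.pi * u j)]
  congr 1
  ext j
  simp only [hk, Pi.add_apply]
  ring

/-- The change of variable `θ = 2πu` identifies the mean over the box with the integral over the
unit torus, which gives access to invariance of Haar measure and to Fourier series. -/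
theorem boxAvg_eq_integral_torusLift (f : (Fin d → ℝ) → V) :
    boxAvg f = ∫ t, torusLift f t := by
  have h2 : (0 : ℝ) < 2 * Real.pi := Real.two_pi_pos
  rw [UnitAddTorus.integral_preimage _ (0 : Fin d → ℝ)]
  have hset : {x : Fin d → ℝ | ∀ i, x i ∈ Ioc ((0 : Fin d → ℝ) i) ((0 : Fin d → ℝ) i + 1)} =
      univ.pi fun _ => Ioc (0 : ℝ) 1 := by
    ext x; simp
  have e1 : ∫ x in univ.pi fun _ : Fin d => Ioc (0 : ℝ) 1,
      torusLift f (fun i => (x i : UnitAddCircle)) =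
      ∫ x in univ.pi fun _ : Fin d => Ioc (0 : ℝ) 1, f ((2 * Real.pi) • x) := by
    refine setIntegral_congr_fun (MeasurableSet.univ_pi fun _ => measurableSet_Ioc) fun x hx => ?_
    simp only [torusLift]
    congr 1
    ext j
    have : x j ∈ Ioc (0 : ℝ) (0 + 1) := by simpa using hx j (mem_univ j)
    rw [AddCircle.equivIoc_coe_of_mem this]
    rfl
  rw [hset, e1, Measure.setIntegral_comp_smul_of_pos _ _ _ h2, boxAvg]
  have e2 : (2 * Real.pi) • (univ.pi fun _ : Fin d => Ioc (0 : ℝ) 1) =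
      univ.pi fun _ : Fin d => Ioc (0 : ℝ) (2 * Real.pi) := by
    ext x
    rw [mem_smul_set_iff_inv_smul_mem₀ h2.ne']
    simp only [mem_pi, mem_univ, true_imp_iff, Pi.smul_apply, smul_eq_mul, mem_Ioc]
    refine forall_congr' fun i => ?_
    rw [inv_mul_le_iff₀ h2, mul_one]
    exact and_congr_left fun _ => by rw [mul_pos_iff_of_pos_left (inv_pos.2 h2)]
  rw [e2, volume_pi, setIntegral_congr_set (Measure.univ_pi_Ioc_ae_eq_Icc
    (f := fun _ : Fin d => (0 : ℝ)) (g := fun _ => 2 * Real.pi))]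
  simp only [Module.finrank_fintype_fun_eq_card, Fintype.card_fin, one_div]
  rfl

theorem torusLift_eq_of_sub {V : Type*} {f : (Fin d → ℝ) → V} (hf : TorusPeriodic f) (s : Fin d → ℝ) :
    torusLift (fun θ => f (s - θ)) =
      fun t => torusLift f ((fun j => ((s j / (2 * Real.pi) : ℝ) : UnitAddCircle)) - t) := by
  ext t
  set u : Fin d → ℝ := fun j => (AddCircle.equivIoc (1 : ℝ) 0 (t j)).1 with hu
  have ht : t = fun j => (u j : UnitAddCircle) := by
    ext j; exact AddCircle.coe_equivIoc.symm
  have e : ((fun j => ((s j / (2 * Real.pi) : ℝ) : UnitAddCircle)) - t) =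
      fun j => ((s j / (2 * Real.pi) - u j : ℝ) : UnitAddCircle) := by
    rw [ht]; ext j; simp
  rw [e, torusLift_coe hf, torusLift]
  congr 1
  ext j
  have := Real.pi_pos
  simp only [Pi.sub_apply, hu]
  field_simp

theorem boxAvg_sub_left {f : (Fin d → ℝ) → V} (hf : TorusPeriodic f) (s : Fin d → ℝ) :
    boxAvg (fun θ => f (s - θ)) = boxAvg f := by
  have : Measure.IsAddHaarMeasure (volume : Measure UnitAddCircle) :=
    inferInstanceAs (Measure.IsAddHaarMeasure AddCircle.haarAddCircle)
  have : Measure.IsAddHaarMeasure (volume : Measure (UnitAddTorus (Fin d))) :=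
    Measure.pi.isAddHaarMeasure _
  have : Measure.IsNegInvariant (volume : Measure (UnitAddTorus (Fin d))) :=
    Measure.IsAddHaarMeasure.isNegInvariant_of_regular _
  rw [boxAvg_eq_integral_torusLift, boxAvg_eq_integral_torusLift, torusLift_eq_of_sub hf]
  exact integral_sub_left_eq_self _ _ _

theorem boxAvg_add_right {f : (Fin d → ℝ) → V} (hf : TorusPeriodic f) (s : Fin d → ℝ) :
    boxAvg (fun θ => f (θ + s)) = boxAvg f := by
  have h1 : TorusPeriodic (fun θ => f (θ + s)) := fun k θ => by
    simp only; rw [add_right_comm]; exact hf k _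
  rw [← boxAvg_sub_left h1 0, ← boxAvg_sub_left hf s]
  congr 1
  ext θ
  congr 1
  abel

theorem torusLift_continuous {f : (Fin d → ℝ) → ℂ} (hf : TorusPeriodic f) (hc : Continuous f) :
    Continuous (torusLift f) := by
  have hq : IsOpenQuotientMap (Pi.map fun (_ : Fin d) (x : ℝ) => (x : UnitAddCircle)) :=
    IsOpenQuotientMap.piMap fun _ => QuotientAddGroup.isOpenQuotientMap_mk
  rw [← hq.continuous_comp_iff]
  have : torusLift f ∘ (Pi.map fun (_ : Fin d) (x : ℝ) => (x : UnitAddCircle)) =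
      fun u => f (fun j => 2 * Real.pi * u j) := by
    ext u; exact torusLift_coe hf u
  rw [this]
  fun_prop

theorem mFourier_coe (k : Fin d → ℤ) (u : Fin d → ℝ) :
    UnitAddTorus.mFourier k (fun j => (u j : UnitAddCircle)) =
      Complex.exp (Complex.I * (dotInt (fun j => 2 * Real.pi * u j) k : ℂ)) := by
  simp only [UnitAddTorus.mFourier, ContinuousMap.coe_mk, fourier_coe_apply, ← Complex.exp_sum,
    dotInt]
  congr 1
  push_cast
  rw [Finset.mul_sum]
  exact Finset.sum_congr rfl fun j _ => by ring

/-- Pointwise convergence of the Fourier series of a periodic continuous function with summable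
coefficients. -/
theorem hasSum_boxAvg_exp {f : (Fin d → ℝ) → ℂ} (hf : TorusPeriodic f) (hc : Continuous f)
    (hs : Summable fun k : Fin d → ℤ =>
      boxAvg fun θ => f θ * Complex.exp (-Complex.I * (dotInt θ k : ℂ))) (q : Fin d → ℝ) :
    HasSum (fun k : Fin d → ℤ => (boxAvg fun θ => f θ * Complex.exp (-Complex.I * (dotInt θ k : ℂ)))
      * Complex.exp (Complex.I * (dotInt q k : ℂ))) (f q) := by
  set F : C(UnitAddTorus (Fin d), ℂ) := ⟨torusLift f, torusLift_continuous hf hc⟩ with hF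
  have hco : UnitAddTorus.mFourierCoeff F = fun k : Fin d → ℤ =>
      boxAvg fun θ => f θ * Complex.exp (-Complex.I * (dotInt θ k : ℂ)) := by
    ext k
    rw [boxAvg_eq_integral_torusLift, UnitAddTorus.mFourierCoeff]
    congr 1
    ext t
    have ht : t = fun j => ((AddCircle.equivIoc (1 : ℝ) 0 (t j)).1 : UnitAddCircle) := by
      ext j; exact AddCircle.coe_equivIoc.symm
    conv_lhs => enter [1]; rw [ht]
    rw [mFourier_coe, smul_eq_mul, mul_comm]
    simp only [torusLift, hF, ContinuousMap.coe_mk]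
    congr 2
    simp [dotInt]
  have h1 := UnitAddTorus.hasSum_mFourier_series_apply_of_summable (f := F) (by rwa [hco])
    (fun j => ((q j / (2 * Real.pi) : ℝ) : UnitAddCircle))
  have e : (fun j => 2 * Real.pi * (q j / (2 * Real.pi))) = q := by
    ext j
    have := Real.pi_pos
    field_simp
  have e2 : F (fun j => ((q j / (2 * Real.pi) : ℝ) : UnitAddCircle)) = f q := by
    rw [hF, ContinuousMap.coe_mk, torusLift_coe hf, e]
  rw [hco, e2] at h1
  simpa only [mFourier_coe, e, smul_eq_mul] using h1

theorem volume_box_toReal :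
    (volume (Icc (0 : Fin d → ℝ) (fun _ => 2 * Real.pi))).toReal = (2 * Real.pi) ^ d := by
  rw [Real.volume_Icc_pi]
  simp [Real.pi_pos.le]

theorem norm_boxAvg_le {f : (Fin d → ℝ) → V} {C : ℝ} (hC : ∀ θ, ‖f θ‖ ≤ C) : ‖boxAvg f‖ ≤ C := by
  have h1 := norm_setIntegral_le_of_norm_le_const (μ := volume)
    (s := Icc (0 : Fin d → ℝ) (fun _ => 2 * Real.pi)) (f := f) (C := C)
    isCompact_Icc.measure_lt_top (fun θ _ => hC θ)
  rw [measureReal_def, volume_box_toReal] at h1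
  have h2 : (0 : ℝ) < (2 * Real.pi) ^ d := pow_pos Real.two_pi_pos d
  rw [boxAvg, norm_smul, Real.norm_eq_abs, abs_of_pos (by positivity)]
  calc 1 / (2 * Real.pi) ^ d * ‖∫ q in Icc (0 : Fin d → ℝ) (fun _ => 2 * Real.pi), f q‖
      ≤ 1 / (2 * Real.pi) ^ d * (C * (2 * Real.pi) ^ d) := by gcongr
    _ = C := by field_simp

theorem boxAvg_add {f g : (Fin d → ℝ) → V} (hf : Continuous f) (hg : Continuous g) :
    boxAvg (fun θ => f θ + g θ) = boxAvg f + boxAvg g := by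
  rw [boxAvg, integral_add (hf.continuousOn.integrableOn_compact isCompact_Icc)
    (hg.continuousOn.integrableOn_compact isCompact_Icc), smul_add]
  rfl

theorem boxAvg_smul {𝕜 : Type*} [RCLike 𝕜] [NormedSpace 𝕜 V] [SMulCommClass ℝ 𝕜 V]
    (c : 𝕜) (f : (Fin d → ℝ) → V) : boxAvg (fun θ => c • f θ) = c • boxAvg f := by
  rw [boxAvg, integral_smul, smul_comm]
  rfl

theorem boxAvg_clm {W : Type*} [NormedAddCommGroup W] [NormedSpace ℝ W] [CompleteSpace V]
    [CompleteSpace W] {f : (Fin d → ℝ) → V} (hf : Continuous f) (L : V →L[ℝ] W) :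
    boxAvg (fun θ => L (f θ)) = L (boxAvg f) := by
  rw [boxAvg, L.integral_comp_comm (hf.continuousOn.integrableOn_compact isCompact_Icc), boxAvg,
    map_smul]

theorem boxAvg_const [CompleteSpace V] (v : V) : boxAvg (fun _ : Fin d → ℝ => v) = v := by
  have h2 : (0 : ℝ) < (2 * Real.pi) ^ d := pow_pos Real.two_pi_pos d
  rw [boxAvg, setIntegral_const, measureReal_def, volume_box_toReal, smul_smul,
    one_div_mul_cancel h2.ne', one_smul]

theorem boxAvg_sum {κ : Type*} {s : Finset κ} {f : κ → (Fin d → ℝ) → V}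
    (hf : ∀ k ∈ s, Continuous (f k)) :
    boxAvg (fun θ => ∑ k ∈ s, f k θ) = ∑ k ∈ s, boxAvg (f k) := by
  rw [boxAvg, integral_finsetSum _ fun k hk =>
    ((hf k hk).continuousOn.integrableOn_compact isCompact_Icc), Finset.smul_sum]
  rfl

end BoxAvg

/-! ### Fourier modes as averaging operators -/

section Modes

open Set MeasureTheory

variable {ι κ : Type*} {d : ℕ} {V : Type} [NormedAddCommGroup V] [NormedSpace ℝ V]

/-- The average of `F (p, q - θ)` over `θ ∈ 𝕋^d` with weight `w`. -/
def modeAvg (w : (Fin d → ℝ) → ℝ) (F : Phase d → V) (x : Phase d) : V :=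
  boxAvg fun θ => w θ • F (x - (0, θ))

theorem continuous_modeAvg_integrand {w : (Fin d → ℝ) → ℝ} (hw : Continuous w) {F : Phase d → V}
    (hF : Continuous F) (x : Phase d) : Continuous fun θ => w θ • F (x - (0, θ)) := by
  fun_prop

theorem norm_modeAvg_le {w : (Fin d → ℝ) → ℝ} (hw : ∀ θ, |w θ| ≤ 1) {F : Phase d → V} {C : ℝ}
    (hC : ∀ x, ‖F x‖ ≤ C) (x : Phase d) : ‖modeAvg w F x‖ ≤ C := by
  refine norm_boxAvg_le fun θ => ?_
  rw [norm_smul, Real.norm_eq_abs]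
  calc |w θ| * ‖F (x - (0, θ))‖ ≤ 1 * C := by
        gcongr
        exacts [hw θ, hC _]
    _ = C := one_mul C

/-- Differentiation under the integral falls on `F` alone, since the base point enters only there.
Derivatives of a mode are therefore modes of derivatives, with bounds that do not see the frequency
in the weight. -/
theorem hasFDerivAt_modeAvg {w : (Fin d → ℝ) → ℝ} (hwc : Continuous w) (hw : ∀ θ, |w θ| ≤ 1)
    {F : Phase d → V} (hF : Differentiable ℝ F) (hF' : Continuous (fderiv ℝ F)) {C : ℝ}
    (hC : ∀ x, ‖fderiv ℝ F x‖ ≤ C) (x : Phase d) :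
    HasFDerivAt (modeAvg w F) (modeAvg w (fderiv ℝ F) x) x := by
  have hFc := hF.continuous
  refine HasFDerivAt.const_smul (hasFDerivAt_integral_of_dominated_of_fderiv_le
    (μ := volume.restrict (Icc (0 : Fin d → ℝ) (fun _ => 2 * Real.pi)))
    (F := fun x θ => w θ • F (x - (0, θ))) (F' := fun x θ => w θ • fderiv ℝ F (x - (0, θ)))
    (bound := fun _ => C) (s := univ) Filter.univ_mem ?_ ?_ ?_ ?_ ?_ ?_) _
  · exact Filter.Eventually.of_forall fun y =>
      (continuous_modeAvg_integrand hwc hFc y).aestronglyMeasurable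
  · exact (continuous_modeAvg_integrand hwc hFc x).continuousOn.integrableOn_compact isCompact_Icc
  · exact (continuous_modeAvg_integrand hwc hF' x).aestronglyMeasurable
  · refine Filter.Eventually.of_forall fun θ y _ => ?_
    rw [norm_smul, Real.norm_eq_abs]
    calc |w θ| * ‖fderiv ℝ F (y - (0, θ))‖ ≤ 1 * C := by
          gcongr
          exacts [hw θ, hC _]
      _ = C := one_mul C
  · exact continuous_const.continuousOn.integrableOn_compact isCompact_Icc
  · refine Filter.Eventually.of_forall fun θ y _ => ?_
    have h1 : HasFDerivAt (fun y : Phase d => F (y - (0, θ))) (fderiv ℝ F (y - (0, θ))) y := by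
      have := (hF (y - (0, θ))).hasFDerivAt.comp y ((hasFDerivAt_id y).sub_const (0, θ))
      simpa using! this
    exact h1.const_smul (w θ)

theorem UnifBdd.modeAvg {w : κ → (Fin d → ℝ) → ℝ} (hwc : ∀ k, Continuous (w k))
    (hw : ∀ k θ, |w k θ| ≤ 1) {n : ℕ} : ∀ {V : Type} [NormedAddCommGroup V] [NormedSpace ℝ V]
    {F : ι → Phase d → V}, UnifBdd n F →
    UnifBdd n (fun (a : ι × κ) => modeAvg (w a.2) (F a.1)) := by
  induction n with
  | zero =>
    intro V _ _ F h
    obtain ⟨C, -, hC⟩ := h.bounded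
    obtain ⟨K, -, hK⟩ := h.lipschitz
    have hc : ∀ i, Continuous (F i) := fun i => (h.contDiff i).continuous
    refine unifBdd_zero_of (fun a => norm_modeAvg_le (hw a.2) (hC a.1)) (K := K) fun a x y => ?_
    have e : NormalFormLemma.modeAvg (w a.2) (F a.1) x - NormalFormLemma.modeAvg (w a.2) (F a.1) y =
        boxAvg fun θ => w a.2 θ • (F a.1 (x - (0, θ)) - F a.1 (y - (0, θ))) := by
      rw [sub_eq_iff_eq_add, NormalFormLemma.modeAvg, NormalFormLemma.modeAvg, ← boxAvg_add]
      · simp [smul_sub]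
      · have := hwc a.2; have := hc a.1
        fun_prop
      · exact continuous_modeAvg_integrand (hwc a.2) (hc a.1) y
    rw [e]
    refine norm_boxAvg_le fun θ => ?_
    rw [norm_smul, Real.norm_eq_abs]
    have h2 := hK a.1 (x - (0, θ)) (y - (0, θ))
    rw [sub_sub_sub_cancel_right] at h2
    calc |w a.2 θ| * ‖F a.1 (x - (0, θ)) - F a.1 (y - (0, θ))‖ ≤ 1 * (K * ‖x - y‖) := by
          gcongr
          exact hw a.2 θ
      _ = K * ‖x - y‖ := one_mul _
  | succ n ih =>
    intro V _ _ F h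
    obtain ⟨C, -, hC⟩ := h.bounded
    obtain ⟨C', -, hC'⟩ := h.2.2.bounded
    have hd : ∀ (a : ι × κ) x, HasFDerivAt (NormalFormLemma.modeAvg (w a.2) (F a.1))
        (NormalFormLemma.modeAvg (w a.2) (fderiv ℝ (F a.1)) x) x := fun a x =>
      hasFDerivAt_modeAvg (hwc a.2) (hw a.2) (h.2.1 a.1) (h.2.2.contDiff a.1).continuous
        (hC' a.1) x
    refine ⟨⟨C, fun a => norm_modeAvg_le (hw a.2) (hC a.1)⟩, fun a x =>
      (hd a x).differentiableAt, ?_⟩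
    convert ih h.2.2 using 2 with a
    ext1 x
    exact (hd a x).fderiv

theorem isPeriodic_modeAvg (w : (Fin d → ℝ) → ℝ) {F : Phase d → ℝ} (hF : IsPeriodic F) :
    IsPeriodic (modeAvg w F) := by
  intro k x
  simp only [modeAvg, add_sub_right_comm, hF k]

theorem IsPeriodic.coordDeriv {F : Phase d → ℝ} (hF : IsPeriodic F) (a : Fin d ⊕ Fin d) :
    IsPeriodic (coordDeriv a F) := by
  intro k x
  have : (fun y => F (y + shift k)) = F := funext fun y => hF k y
  rw [NormalFormLemma.coordDeriv, NormalFormLemma.coordDeriv, ← fderiv_comp_add_right, this]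

theorem IsPeriodic.wordDeriv {F : Phase d → ℝ} (hF : IsPeriodic F) (w : List (Fin d ⊕ Fin d)) :
    IsPeriodic (wordDeriv w F) := by
  induction w with
  | nil => exact hF
  | cons a w ih => exact ih.coordDeriv a

theorem IsPeriodic.torusPeriodic {F : Phase d → ℝ} (hF : IsPeriodic F) (p : Fin d → ℝ) :
    TorusPeriodic fun θ => F (p, θ) := by
  intro k θ
  have := hF k (p, θ)
  simpa [shift] using this

theorem modeAvg_translate {w : (Fin d → ℝ) → ℝ} (hw : TorusPeriodic w) {F : Phase d → ℝ}
    (hF : IsPeriodic F) (x : Phase d) (s : Fin d → ℝ) :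
    modeAvg w F (x + (0, s)) = modeAvg (fun θ => w (θ + s)) F x := by
  have hper : TorusPeriodic fun θ => w θ • F (x + (0, s) - (0, θ)) := by
    intro k θ
    simp only
    rw [hw k θ]
    congr 1
    rw [← hF k]
    congr 1
    simp [shift, Prod.ext_iff]
    abel
  rw [modeAvg, ← boxAvg_add_right hper s, modeAvg]
  congr 1
  ext θ
  congr 2
  simp [Prod.ext_iff]

theorem dotInt_add (θ s : Fin d → ℝ) (k : Fin d → ℤ) :
    dotInt (θ + s) k = dotInt θ k + dotInt s k := by
  simp [dotInt, add_mul, Finset.sum_add_distrib]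

theorem dotInt_smul (r : ℝ) (θ : Fin d → ℝ) (k : Fin d → ℤ) :
    dotInt (r • θ) k = r * dotInt θ k := by
  simp [dotInt, Finset.mul_sum, mul_assoc]

theorem dotInt_single (j : Fin d) (k : Fin d → ℤ) : dotInt (Pi.single j 1) k = k j := by
  simp [dotInt, Pi.single_apply]

theorem dotInt_neg (θ : Fin d → ℝ) (k : Fin d → ℤ) : dotInt θ (-k) = -dotInt θ k := by
  simp [dotInt]

theorem continuous_dotInt (k : Fin d → ℤ) : Continuous fun θ : Fin d → ℝ => dotInt θ k := by
  unfold dotInt; fun_prop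

theorem dotInt_two_pi_mul (l k : Fin d → ℤ) :
    dotInt (fun j => 2 * Real.pi * (l j : ℝ)) k = ((∑ j, l j * k j : ℤ) : ℝ) * (2 * Real.pi) := by
  simp only [dotInt]
  push_cast
  rw [Finset.sum_mul]
  exact Finset.sum_congr rfl fun j _ => by ring

/-- `Re (F̂_k(p) e^{i k·q})`. -/
def cosMode (k : Fin d → ℤ) (F : Phase d → V) : Phase d → V :=
  modeAvg (fun θ => Real.cos (dotInt θ k)) F

/-- `Im (F̂_k(p) e^{i k·q})`. -/
def sinMode (k : Fin d → ℤ) (F : Phase d → V) : Phase d → V :=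
  modeAvg (fun θ => Real.sin (dotInt θ k)) F

theorem continuous_cos_dotInt (k : Fin d → ℤ) :
    Continuous fun θ : Fin d → ℝ => Real.cos (dotInt θ k) :=
  Real.continuous_cos.comp (continuous_dotInt k)

theorem continuous_sin_dotInt (k : Fin d → ℤ) :
    Continuous fun θ : Fin d → ℝ => Real.sin (dotInt θ k) :=
  Real.continuous_sin.comp (continuous_dotInt k)

theorem UnifBdd.cosMode {n : ℕ} {F : ι → Phase d → V} (h : UnifBdd n F) :
    UnifBdd n (fun (a : ι × (Fin d → ℤ)) => cosMode a.2 (F a.1)) :=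
  UnifBdd.modeAvg (w := fun k θ => Real.cos (dotInt θ k)) continuous_cos_dotInt
    (fun _ _ => Real.abs_cos_le_one _) h

theorem UnifBdd.sinMode {n : ℕ} {F : ι → Phase d → V} (h : UnifBdd n F) :
    UnifBdd n (fun (a : ι × (Fin d → ℤ)) => sinMode a.2 (F a.1)) :=
  UnifBdd.modeAvg (w := fun k θ => Real.sin (dotInt θ k)) continuous_sin_dotInt
    (fun _ _ => Real.abs_sin_le_one _) h

theorem modeAvg_linear {w w' : (Fin d → ℝ) → ℝ} (hw : Continuous w) (hw' : Continuous w')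
    (a b : ℝ) {F : Phase d → ℝ} (hF : Continuous F) (x : Phase d) :
    modeAvg (fun θ => a * w θ + b * w' θ) F x = a * modeAvg w F x + b * modeAvg w' F x := by
  have e : (fun θ => (a * w θ + b * w' θ) • F (x - (0, θ))) =
      fun θ => a • (w θ • F (x - (0, θ))) + b • (w' θ • F (x - (0, θ))) := by
    ext θ; simp only [smul_eq_mul]; ring
  rw [modeAvg, e, boxAvg_add (by fun_prop) (by fun_prop), boxAvg_smul, boxAvg_smul]
  rfl

/-- By invariance of the mean a translation in `q` moves onto the weight, where the addition formula
applies. Differentiating at `s = 0` yields the `q`-derivatives of both kinds of mode. -/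
theorem cosMode_translate {F : Phase d → ℝ} (hF : IsPeriodic F) (hc : Continuous F)
    (k : Fin d → ℤ) (x : Phase d) (s : Fin d → ℝ) :
    cosMode k F (x + (0, s)) =
      Real.cos (dotInt s k) * cosMode k F x + -Real.sin (dotInt s k) * sinMode k F x := by
  rw [cosMode, modeAvg_translate _ hF]
  · rw [sinMode, ← modeAvg_linear (continuous_cos_dotInt k) (continuous_sin_dotInt k) _ _ hc]
    congr 1
    ext θ
    rw [dotInt_add, Real.cos_add]
    ring
  · intro l θ
    beta_reduce
    rw [dotInt_add, dotInt_two_pi_mul, Real.cos_add_int_mul_two_pi]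

theorem sinMode_translate {F : Phase d → ℝ} (hF : IsPeriodic F) (hc : Continuous F)
    (k : Fin d → ℤ) (x : Phase d) (s : Fin d → ℝ) :
    sinMode k F (x + (0, s)) =
      Real.sin (dotInt s k) * cosMode k F x + Real.cos (dotInt s k) * sinMode k F x := by
  rw [sinMode, modeAvg_translate _ hF]
  · rw [cosMode, ← modeAvg_linear (continuous_cos_dotInt k) (continuous_sin_dotInt k) _ _ hc]
    congr 1
    ext θ
    rw [dotInt_add, Real.sin_add]
    ring
  · intro l θ
    beta_reduce
    rw [dotInt_add, dotInt_two_pi_mul, Real.sin_add_int_mul_two_pi]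

theorem hasDerivAt_line {G : Phase d → ℝ} (hG : Differentiable ℝ G) (x : Phase d) (j : Fin d) :
    HasDerivAt (fun s : ℝ => G (x + (0, s • Pi.single j 1))) (coordDeriv (Sum.inr j) G x) 0 := by
  have h1 : HasDerivAt (fun s : ℝ => x + s • coordDir (Sum.inr j)) (coordDir (Sum.inr j)) 0 := by
    simpa using! ((hasDerivAt_id (0 : ℝ)).smul_const (coordDir (d := d) (Sum.inr j))).const_add x
  have h2 := (hG (x + (0 : ℝ) • coordDir (Sum.inr j))).hasFDerivAt.comp_hasDerivAt (0 : ℝ) h1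
  rw [zero_smul, add_zero] at h2
  have e : (fun s : ℝ => G (x + (0, s • Pi.single j 1))) =
      G ∘ fun s : ℝ => x + s • coordDir (Sum.inr j) := by
    ext s; simp [coordDir]
  rw [e]
  exact h2

theorem coordDeriv_cosMode {F : ι → Phase d → ℝ} (h : ∀ n, UnifBdd n F) {i : ι}
    (hp : IsPeriodic (F i)) (k : Fin d → ℤ) (j : Fin d) (x : Phase d) :
    coordDeriv (Sum.inr j) (cosMode k (F i)) x = -(k j : ℝ) * sinMode k (F i) x := by
  have h1 := hasDerivAt_line ((h 1).cosMode.2.1 (i, k)) x j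
  refine h1.unique ?_
  simp only [cosMode_translate hp ((h 0).contDiff i).continuous, dotInt_smul, dotInt_single]
  have h2 : HasDerivAt (fun s : ℝ => s * (k j : ℝ)) (k j) 0 := by
    simpa using (hasDerivAt_id (0 : ℝ)).mul_const (k j : ℝ)
  simpa using! (h2.cos.mul_const (cosMode k (F i) x)).add
    (h2.sin.neg.mul_const (sinMode k (F i) x))

theorem coordDeriv_sinMode {F : ι → Phase d → ℝ} (h : ∀ n, UnifBdd n F) {i : ι}
    (hp : IsPeriodic (F i)) (k : Fin d → ℤ) (j : Fin d) (x : Phase d) :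
    coordDeriv (Sum.inr j) (sinMode k (F i)) x = (k j : ℝ) * cosMode k (F i) x := by
  have h1 := hasDerivAt_line ((h 1).sinMode.2.1 (i, k)) x j
  refine h1.unique ?_
  simp only [sinMode_translate hp ((h 0).contDiff i).continuous, dotInt_smul, dotInt_single]
  have h2 : HasDerivAt (fun s : ℝ => s * (k j : ℝ)) (k j) 0 := by
    simpa using (hasDerivAt_id (0 : ℝ)).mul_const (k j : ℝ)
  simpa using! (h2.sin.mul_const (cosMode k (F i) x)).add
    (h2.cos.mul_const (sinMode k (F i) x))

theorem coordDeriv_modeAvg {w : (Fin d → ℝ) → ℝ} (hwc : Continuous w) (hw : ∀ θ, |w θ| ≤ 1)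
    {F : ι → Phase d → ℝ} (h : ∀ n, UnifBdd n F) (i : ι) (a : Fin d ⊕ Fin d) :
    coordDeriv a (modeAvg w (F i)) = modeAvg w (coordDeriv a (F i)) := by
  ext x
  obtain ⟨C, -, hC⟩ := (h 1).2.2.bounded
  have hc := ((h 1).2.2.contDiff i).continuous
  have h1 := hasFDerivAt_modeAvg hwc hw ((h 1).2.1 i) hc (hC i) x
  rw [coordDeriv, h1.fderiv, modeAvg, modeAvg]
  exact (boxAvg_clm (continuous_modeAvg_integrand hwc hc x)
    (ContinuousLinearMap.apply ℝ ℝ (coordDir a))).symm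

/-! ### Decay of the modes and summability over frequencies -/

/-- `1 + |k_1| + ⋯ + |k_d|`. -/
def bracket (k : Fin d → ℤ) : ℝ := 1 + ∑ j, |(k j : ℝ)|

theorem one_le_bracket (k : Fin d → ℤ) : 1 ≤ bracket k := by
  rw [bracket, le_add_iff_nonneg_right]; positivity

theorem bracket_pos (k : Fin d → ℤ) : 0 < bracket k := zero_lt_one.trans_le (one_le_bracket k)

/-- Decay of the Fourier modes. -/
theorem unifBdd_bracket_pow_modes (M : ℕ) : ∀ {F : ι → Phase d → ℝ}, (∀ n, UnifBdd n F) →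
    (∀ i, IsPeriodic (F i)) → ∀ n,
    UnifBdd n (fun (a : ι × (Fin d → ℤ)) x => bracket a.2 ^ M * cosMode a.2 (F a.1) x) ∧
    UnifBdd n (fun (a : ι × (Fin d → ℤ)) x => bracket a.2 ^ M * sinMode a.2 (F a.1) x) := by
  induction M with
  | zero => intro F h _ n; simpa using ⟨(h n).cosMode, (h n).sinMode⟩
  | succ M ih =>
    intro F h hp n
    -- One more power of the bracket is `1 + ∑ sign(k_j) k_j`, and `k_j` times a mode of `F` is, up
    -- to sign, the other kind of mode of `∂F/∂q_j`. Bounded signs are harmless.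
    have hsg : ∀ j (a : ι × (Fin d → ℤ)), |(SignType.sign (a.2 j : ℝ) : ℝ)| ≤ 1 := by
      intro j a
      cases SignType.sign ((a.2 j : ℝ)) <;> simp
    have hj := fun j => ih (fun n => UnifBdd.coordDeriv h (Sum.inr j) n)
      (fun i => (hp i).coordDeriv (Sum.inr j)) n
    have hS : ∀ (a : ι × (Fin d → ℤ)) j x, sinMode a.2 (coordDeriv (Sum.inr j) (F a.1)) x =
        (a.2 j : ℝ) * cosMode a.2 (F a.1) x := fun a j x => by
      rw [← coordDeriv_sinMode h (hp a.1)]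
      exact (congrFun (coordDeriv_modeAvg (continuous_sin_dotInt _)
        (fun _ => Real.abs_sin_le_one _) h a.1 _) x).symm
    have hC : ∀ (a : ι × (Fin d → ℤ)) j x, cosMode a.2 (coordDeriv (Sum.inr j) (F a.1)) x =
        -(a.2 j : ℝ) * sinMode a.2 (F a.1) x := fun a j x => by
      rw [← coordDeriv_cosMode h (hp a.1)]
      exact (congrFun (coordDeriv_modeAvg (continuous_cos_dotInt _)
        (fun _ => Real.abs_cos_le_one _) h a.1 _) x).symm
    constructor
    · have := (ih h hp n).1.add (UnifBdd.sum Finset.univ fun j _ => (hj j).2.const_smul (hsg j))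
      convert this using 3 with a x
      simp only [hS, pow_succ, bracket, smul_eq_mul]
      rw [mul_add, add_mul, mul_one, add_right_inj, Finset.mul_sum, Finset.sum_mul]
      refine Finset.sum_congr rfl fun j _ => ?_
      rw [← sign_mul_self (a.2 j : ℝ)]
      ring
    · have := (ih h hp n).2.sub (UnifBdd.sum Finset.univ fun j _ => (hj j).1.const_smul (hsg j))
      convert this using 3 with a x
      simp only [hC, pow_succ, bracket, smul_eq_mul]
      rw [mul_add, add_mul, mul_one, sub_eq_add_neg, add_right_inj, Finset.mul_sum,
        Finset.sum_mul, ← Finset.sum_neg_distrib]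
      refine Finset.sum_congr rfl fun j _ => ?_
      rw [← sign_mul_self (a.2 j : ℝ)]
      ring

/-- Summability of the weights over `ℤ^d`. -/
theorem summable_bracket_pow : Summable fun k : Fin d → ℤ => (bracket k ^ (2 * d))⁻¹ := by
  have h1 : Summable fun n : ℤ => ((1 + |(n : ℝ)|) ^ 2)⁻¹ := by
    have h0 : Summable fun n : ℤ => 1 / (n : ℝ) ^ 2 :=
      Real.summable_one_div_int_pow.2 one_lt_two
    have h2 : Summable fun n : ℤ => (if n = 0 then (1 : ℝ) else 0) + 1 / (n : ℝ) ^ 2 :=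
      (summable_of_hasFiniteSupport ((Set.finite_singleton (0 : ℤ)).subset
        fun n hn => by by_contra h; exact hn (if_neg h))).add h0
    refine h2.of_nonneg_of_le (fun n => by positivity) fun n => ?_
    rcases eq_or_ne n 0 with rfl | hn
    · simp
    · rw [if_neg hn, zero_add, one_div]
      have : 0 < |(n : ℝ)| := abs_pos.2 (by exact_mod_cast hn)
      rw [← sq_abs (n : ℝ)]
      gcongr
      linarith
  set A := ∑' n : ℤ, ((1 + |(n : ℝ)|) ^ 2)⁻¹ with hA
  refine summable_of_sum_le (c := A ^ d) (fun k => by have := bracket_pos k; positivity) fun s => ?_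
  obtain ⟨t, ht⟩ : ∃ t : Finset ℤ, s ⊆ Fintype.piFinset fun _ => t := by
    refine ⟨s.biUnion fun k => Finset.univ.image k, fun k hk => ?_⟩
    rw [Fintype.mem_piFinset]
    intro j
    exact Finset.mem_biUnion.2 ⟨k, hk, Finset.mem_image_of_mem _ (Finset.mem_univ j)⟩
  -- Each factor `1 + |k_j|` is at most the bracket, so the exponent `2d` leaves an inverse square
  -- in each of the `d` variables, and the sum over a box factorizes.
  calc ∑ k ∈ s, (bracket k ^ (2 * d))⁻¹
      ≤ ∑ k ∈ s, ∏ j, ((1 + |(k j : ℝ)|) ^ 2)⁻¹ := by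
        refine Finset.sum_le_sum fun k _ => ?_
        rw [Finset.prod_inv_distrib, pow_mul]
        have : ∏ j, (1 + |(k j : ℝ)|) ^ 2 ≤ ∏ _j : Fin d, bracket k ^ 2 := by
          refine Finset.prod_le_prod (fun j _ => by positivity) fun j _ => ?_
          gcongr
          rw [bracket]
          gcongr
          exact Finset.single_le_sum (f := fun j => |(k j : ℝ)|) (fun j _ => abs_nonneg _)
            (Finset.mem_univ j)
        rw [Finset.prod_const, Finset.card_univ, Fintype.card_fin] at this
        exact inv_anti₀ (Finset.prod_pos fun j _ => by positivity) this
    _ ≤ ∑ k ∈ Fintype.piFinset fun _ : Fin d => t, ∏ j, ((1 + |(k j : ℝ)|) ^ 2)⁻¹ :=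
        Finset.sum_le_sum_of_subset_of_nonneg ht fun k _ _ =>
          Finset.prod_nonneg fun j _ => by positivity
    _ = ∏ _j : Fin d, ∑ n ∈ t, ((1 + |(n : ℝ)|) ^ 2)⁻¹ :=
        (Finset.prod_univ_sum (fun _ : Fin d => t) fun _ n => ((1 + |(n : ℝ)|) ^ 2)⁻¹).symm
    _ ≤ ∏ _j : Fin d, A := Finset.prod_le_prod
        (fun j _ => Finset.sum_nonneg fun n _ => by positivity)
        fun j _ => h1.sum_le_tsum t fun n _ => by positivity
    _ = A ^ d := by simp

end Modes

/-! ### Fourier series -/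

section Fourier

open Set MeasureTheory

variable {ι : Type*} {d : ℕ}

theorem fourierCoef_eq_boxAvg (F : Phase d → ℝ) (k : Fin d → ℤ) (p : Fin d → ℝ) :
    fourierCoef F k p =
      boxAvg fun θ => (F (p, θ) : ℂ) * Complex.exp (-Complex.I * (dotInt θ k : ℂ)) := by
  rw [fourierCoef, boxAvg, Complex.real_smul]

theorem exp_dotInt_periodic (k l : Fin d → ℤ) (θ : Fin d → ℝ) (c : ℂ) (hc : c = 1 ∨ c = -1) :
    Complex.exp (c * Complex.I * (dotInt (θ + fun j => 2 * Real.pi * (l j : ℝ)) k : ℂ)) =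
      Complex.exp (c * Complex.I * (dotInt θ k : ℂ)) := by
  rw [dotInt_add, dotInt_two_pi_mul]
  push_cast
  rw [mul_add, Complex.exp_add]
  rcases hc with rfl | rfl
  · have := Complex.exp_int_mul_two_pi_mul_I (∑ j, l j * k j)
    push_cast at this
    rw [show (1 : ℂ) * Complex.I * ((∑ j, (l j : ℂ) * (k j : ℂ)) * (2 * (Real.pi : ℂ))) =
      (∑ j, (l j : ℂ) * (k j : ℂ)) * (2 * (Real.pi : ℂ) * Complex.I) by ring, this, mul_one]
  · have := Complex.exp_int_mul_two_pi_mul_I (-∑ j, l j * k j)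
    push_cast at this
    rw [show (-1 : ℂ) * Complex.I * ((∑ j, (l j : ℂ) * (k j : ℂ)) * (2 * (Real.pi : ℂ))) =
      (-∑ j, (l j : ℂ) * (k j : ℂ)) * (2 * (Real.pi : ℂ) * Complex.I) by ring, this, mul_one]

/-- The substitution `θ ↦ q - θ` turns the product into the mean of `F(p, q - θ) e^{ik·θ}`, whose
real and imaginary parts are the two modes. -/
theorem fourierCoef_mul_exp {F : Phase d → ℝ} (hF : IsPeriodic F) (hc : Continuous F)
    (k : Fin d → ℤ) (p q : Fin d → ℝ) :
    fourierCoef F k p * Complex.exp (Complex.I * (dotInt q k : ℂ)) =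
      cosMode k F (p, q) + Complex.I * sinMode k F (p, q) := by
  have hper : TorusPeriodic fun θ =>
      (F (p, θ) : ℂ) * Complex.exp (Complex.I * (dotInt (q - θ) k : ℂ)) := by
    intro l θ
    beta_reduce
    have h1 : F (p, θ + fun j => 2 * Real.pi * (l j : ℝ)) = F (p, θ) := hF.torusPeriodic p l θ
    have h2 := exp_dotInt_periodic k (-l) (q - θ) 1 (Or.inl rfl)
    have h3 : q - (θ + fun j => 2 * Real.pi * (l j : ℝ)) =
        q - θ + fun j => 2 * Real.pi * (((-l) j : ℤ) : ℝ) := by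
      ext j; simp; ring
    rw [h1, h3]
    simpa using congrArg (fun z => (F (p, θ) : ℂ) * z) h2
  have e1 : fourierCoef F k p * Complex.exp (Complex.I * (dotInt q k : ℂ)) =
      boxAvg fun θ => (F (p, θ) : ℂ) * Complex.exp (Complex.I * (dotInt (q - θ) k : ℂ)) := by
    rw [fourierCoef_eq_boxAvg, mul_comm, ← smul_eq_mul, ← boxAvg_smul]
    congr 1
    ext θ
    have : dotInt (q - θ) k = dotInt q k - dotInt θ k := by
      rw [eq_sub_iff_add_eq, ← dotInt_add, sub_add_cancel]
    rw [this, smul_eq_mul, mul_left_comm, ← Complex.exp_add]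
    congr 2
    push_cast
    ring
  have hcos : Continuous fun θ => Real.cos (dotInt θ k) • F ((p, q) - (0, θ)) :=
    continuous_modeAvg_integrand (continuous_cos_dotInt k) hc _
  have hsin : Continuous fun θ => Real.sin (dotInt θ k) • F ((p, q) - (0, θ)) :=
    continuous_modeAvg_integrand (continuous_sin_dotInt k) hc _
  rw [e1, ← boxAvg_sub_left hper q, cosMode, sinMode, modeAvg, modeAvg]
  have e2 := boxAvg_clm hcos Complex.ofRealCLM
  have e3 := boxAvg_clm hsin Complex.ofRealCLM
  simp only [Complex.ofRealCLM_apply] at e2 e3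
  rw [← e2, ← e3, ← smul_eq_mul Complex.I, ← boxAvg_smul, ← boxAvg_add]
  · congr 1
    ext θ
    rw [sub_sub_cancel, mul_comm Complex.I, Complex.exp_mul_I, ← Complex.ofReal_cos,
      ← Complex.ofReal_sin]
    simp only [Prod.mk_sub_mk, sub_zero, smul_eq_mul]
    push_cast
    ring
  · exact Complex.continuous_ofReal.comp hcos
  · exact (Complex.continuous_ofReal.comp hsin).const_smul Complex.I

theorem fourierCoef_eq_modes {F : Phase d → ℝ} (hF : IsPeriodic F) (hc : Continuous F)
    (k : Fin d → ℤ) (p : Fin d → ℝ) :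
    fourierCoef F k p = cosMode k F (p, 0) + Complex.I * sinMode k F (p, 0) := by
  rw [← fourierCoef_mul_exp hF hc k p 0]
  simp [dotInt]

/-- The Fourier series of a periodic function converges to the function. -/
theorem hasSum_cosMode {F : ι → Phase d → ℝ} (h : ∀ n, UnifBdd n F)
    (hp : ∀ i, IsPeriodic (F i)) (i : ι) (x : Phase d) :
    HasSum (fun k : Fin d → ℤ => cosMode k (F i) x) (F i x) := by
  have hc := ((h 0).contDiff i).continuous
  obtain ⟨C, hC0, hC⟩ := (unifBdd_bracket_pow_modes (2 * d) h hp 0).1.bounded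
  obtain ⟨S, hS0, hS⟩ := (unifBdd_bracket_pow_modes (2 * d) h hp 0).2.bounded
  have hper : TorusPeriodic fun θ => (F i (x.1, θ) : ℂ) := fun k θ =>
    congrArg _ ((hp i).torusPeriodic x.1 k θ)
  have hsum : Summable fun k : Fin d → ℤ =>
      boxAvg fun θ => (F i (x.1, θ) : ℂ) * Complex.exp (-Complex.I * (dotInt θ k : ℂ)) := by
    simp only [← fourierCoef_eq_boxAvg]
    refine Summable.of_norm_bounded (g := fun k => (C + S) * (bracket k ^ (2 * d))⁻¹)
      (summable_bracket_pow.mul_left _) fun k => ?_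
    rw [fourierCoef_eq_modes (hp i) hc]
    have hb : 0 < bracket k ^ (2 * d) := pow_pos (bracket_pos k) _
    have h1 := hC (i, k) (x.1, 0)
    have h2 := hS (i, k) (x.1, 0)
    rw [Real.norm_eq_abs, abs_mul, abs_of_pos hb] at h1 h2
    rw [← div_eq_mul_inv, le_div_iff₀ hb]
    calc _ ≤ (|cosMode k (F i) (x.1, 0)| + |sinMode k (F i) (x.1, 0)|) * bracket k ^ (2 * d) := by
          gcongr
          refine (norm_add_le _ _).trans (le_of_eq ?_)
          simp
      _ ≤ C + S := by linarith
  have h1 := hasSum_boxAvg_exp hper (by fun_prop) hsum x.2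
  simp only [← fourierCoef_eq_boxAvg, fourierCoef_mul_exp (hp i) hc] at h1
  have h2 := Complex.hasSum_re h1
  simpa using h2

theorem lt_bracket_of_notMem_modes {K : ℕ} {k : Fin d → ℤ} (hk : k ∉ modes d K) :
    (K : ℝ) < bracket k := by
  rw [mem_modes, not_le] at hk
  have h1 : (K : ℝ) ^ 2 < ∑ j, |(k j : ℝ)| ^ 2 := by
    have : ((K : ℤ) ^ 2 : ℝ) < ((∑ j, k j ^ 2 : ℤ) : ℝ) := by exact_mod_cast hk
    push_cast at this
    simpa [sq_abs] using this
  have h2 : ∑ j, |(k j : ℝ)| ^ 2 ≤ (∑ j, |(k j : ℝ)|) ^ 2 :=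
    Finset.sum_sq_le_sq_sum_of_nonneg fun j _ => abs_nonneg _
  have h3 : (K : ℝ) < ∑ j, |(k j : ℝ)| :=
    lt_of_pow_lt_pow_left₀ 2 (Finset.sum_nonneg fun j _ => abs_nonneg _) (h1.trans_le h2)
  rw [bracket]; linarith

/-- The part of `F` with frequencies `|k| > K`. -/
def fourierTail (K : ℕ) (F : Phase d → ℝ) (x : Phase d) : ℝ :=
  F x - ∑ k ∈ modes d K, cosMode k F x

/-- Outside the retained modes the bracket exceeds `K`. Of the `M + 2d` powers of decay, `M` absorb
`K^M` and the remaining `2d` make the sum converge, with a constant independent of `K`. -/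
theorem fourierTail_bound {F : ι → Phase d → ℝ} (h : ∀ n, UnifBdd n F)
    (hp : ∀ i, IsPeriodic (F i)) (M : ℕ) :
    ∃ C, ∀ i (K : ℕ) x, (K : ℝ) ^ M * |fourierTail K (F i) x| ≤ C := by
  obtain ⟨C, hC0, hC⟩ := (unifBdd_bracket_pow_modes (M + 2 * d) h hp 0).1.bounded
  refine ⟨C * ∑' k : Fin d → ℤ, (bracket k ^ (2 * d))⁻¹, fun i K x => ?_⟩
  have hs := hasSum_cosMode h hp i x
  have h1 : HasSum (fun k : {k // k ∉ modes d K} => cosMode k.1 (F i) x)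
      (fourierTail K (F i) x) := by
    refine (Finset.hasSum_compl_iff (f := fun k => cosMode k (F i) x) (modes d K)).2 ?_
    rwa [fourierTail, sub_add_cancel]
  have hle : ∀ k : {k // k ∉ modes d K},
      (K : ℝ) ^ M * |cosMode k.1 (F i) x| ≤ C * (bracket k.1 ^ (2 * d))⁻¹ := by
    intro k
    have hb : 0 < bracket k.1 ^ (2 * d) := pow_pos (bracket_pos k.1) _
    have h2 := hC (i, k.1) x
    rw [Real.norm_eq_abs, abs_mul, abs_of_pos (pow_pos (bracket_pos k.1) _), pow_add] at h2
    rw [← div_eq_mul_inv, le_div_iff₀ hb]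
    refine le_trans ?_ h2
    rw [mul_right_comm]
    gcongr
    exact (lt_bracket_of_notMem_modes k.2).le
  have hsub : Summable fun k : {k // k ∉ modes d K} => C * (bracket k.1 ^ (2 * d))⁻¹ :=
    (summable_bracket_pow.mul_left C).subtype _
  have habs : Summable fun k : {k // k ∉ modes d K} => (K : ℝ) ^ M * |cosMode k.1 (F i) x| :=
    hsub.of_nonneg_of_le (fun k => by positivity) hle
  have h3 : (K : ℝ) ^ M * |fourierTail K (F i) x| ≤
      ∑' k : {k // k ∉ modes d K}, (K : ℝ) ^ M * |cosMode k.1 (F i) x| := by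
    have h4 := h1.mul_left ((K : ℝ) ^ M)
    have h5 : |(K : ℝ) ^ M * fourierTail K (F i) x| ≤
        ∑' k : {k // k ∉ modes d K}, ‖(K : ℝ) ^ M * cosMode k.1 (F i) x‖ := by
      rw [← h4.tsum_eq, ← Real.norm_eq_abs]
      refine norm_tsum_le_tsum_norm ?_
      simpa [abs_mul] using habs
    simpa [abs_mul] using h5
  refine h3.trans ?_
  calc _ ≤ ∑' k : {k // k ∉ modes d K}, C * (bracket k.1 ^ (2 * d))⁻¹ :=
        habs.tsum_le_tsum hle hsub
    _ ≤ ∑' k : Fin d → ℤ, C * (bracket k ^ (2 * d))⁻¹ :=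
        (summable_bracket_pow.mul_left C).tsum_subtype_le _ _ fun k => by
          have := bracket_pos k; positivity
    _ = _ := tsum_mul_left

theorem coordDeriv_fourierTail {F : ι → Phase d → ℝ} (h : ∀ n, UnifBdd n F) (i : ι) (c : ℝ)
    (K : ℕ) (a : Fin d ⊕ Fin d) :
    coordDeriv a (fun x => c * fourierTail K (F i) x) =
      fun x => c * fourierTail K (coordDeriv a (F i)) x := by
  ext x
  have hF := ((h 1).2.1 i x).hasFDerivAt
  have hC : ∀ k, HasFDerivAt (cosMode k (F i)) (fderiv ℝ (cosMode k (F i)) x) x := fun k =>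
    ((h 1).cosMode.2.1 (i, k) x).hasFDerivAt
  have h1 := (hF.fun_sub (HasFDerivAt.fun_sum (u := modes d K) fun k _ => hC k)).const_mul c
  have h2 : ∀ k, fderiv ℝ (cosMode k (F i)) x (coordDir a) = cosMode k (coordDeriv a (F i)) x :=
    fun k => congrFun (coordDeriv_modeAvg (continuous_cos_dotInt k)
      (fun _ => Real.abs_cos_le_one _) h i a) x
  change fderiv ℝ (fun x => c * (F i x - ∑ k ∈ modes d K, cosMode k (F i) x)) x (coordDir a) = _
  rw [h1.fderiv]
  simp [h2, fourierTail, coordDeriv]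

theorem wordDeriv_fourierTail {F : ι → Phase d → ℝ} (h : ∀ n, UnifBdd n F) (i : ι) (c : ℝ)
    (K : ℕ) (w : List (Fin d ⊕ Fin d)) :
    wordDeriv w (fun x => c * fourierTail K (F i) x) =
      fun x => c * fourierTail K (wordDeriv w (F i)) x := by
  induction w with
  | nil => rfl
  | cons a w ih =>
    change coordDeriv a (wordDeriv w _) = _
    rw [ih]
    exact coordDeriv_fourierTail (fun n => UnifBdd.wordDeriv h w n) i c K a

theorem contDiff_cosMode {F : ι → Phase d → ℝ} (h : ∀ n, UnifBdd n F) (i : ι) (k : Fin d → ℤ) :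
    ContDiff ℝ ∞ (cosMode k (F i)) :=
  contDiff_of_unifBdd (fun n => (h n).cosMode) (i, k)

/-- The high frequency part of a uniformly bounded family decays faster than any power of the
cutoff. -/
theorem unifBdd_fourierTail {F : ι → Phase d → ℝ} (h : ∀ n, UnifBdd n F)
    (hp : ∀ i, IsPeriodic (F i)) (K : ι → ℕ) (M n : ℕ) :
    UnifBdd n (fun i x => (K i : ℝ) ^ M * fourierTail (K i) (F i) x) := by
  refine unifBdd_of_wordDeriv (fun i => ?_) fun w => ?_
  · exact contDiff_const.mul ((contDiff_of_unifBdd h i).sub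
      (ContDiff.sum fun k _ => contDiff_cosMode h i k))
  · obtain ⟨C, hC⟩ := fourierTail_bound (fun n => UnifBdd.wordDeriv h w n)
      (fun i => (hp i).wordDeriv w) M
    refine ⟨C, fun i x => ?_⟩
    rw [wordDeriv_fourierTail h, abs_mul, abs_of_nonneg (by positivity)]
    exact hC i (K i) x

theorem boxAvg_exp (l : Fin d → ℤ) :
    (boxAvg fun θ : Fin d → ℝ => Complex.exp (Complex.I * (dotInt θ l : ℂ))) =
      if l = 0 then 1 else 0 := by
  split_ifs with hl
  · subst hl
    simpa [dotInt] using boxAvg_const (d := d) (1 : ℂ)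
  obtain ⟨j, hj⟩ : ∃ j, l j ≠ 0 := Function.ne_iff.1 hl
  have hj' : (l j : ℝ) ≠ 0 := by exact_mod_cast hj
  -- A translation by `π / l_j` in the `j`-th variable multiplies the exponential by `-1`; by
  -- invariance the mean equals its own negative.
  set s : Fin d → ℝ := (Real.pi / l j) • Pi.single j 1 with hs
  have hper : TorusPeriodic fun θ : Fin d → ℝ => Complex.exp (Complex.I * (dotInt θ l : ℂ)) :=
    fun k θ => by simpa using exp_dotInt_periodic l k θ 1 (Or.inl rfl)
  have h1 := boxAvg_add_right hper s
  have hds : dotInt s l = Real.pi := by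
    rw [hs, dotInt_smul, dotInt_single]; field_simp
  have e : (fun θ : Fin d → ℝ => Complex.exp (Complex.I * (dotInt (θ + s) l : ℂ))) =
      fun θ => (-1 : ℂ) • Complex.exp (Complex.I * (dotInt θ l : ℂ)) := by
    ext θ
    rw [dotInt_add, hds]
    push_cast
    rw [mul_add, Complex.exp_add, mul_comm Complex.I (Real.pi : ℂ), Complex.exp_pi_mul_I,
      smul_eq_mul, mul_comm]
  rw [e, boxAvg_smul, smul_eq_mul, neg_one_mul] at h1
  exact self_eq_neg.1 h1.symm

/-- Fourier coefficients of a trigonometric polynomial. -/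
theorem fourierCoef_of_eq_sum {Z : Phase d → ℝ} {p : Fin d → ℝ} {s : Finset (Fin d → ℤ)}
    {c : (Fin d → ℤ) → ℂ}
    (hZ : ∀ q, (Z (p, q) : ℂ) = ∑ l ∈ s, c l * Complex.exp (Complex.I * (dotInt q l : ℂ)))
    (k : Fin d → ℤ) : fourierCoef Z k p = if k ∈ s then c k else 0 := by
  rw [fourierCoef_eq_boxAvg]
  have e : (fun θ => (Z (p, θ) : ℂ) * Complex.exp (-Complex.I * (dotInt θ k : ℂ))) =
      fun θ => ∑ l ∈ s, c l • Complex.exp (Complex.I * (dotInt θ (l - k) : ℂ)) := by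
    ext θ
    rw [hZ, Finset.sum_mul]
    refine Finset.sum_congr rfl fun l _ => ?_
    have : dotInt θ (l - k) = dotInt θ l - dotInt θ k := by
      simp [dotInt, mul_sub]
    rw [this, smul_eq_mul, mul_assoc, ← Complex.exp_add]
    congr 2
    push_cast
    ring
  rw [e, boxAvg_sum]
  · have h1 : ∀ l, (boxAvg fun θ => c l • Complex.exp (Complex.I * (dotInt θ (l - k) : ℂ))) =
        if l = k then c l else 0 := fun l => by
      rw [boxAvg_smul, boxAvg_exp]
      simp [sub_eq_zero]
    simp only [h1]
    rw [Finset.sum_ite_eq']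
  · intro l _
    have := continuous_dotInt (d := d) (l - k)
    fun_prop

theorem sinMode_neg (k : Fin d → ℤ) (F : Phase d → ℝ) (x : Phase d) :
    sinMode (-k) F x = -sinMode k F x := by
  have := boxAvg_smul (-1 : ℝ) fun θ => Real.sin (dotInt θ k) • F (x - (0, θ))
  simpa [sinMode, modeAvg, dotInt_neg] using this

theorem neg_mem_modes {K : ℕ} {k : Fin d → ℤ} : -k ∈ modes d K ↔ k ∈ modes d K := by
  simp [mem_modes]

/-- A real trigonometric polynomial obtained from `F` by even multipliers has the multiplied
coefficients of `F`. -/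
theorem sum_mul_cosMode_eq {F : Phase d → ℝ} (hF : IsPeriodic F) (hc : Continuous F) (K : ℕ)
    {c : (Fin d → ℤ) → ℝ} (hcn : ∀ k, c (-k) = c k) (p q : Fin d → ℝ) :
    ((∑ k ∈ modes d K, c k * cosMode k F (p, q) : ℝ) : ℂ) =
      ∑ k ∈ modes d K, c k * fourierCoef F k p * Complex.exp (Complex.I * (dotInt q k : ℂ)) := by
  -- The imaginary parts are odd in `k`, while the multipliers and the set of modes are even, so
  -- they cancel in pairs.
  have h0 : ∑ k ∈ modes d K, c k * sinMode k F (p, q) = 0 := by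
    have : ∑ k ∈ modes d K, c k * sinMode k F (p, q) =
        ∑ k ∈ modes d K, -(c k * sinMode k F (p, q)) := by
      refine Finset.sum_bij' (fun k _ => -k) (fun k _ => -k) (fun k hk => neg_mem_modes.2 hk)
        (fun k hk => neg_mem_modes.2 hk) (fun k _ => neg_neg k) (fun k _ => neg_neg k)
        fun k _ => ?_
      rw [sinMode_neg, hcn]
      ring
    rw [Finset.sum_neg_distrib] at this
    linarith
  have h1 : ((∑ k ∈ modes d K, c k * sinMode k F (p, q) : ℝ) : ℂ) = 0 := by rw [h0]; simp
  simp only [mul_assoc, fourierCoef_mul_exp hF hc]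
  push_cast at h1 ⊢
  simp only [mul_add, Finset.sum_add_distrib]
  simp only [mul_left_comm _ Complex.I, ← Finset.mul_sum, h1, mul_zero, add_zero]

end Fourier

/-! ### Cutoff functions -/

section Cutoff

open Set

variable {ι : Type*} {E E' : Type} [NormedAddCommGroup E] [NormedSpace ℝ E]
  [NormedAddCommGroup E'] [NormedSpace ℝ E'] {V : Type} [NormedAddCommGroup V] [NormedSpace ℝ V]

theorem unifBdd_of_hasCompactSupport {n : ℕ} : ∀ {V : Type} [NormedAddCommGroup V]
    [NormedSpace ℝ V] {f : E → V}, ContDiff ℝ ∞ f → HasCompactSupport f →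
    UnifBdd n (fun _ : Unit => f) := by
  induction n with
  | zero =>
    intro V _ _ f hf hs
    obtain ⟨C, hC⟩ := hs.exists_bound_of_continuous hf.continuous
    obtain ⟨K, hK⟩ := (hs.fderiv (𝕜 := ℝ)).exists_bound_of_continuous
      (hf.continuous_fderiv (by simp))
    refine unifBdd_zero_of (fun _ => hC) (K := K) fun _ x y => ?_
    exact Convex.norm_image_sub_le_of_norm_fderiv_le (s := univ)
      (fun z _ => hf.differentiable (by simp) z) (fun z _ => hK z) convex_univ (mem_univ y)
      (mem_univ x)
  | succ n ih =>
    intro V _ _ f hf hs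
    obtain ⟨C, hC⟩ := hs.exists_bound_of_continuous hf.continuous
    exact ⟨⟨C, fun _ => hC⟩, fun _ => hf.differentiable (by simp),
      ih (hf.fderiv_right (by simp)) (hs.fderiv (𝕜 := ℝ))⟩

/-- Dividing by the variable a function that vanishes near the origin. -/
theorem UnifBdd.inv_smul {n : ℕ} : ∀ {V : Type} [NormedAddCommGroup V] [NormedSpace ℝ V]
    {f : ℝ → V}, UnifBdd n (fun _ : Unit => f) → (∀ s, |s| < 1 / 2 → f s = 0) →
    UnifBdd n (fun (_ : Unit) s => s⁻¹ • f s) := by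
  have hinv : ∀ s : ℝ, 1 / 2 ≤ |s| → |s⁻¹| ≤ 2 := fun s hs => by
    rw [abs_inv]
    exact inv_le_of_inv_le₀ (by norm_num) (by linarith)
  have bdd : ∀ {V : Type} [NormedAddCommGroup V] [NormedSpace ℝ V] {f : ℝ → V} {C : ℝ}, 0 ≤ C →
      (∀ s, ‖f s‖ ≤ C) → (∀ s, |s| < 1 / 2 → f s = 0) → ∀ s, ‖s⁻¹ • f s‖ ≤ 2 * C := by
    intro V _ _ f C hC0 hC h0 s
    rcases lt_or_ge |s| (1 / 2) with hs | hs
    · rw [h0 s hs]; simpa using hC0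
    · rw [norm_smul, Real.norm_eq_abs]
      gcongr
      exacts [hinv s hs, hC s]
  induction n with
  | zero =>
    intro V _ _ f hf h0
    obtain ⟨C, hC0, hC⟩ := hf.bounded
    obtain ⟨K, hK0, hK⟩ := hf.lipschitz
    have key : ∀ s t : ℝ, 1 / 2 ≤ |s| → ‖s⁻¹ • f s - t⁻¹ • f t‖ ≤ (2 * K + 4 * C) * ‖s - t‖ := by
      intro s t hs
      have h1 : ‖s⁻¹ • (f s - f t)‖ ≤ 2 * (K * ‖s - t‖) := by
        rw [norm_smul, Real.norm_eq_abs]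
        gcongr
        exacts [hinv s hs, hK () s t]
      rcases lt_or_ge |t| (1 / 2) with ht | ht
      · have e : s⁻¹ • f s - t⁻¹ • f t = s⁻¹ • (f s - f t) := by simp [h0 t ht]
        rw [e]
        refine h1.trans ?_
        have : 0 ≤ 4 * C * ‖s - t‖ := by positivity
        linarith
      · have hs0 : s ≠ 0 := fun h => by norm_num [h] at hs
        have ht0 : t ≠ 0 := fun h => by norm_num [h] at ht
        have e : s⁻¹ • f s - t⁻¹ • f t = s⁻¹ • (f s - f t) + (s⁻¹ * t⁻¹ * (t - s)) • f t := by
          have : s⁻¹ * t⁻¹ * (t - s) = s⁻¹ - t⁻¹ := by field_simp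
          rw [this, smul_sub, sub_smul]
          abel
        rw [e]
        have h2 : ‖(s⁻¹ * t⁻¹ * (t - s)) • f t‖ ≤ 2 * 2 * ‖s - t‖ * C := by
          rw [norm_smul, Real.norm_eq_abs, abs_mul, abs_mul, Real.norm_eq_abs, abs_sub_comm t s]
          gcongr
          exacts [hinv s hs, hinv t ht, hC () t]
        refine (norm_add_le _ _).trans ((add_le_add h1 h2).trans (le_of_eq (by ring)))
    refine unifBdd_zero_of (fun _ => bdd hC0 (hC ()) h0) (K := 2 * K + 4 * C) fun _ s t => ?_
    rcases lt_or_ge |s| (1 / 2) with hs | hs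
    · rcases lt_or_ge |t| (1 / 2) with ht | ht
      · rw [h0 s hs, h0 t ht]
        simp only [smul_zero, sub_self, norm_zero]
        positivity
      · rw [norm_sub_rev, norm_sub_rev s t]
        exact key t s ht
    · exact key s t hs
  | succ n ih =>
    intro V _ _ f hf h0
    obtain ⟨C, hC0, hC⟩ := hf.bounded
    have hopen : IsOpen {s : ℝ | |s| < 1 / 2} := isOpen_lt continuous_abs continuous_const
    have hev : ∀ s : ℝ, |s| < 1 / 2 → f =ᶠ[nhds s] fun _ => 0 := fun s hs =>
      Filter.eventuallyEq_of_mem (hopen.mem_nhds hs) fun t ht => h0 t ht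
    have hd0 : ∀ s, |s| < 1 / 2 → fderiv ℝ f s = 0 := fun s hs => by
      rw [(hev s hs).fderiv_eq]; simp
    set L : V →L[ℝ] (ℝ →L[ℝ] V) :=
      ContinuousLinearMap.smulRightL ℝ ℝ V (ContinuousLinearMap.id ℝ ℝ) with hL
    -- Both terms of the quotient rule are again functions vanishing near `0`, divided by `s` once
    -- or twice, so the induction closes.
    have hder : ∀ s, HasFDerivAt (fun s => s⁻¹ • f s)
        (s⁻¹ • fderiv ℝ f s - s⁻¹ • (s⁻¹ • L (f s))) s := by
      intro s
      rcases lt_or_ge |s| (1 / 2) with hs | hs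
      · rw [hd0 s hs, h0 s hs]
        simp only [map_zero, smul_zero, sub_zero]
        refine (hasFDerivAt_const (0 : V) s).congr_of_eventuallyEq ?_
        filter_upwards [hev s hs] with t ht
        rw [ht, smul_zero]
      · have hs0 : s ≠ 0 := fun h => by norm_num [h] at hs
        have h1 := (hasDerivAt_inv hs0).hasFDerivAt.smul (hf.2.1 () s).hasFDerivAt
        refine h1.congr_fderiv ?_
        refine ContinuousLinearMap.ext fun t => ?_
        have hLt : L (f s) t = t • f s := rfl
        simp only [hLt, add_apply, sub_apply, smul_apply, ContinuousLinearMap.smulRight_apply,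
          ContinuousLinearMap.toSpanSingleton_apply, smul_smul, smul_eq_mul]
        rw [sub_eq_add_neg, ← neg_smul]
        congr 2
        field_simp
    refine ⟨⟨2 * C, fun _ => bdd hC0 (hC ()) h0⟩, fun _ s => (hder s).differentiableAt, ?_⟩
    have e1 := ih hf.2.2 hd0
    have e2 := ih (ih (hf.of_succ.clm L) fun s hs => by simp [h0 s hs]) fun s hs => by
      simp [h0 s hs]
    convert e1.sub e2 using 3 with u s
    exact (hder s).fderiv

/-- A smooth even cutoff: `1` on `[-1/2, 1/2]` and `0` outside of `(-1, 1)`. -/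
def cutoffBump : ContDiffBump (0 : ℝ) := ⟨1 / 2, 1, by norm_num, by norm_num⟩

/-- The resonant cutoff `χ`. -/
def resCutoff (s : ℝ) : ℝ := cutoffBump s

/-- The regularised divisor `(1 - χ(s)) / s`. -/
def regDivisor (s : ℝ) : ℝ := s⁻¹ * (1 - resCutoff s)

theorem resCutoff_neg (s : ℝ) : resCutoff (-s) = resCutoff s := cutoffBump.neg s

theorem resCutoff_eq_one {s : ℝ} (hs : |s| ≤ 1 / 2) : resCutoff s = 1 :=
  cutoffBump.one_of_mem_closedBall (by simpa [cutoffBump] using hs)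

theorem abs_lt_one_of_resCutoff_ne_zero {s : ℝ} (hs : resCutoff s ≠ 0) : |s| < 1 := by
  have : s ∈ Function.support cutoffBump := hs
  rw [cutoffBump.support_eq] at this
  simpa [cutoffBump] using this

theorem mul_regDivisor (s : ℝ) : s * regDivisor s = 1 - resCutoff s := by
  rcases eq_or_ne s 0 with rfl | hs
  · rw [resCutoff_eq_one (by norm_num)]; simp
  · rw [regDivisor, mul_inv_cancel_left₀ hs]

theorem unifBdd_resCutoff (n : ℕ) : UnifBdd n (fun _ : Unit => resCutoff) :=
  unifBdd_of_hasCompactSupport cutoffBump.contDiff cutoffBump.hasCompactSupport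

theorem unifBdd_regDivisor (n : ℕ) : UnifBdd n (fun _ : Unit => regDivisor) :=
  UnifBdd.inv_smul (f := fun s => 1 - resCutoff s)
    ((unifBdd_const (c := fun _ : Unit => (1 : ℝ)) (C := 1) (by simp)).sub (unifBdd_resCutoff n))
    fun s hs => by rw [resCutoff_eq_one hs.le, sub_self]

/-- Composition with linear maps, with the loss of powers of their norms. -/
theorem UnifBdd.comp_clm {n : ℕ} {L : ι → E →L[ℝ] E'} {c : ι → ℝ} (hc : ∀ i, 1 ≤ c i)
    (hL : ∀ i, ‖L i‖ ≤ c i) : ∀ {V : Type} [NormedAddCommGroup V] [NormedSpace ℝ V]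
    {f : E' → V}, UnifBdd n (fun _ : Unit => f) →
    UnifBdd n (fun i x => (c i ^ (n + 1))⁻¹ • f (L i x)) := by
  have hinv : ∀ i m, |(c i ^ m)⁻¹| ≤ 1 := fun i m => by
    have h1 : 1 ≤ c i ^ m := one_le_pow₀ (hc i)
    rw [abs_of_pos (by positivity)]
    exact inv_le_one_of_one_le₀ h1
  have bdd : ∀ {V : Type} [NormedAddCommGroup V] [NormedSpace ℝ V] {f : E' → V} {C : ℝ} (m : ℕ),
      (∀ s, ‖f s‖ ≤ C) → ∀ i x, ‖(c i ^ m)⁻¹ • f (L i x)‖ ≤ C := by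
    intro V _ _ f C m hC i x
    rw [norm_smul, Real.norm_eq_abs]
    calc _ ≤ 1 * C := by
          gcongr
          exacts [hinv i m, hC _]
      _ = C := one_mul C
  induction n with
  | zero =>
    intro V _ _ f hf
    obtain ⟨C, hC0, hC⟩ := hf.bounded
    obtain ⟨K, hK0, hK⟩ := hf.lipschitz
    refine unifBdd_zero_of (bdd _ (hC ())) (K := K) fun i x y => ?_
    have hci : 0 < c i := zero_lt_one.trans_le (hc i)
    rw [← smul_sub, norm_smul, zero_add, pow_one, Real.norm_eq_abs, abs_of_pos (by positivity)]
    have h1 := hK () (L i x) (L i y)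
    rw [← map_sub] at h1
    have h2 := (L i).le_of_opNorm_le (hL i) (x - y)
    calc (c i)⁻¹ * ‖f (L i x) - f (L i y)‖ ≤ (c i)⁻¹ * (K * (c i * ‖x - y‖)) := by
          gcongr
          exact h1.trans (by gcongr)
      _ = K * ‖x - y‖ := by field_simp
  | succ n ih =>
    intro V _ _ f hf
    obtain ⟨C, hC0, hC⟩ := hf.bounded
    -- Differentiation brings out one factor `L i`. One of the `n + 2` inverse powers of `c i`
    -- normalizes it, and the other `n + 1` remain for the induction hypothesis.
    have hder : ∀ i x, HasFDerivAt (fun x => (c i ^ (n + 1 + 1))⁻¹ • f (L i x))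
        (((c i ^ (n + 1))⁻¹ • fderiv ℝ f (L i x)).comp ((c i)⁻¹ • L i)) x := by
      intro i x
      have h1 := ((hf.2.1 () (L i x)).hasFDerivAt.comp x (L i).hasFDerivAt).const_smul
        (c i ^ (n + 1 + 1))⁻¹
      refine h1.congr_fderiv ?_
      rw [ContinuousLinearMap.comp_smul, ContinuousLinearMap.smul_comp, smul_smul,
        pow_succ _ (n + 1), mul_inv, mul_comm]
    refine ⟨⟨C, bdd _ (hC ())⟩, fun i x => (hder i x).differentiableAt, ?_⟩
    have h1 : UnifBdd n (fun i (_ : E) => (c i)⁻¹ • L i) := unifBdd_const (C := 1) fun i => by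
      have hci : 0 < c i := zero_lt_one.trans_le (hc i)
      rw [norm_smul, norm_inv, Real.norm_eq_abs, abs_of_pos hci, inv_mul_le_iff₀ hci, mul_one]
      exact hL i
    convert UnifBdd.bilin (ContinuousLinearMap.compL ℝ E E' V) (ih hf.2.2) h1 using 3 with i x
    exact (hder i x).fderiv

end Cutoff

/-! ### The homological equation -/

section Homological

open Set

variable {ι : Type*} {d : ℕ}

/-- The linear functional `(p, q) ↦ p · k`. -/
def actionDot (k : Fin d → ℤ) : Phase d →L[ℝ] ℝ := ∑ j, (k j : ℝ) • coordProj (Sum.inl j)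

theorem actionDot_apply (k : Fin d → ℤ) (x : Phase d) : actionDot k x = dotInt x.1 k := by
  simp [actionDot, coordProj, dotInt, mul_comm]

theorem norm_actionDot_le (k : Fin d → ℤ) : ‖actionDot k‖ ≤ bracket k := by
  refine ContinuousLinearMap.opNorm_le_bound _ (bracket_pos k).le fun x => ?_
  rw [actionDot_apply, dotInt, bracket, add_mul, Finset.sum_mul]
  refine (norm_sum_le _ _).trans ?_
  have : ∑ j, ‖x.1 j * (k j : ℝ)‖ ≤ ∑ j, |(k j : ℝ)| * ‖x‖ := by
    refine Finset.sum_le_sum fun j _ => ?_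
    rw [norm_mul, mul_comm, Real.norm_eq_abs (k j : ℝ)]
    gcongr
    exact (norm_le_pi_norm x.1 j).trans (norm_fst_le x)
  linarith [norm_nonneg x]

/-- The resonant part of `F`. -/
def resPart (K : ℕ) (F : Phase d → ℝ) (y : Phase d) : ℝ :=
  ∑ k ∈ modes d K, resCutoff (dotInt y.1 k) * cosMode k F y

/-- The solution of the homological equation. -/
def homSol (K : ℕ) (F : Phase d → ℝ) (y : Phase d) : ℝ :=
  ∑ k ∈ modes d K, regDivisor (dotInt y.1 k) * sinMode k F y

/-- Derivatives of `f(y·k)` grow like powers of the bracket, but the coefficients decay faster than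
any power. The estimate is therefore uniform in the truncation `K`. -/
theorem unifBdd_multiplier {f : ℝ → ℝ} (hf : ∀ n, UnifBdd n (fun _ : Unit => f))
    {G : ι × (Fin d → ℤ) → Phase d → ℝ}
    (hG : ∀ M n : ℕ, UnifBdd n (fun a x => bracket a.2 ^ M * G a x)) (K : ι → ℕ) (n : ℕ) :
    UnifBdd n (fun i y => ∑ k ∈ modes d (K i), f (dotInt y.1 k) * G (i, k) y) := by
  have h1 := (UnifBdd.comp_clm (L := fun k : Fin d → ℤ => actionDot k) one_le_bracket
    norm_actionDot_le (hf n)).reindex (fun a : ι × (Fin d → ℤ) => a.2)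
  -- The power `n + 1` pays for the multiplier in `C^{n,1}`; the power `2d` makes the sum over
  -- frequencies converge.
  have h2 := h1.mul (hG (2 * d + (n + 1)) n)
  have h3 := UnifBdd.finset_sum (s := fun i => modes d (K i))
    (c := fun k => (bracket k ^ (2 * d))⁻¹) (M := ∑' k : Fin d → ℤ, (bracket k ^ (2 * d))⁻¹)
    (fun i => ?_) h2
  · convert h3 using 3 with i y
    refine Finset.sum_congr rfl fun k _ => ?_
    have := bracket_pos k
    simp only [actionDot_apply, smul_eq_mul, pow_add]
    field_simp
  · have : ∀ k : Fin d → ℤ, 0 ≤ (bracket k ^ (2 * d))⁻¹ := fun k => by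
      have := bracket_pos k; positivity
    simp only [abs_of_nonneg (this _)]
    exact summable_bracket_pow.sum_le_tsum _ fun k _ => this k

theorem unifBdd_resPart {F : ι → Phase d → ℝ} (h : ∀ n, UnifBdd n F)
    (hp : ∀ i, IsPeriodic (F i)) (K : ι → ℕ) (n : ℕ) :
    UnifBdd n (fun i => resPart (K i) (F i)) :=
  unifBdd_multiplier unifBdd_resCutoff (G := fun a => cosMode a.2 (F a.1))
    (fun M n => (unifBdd_bracket_pow_modes M h hp n).1) K n

theorem unifBdd_homSol {F : ι → Phase d → ℝ} (h : ∀ n, UnifBdd n F)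
    (hp : ∀ i, IsPeriodic (F i)) (K : ι → ℕ) (n : ℕ) :
    UnifBdd n (fun i => homSol (K i) (F i)) :=
  unifBdd_multiplier unifBdd_regDivisor (G := fun a => sinMode a.2 (F a.1))
    (fun M n => (unifBdd_bracket_pow_modes M h hp n).2) K n

theorem shift_fst (k : Fin d → ℤ) (x : Phase d) : (x + shift k).1 = x.1 := by simp [shift]

theorem isPeriodic_resPart (K : ℕ) {F : Phase d → ℝ} (hF : IsPeriodic F) :
    IsPeriodic (resPart K F) := by
  intro k x
  simp only [resPart, shift_fst]
  exact Finset.sum_congr rfl fun l _ => by rw [cosMode, isPeriodic_modeAvg _ hF k x]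

theorem isPeriodic_homSol (K : ℕ) {F : Phase d → ℝ} (hF : IsPeriodic F) :
    IsPeriodic (homSol K F) := by
  intro k x
  simp only [homSol, shift_fst]
  exact Finset.sum_congr rfl fun l _ => by rw [sinMode, isPeriodic_modeAvg _ hF k x]

theorem isPeriodic_fourierTail (K : ℕ) {F : Phase d → ℝ} (hF : IsPeriodic F) :
    IsPeriodic (fourierTail K F) := by
  intro k x
  simp only [fourierTail, hF k x]
  congr 1
  exact Finset.sum_congr rfl fun l _ => by rw [cosMode, isPeriodic_modeAvg _ hF k x]

/-- The multiplier depends on the actions only, so a derivative in `q_j` acts on the mode and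
produces the factor `k_j`. Contracting with `y` then rebuilds the divisor `y·k`. -/
theorem coordDeriv_homSol {F : ι → Phase d → ℝ} (h : ∀ n, UnifBdd n F) {i : ι}
    (hp : IsPeriodic (F i)) (K : ℕ) (j : Fin d) (y : Phase d) :
    coordDeriv (Sum.inr j) (homSol K (F i)) y =
      ∑ k ∈ modes d K, regDivisor (dotInt y.1 k) * ((k j : ℝ) * cosMode k (F i) y) := by
  have h1 : ∀ k, HasFDerivAt (fun y : Phase d => regDivisor (dotInt y.1 k))
      ((fderiv ℝ regDivisor (actionDot k y)).comp (actionDot k)) y := fun k => by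
    have := ((unifBdd_regDivisor 1).2.1 () (actionDot k y)).hasFDerivAt.comp y
      (actionDot k).hasFDerivAt
    refine this.congr_of_eventuallyEq (Filter.Eventually.of_forall fun z => ?_)
    simp [actionDot_apply]
  have h2 : ∀ k, HasFDerivAt (sinMode k (F i)) (fderiv ℝ (sinMode k (F i)) y) y := fun k =>
    ((h 1).sinMode.2.1 (i, k) y).hasFDerivAt
  have h3 := HasFDerivAt.fun_sum (u := modes d K) fun k _ => (h1 k).fun_mul (h2 k)
  change fderiv ℝ (fun y => ∑ k ∈ modes d K, regDivisor (dotInt y.1 k) * sinMode k (F i) y) y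
    (coordDir (Sum.inr j)) = _
  rw [h3.fderiv, sum_apply]
  refine Finset.sum_congr rfl fun k _ => ?_
  have h4 : actionDot k (coordDir (Sum.inr j)) = 0 := by
    rw [actionDot_apply]; simp [coordDir, dotInt]
  have h5 := coordDeriv_sinMode h hp k j y
  rw [coordDeriv] at h5
  simp [h4, h5]

/-- The homological equation. -/
theorem sum_mul_coordDeriv_homSol {F : ι → Phase d → ℝ} (h : ∀ n, UnifBdd n F) {i : ι}
    (hp : IsPeriodic (F i)) (K : ℕ) (y : Phase d) :
    ∑ j, y.1 j * coordDeriv (Sum.inr j) (homSol K (F i)) y =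
      F i y - resPart K (F i) y - fourierTail K (F i) y := by
  have e1 : ∑ j, y.1 j * coordDeriv (Sum.inr j) (homSol K (F i)) y =
      ∑ k ∈ modes d K, (1 - resCutoff (dotInt y.1 k)) * cosMode k (F i) y := by
    simp only [coordDeriv_homSol h hp, Finset.mul_sum]
    rw [Finset.sum_comm]
    refine Finset.sum_congr rfl fun k _ => ?_
    rw [← mul_regDivisor]
    conv_rhs => enter [1, 1]; rw [dotInt]
    rw [Finset.sum_mul, Finset.sum_mul]
    exact Finset.sum_congr rfl fun j _ => by ring
  rw [e1, fourierTail, resPart]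
  simp only [sub_mul, one_mul, Finset.sum_sub_distrib]
  ring

/-- The resonant part is in normal form. -/
theorem isNormalForm_resPart {ε₀ δ β : ℝ} {F : ℝ → Phase d → ℝ}
    (hp : ∀ ε ∈ Ioo 0 ε₀, IsPeriodic (F ε)) (hc : ∀ ε ∈ Ioo 0 ε₀, Continuous (F ε)) :
    IsNormalForm ε₀ δ β (fun ε x => resPart (cutoff β ε) (F ε) (scale (ε ^ (-δ)) x)) := by
  intro ε hε
  have h1 : ∀ p q : Fin d → ℝ,
      ((resPart (cutoff β ε) (F ε) (scale (ε ^ (-δ)) (p, q)) : ℝ) : ℂ) =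
      ∑ k ∈ modes d (cutoff β ε), (resCutoff (dotInt (ε ^ (-δ) • p) k) : ℂ) *
        fourierCoef (F ε) k (ε ^ (-δ) • p) * Complex.exp (Complex.I * (dotInt q k : ℂ)) :=
    fun p q => sum_mul_cosMode_eq (hp ε hε) (hc ε hε) _
      (c := fun k => resCutoff (dotInt (ε ^ (-δ) • p) k))
      (fun k => by rw [dotInt_neg, resCutoff_neg]) _ q
  have h2 : ∀ (p : Fin d → ℝ) k,
      fourierCoef (fun x => resPart (cutoff β ε) (F ε) (scale (ε ^ (-δ)) x)) k p =
      if k ∈ modes d (cutoff β ε) then (resCutoff (dotInt (ε ^ (-δ) • p) k) : ℂ) *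
        fourierCoef (F ε) k (ε ^ (-δ) • p) else 0 := fun p k =>
    fourierCoef_of_eq_sum
      (Z := fun x => resPart (cutoff β ε) (F ε) (scale (ε ^ (-δ)) x)) (s := modes d (cutoff β ε))
      (c := fun k => (resCutoff (dotInt (ε ^ (-δ) • p) k) : ℂ) *
        fourierCoef (F ε) k (ε ^ (-δ) • p)) (h1 p) k
  refine ⟨fun p q => ?_, fun k p _ hk => ?_⟩
  · rw [h1]
    refine Finset.sum_congr rfl fun k hk => ?_
    rw [h2, if_pos hk]
  · rw [h2] at hk
    -- A nonzero coefficient forces `ε^{-δ} p·k` into the support of the cutoff, which is the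
    -- resonance condition in the original actions.
    have h3 : resCutoff (dotInt (ε ^ (-δ) • p) k) ≠ 0 := fun h0 => by simp [h0] at hk
    have h4 := abs_lt_one_of_resCutoff_ne_zero h3
    have hpos : 0 < ε ^ δ := Real.rpow_pos_of_pos hε.1 δ
    rw [dotInt_smul, abs_mul, abs_of_pos (Real.rpow_pos_of_pos hε.1 _), Real.rpow_neg hε.1.le,
      inv_mul_lt_iff₀ hpos, mul_one] at h4
    exact h4.le

end Homological

/-! ### Hamiltonian flows -/

section HamFlow

open Set

variable {ι : Type*} {d : ℕ}

theorem contDiff_of_unifMap {E V : Type} [NormedAddCommGroup E] [NormedSpace ℝ E]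
    [NormedAddCommGroup V] [NormedSpace ℝ V] {φ : ι → E → V} (h : ∀ n, UnifMap n φ) (i : ι) :
    ContDiff ℝ ∞ (φ i) :=
  contDiff_infty_iff_fderiv.2 ⟨(h 1).1 i, contDiff_of_unifBdd (fun n => (h (n + 1)).2) i⟩

/-- The linear map `ℓ ↦ (-ℓ_q, ℓ_p)` from covectors to vectors. -/
def symplGrad : (Phase d →L[ℝ] ℝ) →L[ℝ] Phase d :=
  (ContinuousLinearMap.pi fun j =>
    -ContinuousLinearMap.apply ℝ ℝ (coordDir (Sum.inr j))).prod
  (ContinuousLinearMap.pi fun j => ContinuousLinearMap.apply ℝ ℝ (coordDir (Sum.inl j)))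

theorem hamVF_eq_symplGrad (g : Phase d → ℝ) (x : Phase d) :
    hamVF g x = symplGrad (fderiv ℝ g x) := rfl

theorem hamVF_fst (g : Phase d → ℝ) (x : Phase d) (j : Fin d) :
    (hamVF g x).1 j = -coordDeriv (Sum.inr j) g x := rfl

theorem hamVF_snd (g : Phase d → ℝ) (x : Phase d) (j : Fin d) :
    (hamVF g x).2 j = coordDeriv (Sum.inl j) g x := rfl

theorem unifBdd_hamVF {G : ι → Phase d → ℝ} (h : ∀ n, UnifBdd n G) (n : ℕ) :
    UnifBdd n (fun i => hamVF (G i)) :=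
  (fderiv_unifBdd h n).clm symplGrad

theorem exists_isHamFlow {G : ι → Phase d → ℝ} (h : ∀ n, UnifBdd n G) (i : ι) :
    ∃ Φ, IsHamFlow (G i) Φ := by
  obtain ⟨L, -, hL⟩ := (unifBdd_hamVF h 0).bounded
  obtain ⟨K, hK0, hK⟩ := (unifBdd_hamVF h 0).lipschitz
  exact exists_global_flow (hL i) hK0 (hK i)

theorem IsHamFlow.unique {G : ι → Phase d → ℝ} (h : ∀ n, UnifBdd n G) {i : ι} {γ η : ℝ → Phase d}
    (hγ : ∀ t, HasDerivAt γ (hamVF (G i) (γ t)) t) (hη : ∀ t, HasDerivAt η (hamVF (G i) (η t)) t)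
    (h0 : γ 0 = η 0) : γ = η := by
  obtain ⟨K, hK0, hK⟩ := (unifBdd_hamVF h 0).lipschitz
  have hlip : LipschitzWith ⟨K, hK0⟩ (hamVF (G i)) := LipschitzWith.of_dist_le_mul fun x y => by
    rw [dist_eq_norm, dist_eq_norm]; exact hK i x y
  exact ODE_solution_unique_univ (v := fun _ => hamVF (G i)) (s := fun _ => univ)
    (fun _ => hlip.lipschitzOnWith) (fun t => ⟨hγ t, trivial⟩) (fun t => ⟨hη t, trivial⟩) h0

theorem IsHamFlow.add_time {G : ι → Phase d → ℝ} (h : ∀ n, UnifBdd n G) {i : ι}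
    {Φ : ℝ → Phase d → Phase d} (hΦ : IsHamFlow (G i) Φ) (s t : ℝ) (x : Phase d) :
    Φ (t + s) x = Φ t (Φ s x) := by
  refine congrFun (IsHamFlow.unique h (γ := fun t => Φ (t + s) x) (η := fun t => Φ t (Φ s x))
    (fun t => ?_) (fun t => (hΦ _).2 t) ?_) t
  · exact ((hΦ x).2 (t + s)).comp_add_const t s
  · rw [zero_add, (hΦ _).1]

theorem hamVF_periodic {g : Phase d → ℝ} (hg : IsPeriodic g) (k : Fin d → ℤ) (x : Phase d) :
    hamVF g (x + shift k) = hamVF g x := by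
  refine Prod.ext ?_ ?_ <;> ext j
  · rw [hamVF_fst, hamVF_fst, hg.coordDeriv _ k x]
  · rw [hamVF_snd, hamVF_snd, hg.coordDeriv _ k x]

theorem IsHamFlow.shift {G : ι → Phase d → ℝ} (h : ∀ n, UnifBdd n G) {i : ι}
    (hp : IsPeriodic (G i)) {Φ : ℝ → Phase d → Phase d} (hΦ : IsHamFlow (G i) Φ) (t : ℝ)
    (x : Phase d) (k : Fin d → ℤ) : Φ t (x + shift k) = Φ t x + shift k := by
  refine congrFun (IsHamFlow.unique h (γ := fun t => Φ t (x + NormalFormLemma.shift k))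
    (η := fun t => Φ t x + NormalFormLemma.shift k) (fun t => (hΦ _).2 t) (fun t => ?_) ?_) t
  · rw [hamVF_periodic hp]
    exact ((hΦ x).2 t).add_const _
  · rw [(hΦ _).1, (hΦ _).1]

/-- The Poisson bracket `∑ (∂_q f ∂_p g - ∂_p f ∂_q g)`. -/
def poisson (f g : Phase d → ℝ) (x : Phase d) : ℝ := fderiv ℝ f x (hamVF g x)

theorem IsHamFlow.hasDerivAt_comp {g f : Phase d → ℝ} {Φ : ℝ → Phase d → Phase d}
    (hΦ : IsHamFlow g Φ) (hf : Differentiable ℝ f) (x : Phase d) (t : ℝ) :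
    HasDerivAt (fun s => f (Φ s x)) (poisson f g (Φ t x)) t :=
  (hf (Φ t x)).hasFDerivAt.comp_hasDerivAt t ((hΦ x).2 t)

theorem IsHamFlow.regularity {G : ι → Phase d → ℝ} (h : ∀ n, UnifBdd n G)
    {Φ : ι → ℝ → Phase d → Phase d} (hΦ : ∀ i, IsHamFlow (G i) (Φ i)) :
    (∀ n, UnifMap n (fun (a : ι × Icc (0 : ℝ) 1) x => Φ a.1 a.2 x)) ∧
    ∀ i x, ∀ t ∈ Icc (0 : ℝ) 1, HasDerivWithinAt (fun s => fderiv ℝ (Φ i s) x)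
      ((fderiv ℝ (hamVF (G i)) (Φ i t x)).comp (fderiv ℝ (Φ i t) x)) (Icc 0 1) t :=
  flow_regularity (unifBdd_hamVF h) (fun i x => (hΦ i x).1)
    fun i x t _ => ((hΦ i x).2 t).hasDerivWithinAt

theorem IsHamFlow.neg_time {g : Phase d → ℝ} {Φ : ℝ → Phase d → Phase d} (hΦ : IsHamFlow g Φ) :
    IsHamFlow (fun x => -g x) (fun t => Φ (-t)) := by
  intro x
  refine ⟨by simpa using (hΦ x).1, fun t => ?_⟩
  have h1 := ((hΦ x).2 (-t)).scomp t (hasDerivAt_neg t)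
  have h2 : hamVF (fun x => -g x) (Φ (-t) x) = -hamVF g (Φ (-t) x) := by
    rw [hamVF_eq_symplGrad, hamVF_eq_symplGrad, fderiv_fun_neg, map_neg]
  rw [h2]
  simpa using! h1

/-! ### Symplecticity of Hamiltonian flows and conjugation by rescaling -/

/-- The functional `u ↦ symp u v`. -/
def sympRight (v : Phase d) : Phase d →L[ℝ] ℝ :=
  ∑ j, (v.2 j • coordProj (Sum.inl j) - v.1 j • coordProj (Sum.inr j))

theorem sympRight_apply (u v : Phase d) : sympRight v u = symp u v := by
  simp [sympRight, symp, coordProj, mul_comm]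

theorem symp_swap (u v : Phase d) : symp u v = -symp v u := by
  rw [symp, symp, ← Finset.sum_neg_distrib]
  exact Finset.sum_congr rfl fun j _ => by ring

theorem symp_hamVF (g : Phase d → ℝ) (x v : Phase d) : symp (hamVF g x) v = -fderiv ℝ g x v := by
  rw [clm_eq_sum_coord (fderiv ℝ g x), Fintype.sum_sum_type]
  simp only [add_apply, sum_apply, ContinuousLinearMap.smulRight_apply, symp, hamVF_fst,
    hamVF_snd, coordDeriv, smul_eq_mul]
  rw [← Finset.sum_add_distrib, ← Finset.sum_neg_distrib]
  refine Finset.sum_congr rfl fun j _ => ?_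
  simp [coordProj]
  ring

/-- The linearization of a Hamiltonian vector field is infinitesimally symplectic. -/
theorem symp_fderiv_hamVF {g : Phase d → ℝ} (hg : ContDiff ℝ ∞ g) (x u v : Phase d) :
    symp (fderiv ℝ (hamVF g) x u) v + symp u (fderiv ℝ (hamVF g) x v) = 0 := by
  have hd : Differentiable ℝ (fderiv ℝ g) :=
    (hg.fderiv_right (m := ∞) (by simp)).differentiable (by simp)
  have hX : Differentiable ℝ (hamVF g) := symplGrad.differentiable.comp hd
  -- Pairing the linearized field with a vector gives minus the Hessian of `g`, so the identity
  -- reduces to symmetry of the Hessian.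
  have key : ∀ a b : Phase d, symp (fderiv ℝ (hamVF g) x a) b =
      -fderiv ℝ (fderiv ℝ g) x a b := by
    intro a b
    have h1 : HasFDerivAt (fun z => sympRight b (hamVF g z))
        ((sympRight b).comp (fderiv ℝ (hamVF g) x)) x :=
      (sympRight b).hasFDerivAt.comp x (hX x).hasFDerivAt
    have h2 : HasFDerivAt (fun z => -fderiv ℝ g z b)
        (-((ContinuousLinearMap.apply ℝ ℝ b).comp (fderiv ℝ (fderiv ℝ g) x))) x :=
      ((ContinuousLinearMap.apply ℝ ℝ b).hasFDerivAt.comp x (hd x).hasFDerivAt).neg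
    have h3 : (fun z => sympRight b (hamVF g z)) = fun z => -fderiv ℝ g z b := by
      ext z; rw [sympRight_apply, symp_hamVF]
    rw [h3] at h1
    have h4 := congrArg (fun L => L a) (h1.unique h2)
    simpa [sympRight_apply] using h4
  have hs : IsSymmSndFDerivAt ℝ g x := (hg.contDiffAt).isSymmSndFDerivAt
    (by
      rw [minSmoothness_of_isRCLikeNormedField]
      exact WithTop.coe_le_coe.2 le_top)
  rw [symp_swap u, key, key, hs.eq u v]
  ring

theorem hasDerivWithinAt_symp {a b : ℝ → Phase d} {a' b' : Phase d} {s : Set ℝ} {t : ℝ}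
    (ha : HasDerivWithinAt a a' s t) (hb : HasDerivWithinAt b b' s t) :
    HasDerivWithinAt (fun t => symp (a t) (b t)) (symp a' (b t) + symp (a t) b') s t := by
  have hc : ∀ (c : Fin d ⊕ Fin d) {y : ℝ → Phase d} {y' : Phase d}, HasDerivWithinAt y y' s t →
      HasDerivWithinAt (fun t => coordProj c (y t)) (coordProj c y') s t :=
    fun c _ _ hy => (coordProj c).hasFDerivAt.comp_hasDerivWithinAt t hy
  have h1 := HasDerivWithinAt.fun_sum (u := Finset.univ) fun (j : Fin d) _ =>
    ((hc (Sum.inl j) ha).fun_mul (hc (Sum.inr j) hb)).fun_sub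
      ((hc (Sum.inr j) ha).fun_mul (hc (Sum.inl j) hb))
  refine h1.congr_deriv ?_
  rw [symp, symp, ← Finset.sum_add_distrib]
  refine Finset.sum_congr rfl fun j _ => ?_
  simp only [coordProj, ContinuousLinearMap.comp_apply, ContinuousLinearMap.proj_apply,
    ContinuousLinearMap.coe_fst', ContinuousLinearMap.coe_snd']
  ring

/-- The time-one map of a uniformly bounded Hamiltonian is a canonical transformation. -/
theorem IsHamFlow.isCanonical {G : ι → Phase d → ℝ} (h : ∀ n, UnifBdd n G)
    (hp : ∀ i, IsPeriodic (G i)) {Φ : ι → ℝ → Phase d → Phase d}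
    (hΦ : ∀ i, IsHamFlow (G i) (Φ i)) (i : ι) : IsCanonical (Φ i 1) := by
  have h01 : (1 : ℝ) ∈ Icc (0 : ℝ) 1 := ⟨zero_le_one, le_rfl⟩
  have hreg := IsHamFlow.regularity h hΦ
  -- The inverse is the time `-1` map, which is the time-one map of `-G`; its smoothness follows
  -- from the same regularity statement.
  have hreg' := IsHamFlow.regularity (fun n => (h n).neg) fun i => (hΦ i).neg_time
  refine ⟨contDiff_of_unifMap hreg.1 (i, ⟨1, h01⟩), fun x k => ⟨k, (hΦ i).shift h (hp i) 1 x k⟩,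
    ⟨Φ i (-1), contDiff_of_unifMap hreg'.1 (i, ⟨1, h01⟩),
      fun x k => ⟨k, (hΦ i).shift h (hp i) (-1) x k⟩, fun x => ?_, fun x => ?_⟩, fun x u v => ?_⟩
  · rw [← (hΦ i).add_time h, neg_add_cancel, (hΦ i x).1]
  · rw [← (hΦ i).add_time h, add_neg_cancel, (hΦ i x).1]
  · have hd : ∀ w : Phase d, ∀ t ∈ Icc (0 : ℝ) 1,
        HasDerivWithinAt (fun s => fderiv ℝ (Φ i s) x w)
          (fderiv ℝ (hamVF (G i)) (Φ i t x) (fderiv ℝ (Φ i t) x w)) (Icc 0 1) t := fun w t ht =>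
      (ContinuousLinearMap.apply ℝ (Phase d) w).hasFDerivAt.comp_hasDerivWithinAt t
        (hreg.2 i x t ht)
    have hs : ∀ t ∈ Icc (0 : ℝ) 1, HasDerivWithinAt
        (fun s => symp (fderiv ℝ (Φ i s) x u) (fderiv ℝ (Φ i s) x v)) 0 (Icc 0 1) t :=
      fun t ht => (hasDerivWithinAt_symp (hd u t ht) (hd v t ht)).congr_deriv
        (symp_fderiv_hamVF (contDiff_of_unifBdd h i) _ _ _)
    have h1 := (convex_Icc (0 : ℝ) 1).norm_image_sub_le_of_norm_hasDerivWithin_le hs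
      (C := 0) (fun _ _ => by simp) ⟨le_rfl, zero_le_one⟩ h01
    rw [zero_mul, norm_le_zero_iff, sub_eq_zero] at h1
    have h2 : fderiv ℝ (Φ i 0) x = ContinuousLinearMap.id ℝ (Phase d) := by
      have : Φ i 0 = id := funext fun z => (hΦ i z).1
      rw [this, fderiv_id]
    rw [h1, h2]
    rfl

theorem IsCanonical.comp {S T : Phase d → Phase d} (hS : IsCanonical S) (hT : IsCanonical T) :
    IsCanonical (S ∘ T) := by
  have hdesc : ∀ {A B : Phase d → Phase d}, Descends A → Descends B → Descends (A ∘ B) := by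
    intro A B hA hB x k
    obtain ⟨l, hl⟩ := hB x k
    obtain ⟨l', hl'⟩ := hA (B x) l
    exact ⟨l', by simp only [Function.comp, hl, hl']⟩
  obtain ⟨S', h1, h2, h3, h4⟩ := hS.exists_inverse
  obtain ⟨T', k1, k2, k3, k4⟩ := hT.exists_inverse
  refine ⟨hS.smooth.comp hT.smooth, hdesc hS.descends hT.descends,
    ⟨T' ∘ S', k1.comp h1, hdesc k2 h2, h3.comp k3, h4.comp k4⟩, fun x u v => ?_⟩
  rw [fderiv_comp x (hS.smooth.differentiable (by simp) _) (hT.smooth.differentiable (by simp) x)]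
  simp only [ContinuousLinearMap.comp_apply, hS.symplectic, hT.symplectic]

theorem isCanonical_id : IsCanonical (id : Phase d → Phase d) :=
  ⟨contDiff_id, fun _ k => ⟨k, rfl⟩, ⟨id, contDiff_id, fun _ k => ⟨k, rfl⟩, fun _ => rfl,
    fun _ => rfl⟩, fun x u v => by simp⟩

theorem symp_scale (r : ℝ) (u v : Phase d) : symp (scale r u) (scale r v) = r * symp u v := by
  simp only [symp, scale_apply, Pi.smul_apply, smul_eq_mul, Finset.mul_sum]
  exact Finset.sum_congr rfl fun j _ => by ring

theorem scale_shift (r : ℝ) (x : Phase d) (k : Fin d → ℤ) :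
    scale r (x + shift k) = scale r x + shift k := by
  simp [shift]

/-- Conjugating a canonical transformation by a rescaling of the actions. -/
theorem IsCanonical.conj_scale {T : Phase d → Phase d} (hT : IsCanonical T) {r s : ℝ}
    (hrs : r * s = 1) : IsCanonical (fun x => scale r (T (scale s x))) := by
  have hdesc : ∀ {A : Phase d → Phase d}, Descends A →
      Descends (fun x => scale r (A (scale s x))) := by
    intro A hA x k
    obtain ⟨l, hl⟩ := hA (scale s x) k
    exact ⟨l, by beta_reduce; rw [scale_shift, hl, scale_shift]⟩
  have hsr : s * r = 1 := by rw [mul_comm]; exact hrs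
  obtain ⟨S, h1, h2, h3, h4⟩ := hT.exists_inverse
  refine ⟨(scale r).contDiff.comp (hT.smooth.comp (scale s).contDiff), hdesc hT.descends,
    ⟨fun x => scale r (S (scale s x)), (scale r).contDiff.comp (h1.comp (scale s).contDiff),
      hdesc h2, fun x => ?_, fun x => ?_⟩, fun x u v => ?_⟩
  · simp only [scale_scale hsr, h3 _, scale_scale hrs]
  · simp only [scale_scale hsr, h4 _, scale_scale hrs]
  · have hd : HasFDerivAt (fun x => scale r (T (scale s x)))
        ((scale r).comp ((fderiv ℝ T (scale s x)).comp (scale s))) x :=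
      (scale r).hasFDerivAt.comp x (((hT.smooth.differentiable (by simp)) _).hasFDerivAt.comp x
        (scale s).hasFDerivAt)
    rw [hd.fderiv]
    simp only [ContinuousLinearMap.comp_apply]
    rw [symp_scale, hT.symplectic, symp_scale, ← mul_assoc, hrs, one_mul]

/-- The rescaling multiplies the symplectic form by `r`, and the factor `r` on the Hamiltonian
compensates. With `r = ε^δ` it turns a rescaled generator of order `m - 2δ` into a symbol of order
`m - δ`. -/
theorem hamVF_conj_scale {G : Phase d → ℝ} (hG : Differentiable ℝ G) {r s : ℝ} (hrs : r * s = 1)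
    (y : Phase d) :
    hamVF (fun x => r * G (scale s x)) (scale r y) = scale r (hamVF G y) := by
  have hsr : s * r = 1 := by rw [mul_comm]; exact hrs
  refine Prod.ext ?_ ?_ <;> ext j
  · rw [hamVF_fst, coordDeriv_const_mul_comp_scale _ _ _ hG]
    simp only [scale_scale hsr]
    simp [hamVF_fst]
  · rw [hamVF_snd, coordDeriv_const_mul_comp_scale _ _ _ hG]
    simp only [scale_scale hsr]
    simp [hamVF_snd, hrs]

theorem IsHamFlow.conj_scale {G : Phase d → ℝ} (hG : Differentiable ℝ G)
    {Φ : ℝ → Phase d → Phase d} (hΦ : IsHamFlow G Φ) {r s : ℝ} (hrs : r * s = 1) :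
    IsHamFlow (fun x => r * G (scale s x)) (fun t x => scale r (Φ t (scale s x))) := by
  intro x
  refine ⟨by beta_reduce; rw [(hΦ _).1, scale_scale hrs], fun t => ?_⟩
  rw [hamVF_conj_scale hG hrs]
  exact (scale r).hasFDerivAt.comp_hasDerivAt t ((hΦ _).2 t)

end HamFlow

/-! ### Families of a given order in a small parameter -/

section Order

open Set

variable {ι κ : Type*} {E E' : Type} [NormedAddCommGroup E] [NormedSpace ℝ E]
  [NormedAddCommGroup E'] [NormedSpace ℝ E']
  {V W : Type} [NormedAddCommGroup V] [NormedSpace ℝ V] [NormedAddCommGroup W] [NormedSpace ℝ W]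
  {e : ι → ℝ} {m m' s : ℝ}

/-- `F i = O(e i ^ m)` with all its derivatives. -/
def HasOrder (e : ι → ℝ) (m : ℝ) (F : ι → E → V) : Prop :=
  ∀ n, UnifBdd n (fun i x => e i ^ (-m) • F i x)

theorem HasOrder.add {F G : ι → E → V} (hF : HasOrder e m F) (hG : HasOrder e m G) :
    HasOrder e m (fun i x => F i x + G i x) := fun n => by
  simpa only [smul_add] using (hF n).add (hG n)

theorem HasOrder.sub {F G : ι → E → V} (hF : HasOrder e m F) (hG : HasOrder e m G) :
    HasOrder e m (fun i x => F i x - G i x) := fun n => by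
  simpa only [smul_sub] using (hF n).sub (hG n)

theorem HasOrder.clm {F : ι → E → V} (hF : HasOrder e m F) (L : V →L[ℝ] W) :
    HasOrder e m (fun i x => L (F i x)) := fun n => by
  simpa only [map_smul] using (hF n).clm L

/-- The surplus power of the parameter is bounded by the same power of `b`; no bound by `1` is
needed. -/
theorem HasOrder.mono {b : ℝ} (he : ∀ i, 0 < e i) (hb : ∀ i, e i ≤ b) (hm : m' ≤ m)
    {F : ι → E → V} (hF : HasOrder e m F) : HasOrder e m' F := fun n => by
  convert (hF n).const_smul (c := fun i => e i ^ (m - m')) (C := b ^ (m - m')) (fun i => ?_)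
    using 3 with i x
  · rw [smul_smul, ← Real.rpow_add (he i)]
    congr 2
    ring
  · rw [abs_of_pos (Real.rpow_pos_of_pos (he i) _)]
    exact Real.rpow_le_rpow (he i).le (hb i) (by linarith)

theorem HasOrder.unifBdd {b : ℝ} (he : ∀ i, 0 < e i) (hb : ∀ i, e i ≤ b) (hm : 0 ≤ m)
    {F : ι → E → V} (hF : HasOrder e m F) (n : ℕ) : UnifBdd n F := by
  simpa using hF.mono he hb hm n

theorem HasOrder.rpow_smul (he : ∀ i, 0 < e i) {F : ι → E → V} (hF : HasOrder e m F) (s : ℝ) :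
    HasOrder e (m + s) (fun i x => e i ^ s • F i x) := fun n => by
  convert hF n using 3 with i x
  rw [smul_smul, ← Real.rpow_add (he i)]
  congr 2
  ring

theorem HasOrder.contDiff (he : ∀ i, 0 < e i) {F : ι → E → V} (hF : HasOrder e m F) (i : ι) :
    ContDiff ℝ ∞ (F i) := by
  convert (contDiff_of_unifBdd hF i).const_smul (e i ^ m) using 1
  ext x
  rw [smul_smul, ← Real.rpow_add (he i), add_neg_cancel, Real.rpow_zero, one_smul]

theorem HasOrder.exists_bound (he : ∀ i, 0 < e i) {F : ι → E → V} (hF : HasOrder e m F) :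
    ∃ C, 0 ≤ C ∧ ∀ i x, ‖F i x‖ ≤ C * e i ^ m := by
  obtain ⟨C, hC0, hC⟩ := (hF 0).bounded
  refine ⟨C, hC0, fun i x => ?_⟩
  have h1 := hC i x
  have h2 := Real.rpow_pos_of_pos (he i) m
  rwa [norm_smul, Real.rpow_neg (he i).le, norm_inv, Real.norm_eq_abs, abs_of_pos h2,
    inv_mul_le_iff₀ h2, mul_comm] at h1

theorem HasOrder.fderiv (he : ∀ i, 0 < e i) {F : ι → E → V} (hF : HasOrder e m F) :
    HasOrder e m (fun i => fderiv ℝ (F i)) := fun n => by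
  convert fderiv_unifBdd hF n using 3 with i x
  exact (fderiv_fun_const_smul ((hF.contDiff he i).differentiable (by simp) x) _).symm

theorem HasOrder.bilin (he : ∀ i, 0 < e i) {U : Type} [NormedAddCommGroup U] [NormedSpace ℝ U]
    (B : V →L[ℝ] W →L[ℝ] U) {F : ι → E → V} {G : ι → E → W} (hF : HasOrder e m F)
    (hG : HasOrder e m' G) : HasOrder e (m + m') (fun i x => B (F i x) (G i x)) := fun n => by
  convert UnifBdd.bilin B (hF n) (hG n) using 3 with i x
  simp only [map_smul, smul_apply, smul_smul]
  rw [← Real.rpow_add (he i)]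
  congr 2
  ring

theorem HasOrder.comp {F : ι → E' → V} (hF : HasOrder e m F) (r : κ → ι) {φ : κ → E → E'}
    (hφ : ∀ n, UnifMap n φ) : HasOrder (fun k => e (r k)) m (fun k x => F (r k) (φ k x)) :=
  fun n => ((hF n).reindex r).comp (hφ n)

theorem HasOrder.reindex {F : ι → E → V} (hF : HasOrder e m F) (r : κ → ι) :
    HasOrder (fun k => e (r k)) m (fun k => F (r k)) := fun n => (hF n).reindex r

theorem HasOrder.of_hasDerivWithinAt [FiniteDimensional ℝ E] [CompleteSpace V]
    {b w : ι → ℝ → E → V}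
    (hb : HasOrder (fun a : ι × Icc (0 : ℝ) 1 => e a.1) m (fun a x => b a.1 a.2 x))
    (hbc : ∀ i x, ContinuousOn (fun t => b i t x) (Icc 0 1)) (hw0 : ∀ i x, w i 0 x = 0)
    (hw : ∀ i x, ∀ t ∈ Icc (0 : ℝ) 1,
      HasDerivWithinAt (fun s => w i s x) (b i t x) (Icc 0 1) t) :
    HasOrder (fun a : ι × Icc (0 : ℝ) 1 => e a.1) m (fun a x => w a.1 a.2 x) := fun n =>
  unifBdd_of_hasDerivWithinAt (b := fun i t x => e i ^ (-m) • b i t x)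
    (w := fun i t x => e i ^ (-m) • w i t x) (hb n) (fun i x => (hbc i x).const_smul _)
    (fun i x => by rw [hw0, smul_zero]) fun i x t ht => (hw i x t ht).const_smul _

variable {d : ℕ}

theorem HasOrder.hamVF (he : ∀ i, 0 < e i) {G : ι → Phase d → ℝ} (hG : HasOrder e m G) :
    HasOrder e m (fun i => hamVF (G i)) :=
  (hG.fderiv he).clm symplGrad

theorem HasOrder.poisson (he : ∀ i, 0 < e i) {F G : ι → Phase d → ℝ} (hF : HasOrder e m F)
    (hG : HasOrder e m' G) : HasOrder e (m + m') (fun i => poisson (F i) (G i)) :=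
  HasOrder.bilin he (ContinuousLinearMap.id ℝ (Phase d →L[ℝ] ℝ)) (hF.fderiv he) (hG.hamVF he)

theorem cosMode_const_mul (k : Fin d → ℤ) (c : ℝ) (F : Phase d → ℝ) (y : Phase d) :
    cosMode k (fun x => c * F x) y = c * cosMode k F y := by
  simp only [cosMode, modeAvg, smul_eq_mul, mul_left_comm _ c]
  exact boxAvg_smul c _

theorem sinMode_const_mul (k : Fin d → ℤ) (c : ℝ) (F : Phase d → ℝ) (y : Phase d) :
    sinMode k (fun x => c * F x) y = c * sinMode k F y := by
  simp only [sinMode, modeAvg, smul_eq_mul, mul_left_comm _ c]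
  exact boxAvg_smul c _

theorem isPeriodic_const_mul (c : ℝ) {F : Phase d → ℝ} (hF : IsPeriodic F) :
    IsPeriodic (fun x => c * F x) := fun k x => by simp only [hF k x]

theorem HasOrder.resPart {F : ι → Phase d → ℝ} (hF : HasOrder e m F)
    (hp : ∀ i, IsPeriodic (F i)) (K : ι → ℕ) : HasOrder e m (fun i => resPart (K i) (F i)) :=
  fun n => by
    convert unifBdd_resPart hF (fun i => isPeriodic_const_mul _ (hp i)) K n using 3 with i x
    simp only [NormalFormLemma.resPart, smul_eq_mul, cosMode_const_mul, Finset.mul_sum]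
    exact Finset.sum_congr rfl fun k _ => by ring

theorem HasOrder.homSol {F : ι → Phase d → ℝ} (hF : HasOrder e m F)
    (hp : ∀ i, IsPeriodic (F i)) (K : ι → ℕ) : HasOrder e m (fun i => homSol (K i) (F i)) :=
  fun n => by
    convert unifBdd_homSol hF (fun i => isPeriodic_const_mul _ (hp i)) K n using 3 with i x
    simp only [NormalFormLemma.homSol, smul_eq_mul, sinMode_const_mul, Finset.mul_sum]
    exact Finset.sum_congr rfl fun k _ => by ring

/-- The Fourier tail gains any power of the parameter that the cutoff controls. -/
theorem HasOrder.fourierTail (he : ∀ i, 0 < e i) {F : ι → Phase d → ℝ} (hF : HasOrder e m F)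
    (hp : ∀ i, IsPeriodic (F i)) {K : ι → ℕ} {M : ℕ} {C : ℝ} (hK0 : ∀ i, 0 < K i)
    (hK : ∀ i, e i ^ (-s) ≤ C * (K i : ℝ) ^ M) :
    HasOrder e (m + s) (fun i => fourierTail (K i) (F i)) := fun n => by
  have h := unifBdd_fourierTail hF (fun i => isPeriodic_const_mul _ (hp i)) K M n
  convert h.const_smul (c := fun i => e i ^ (-s) / (K i : ℝ) ^ M) (C := C) (fun i => ?_)
    using 3 with i x
  · have hK1 : (0 : ℝ) < K i := by exact_mod_cast hK0 i
    simp only [NormalFormLemma.fourierTail, smul_eq_mul, cosMode_const_mul, ← Finset.mul_sum,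
      ← mul_sub]
    rw [neg_add, Real.rpow_add (he i)]
    field_simp
  · have hK1 : (0 : ℝ) < K i := by exact_mod_cast hK0 i
    rw [abs_of_nonneg (by have := Real.rpow_pos_of_pos (he i) (-s); positivity),
      div_le_iff₀ (by positivity)]
    exact hK i

theorem hasFDerivAt_freeHam (x : Phase d) :
    HasFDerivAt freeHam (∑ j, x.1 j • coordProj (Sum.inl j)) x := by
  have h1 : ∀ j ∈ (Finset.univ : Finset (Fin d)), HasFDerivAt (fun x : Phase d => x.1 j ^ 2 / 2)
      (x.1 j • coordProj (Sum.inl j)) x := fun j _ => by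
    have h2 : HasDerivAt (fun t : ℝ => t ^ 2 / 2) (x.1 j) (coordProj (Sum.inl j) x) := by
      refine ((hasDerivAt_pow 2 (coordProj (Sum.inl j) x)).div_const 2).congr_deriv ?_
      simp only [coordProj, ContinuousLinearMap.comp_apply, ContinuousLinearMap.proj_apply,
        ContinuousLinearMap.coe_fst']
      norm_num
    exact h2.comp_hasFDerivAt x (coordProj (Sum.inl j)).hasFDerivAt
  exact HasFDerivAt.fun_sum h1

theorem poisson_freeHam (g : Phase d → ℝ) (x : Phase d) :
    poisson freeHam g x = -∑ j, x.1 j * coordDeriv (Sum.inr j) g x := by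
  rw [poisson, (hasFDerivAt_freeHam x).fderiv, sum_apply, ← Finset.sum_neg_distrib]
  refine Finset.sum_congr rfl fun j _ => ?_
  simp [coordProj, hamVF_fst]

theorem continuous_poisson {f g : Phase d → ℝ} (hf : ContDiff ℝ ∞ f) (hg : ContDiff ℝ ∞ g) :
    Continuous (poisson f g) :=
  (hf.continuous_fderiv (by simp)).clm_apply
    (symplGrad.continuous.comp (hg.continuous_fderiv (by simp)))

theorem coordDeriv_const_mul (a : Fin d ⊕ Fin d) (c : ℝ) {f : Phase d → ℝ}
    (hf : Differentiable ℝ f) (x : Phase d) :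
    coordDeriv a (fun x => c * f x) x = c * coordDeriv a f x := by
  rw [coordDeriv, fderiv_const_mul (hf x)]
  rfl

/-- One step of the normalization, in rescaled variables. -/
theorem exists_rescaled_step {b δ : ℝ} (he : ∀ i, 0 < e i) (hb : ∀ i, e i ≤ b) (hδ : 2 * δ ≤ 1)
    (hm : 1 ≤ m) {K : ι → ℕ} {M : ℕ} {C : ℝ} (hK0 : ∀ i, 0 < K i)
    (hK : ∀ i, e i ^ (-(1 - 2 * δ)) ≤ C * (K i : ℝ) ^ M) {W F : ι → Phase d → ℝ}
    (hW : HasOrder e 1 W) (hWp : ∀ i, IsPeriodic (W i)) (hF : HasOrder e m F)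
    (hFp : ∀ i, IsPeriodic (F i)) {Ψ : ι → ℝ → Phase d → Phase d}
    (hΨ : ∀ i, IsHamFlow (fun y => e i ^ (-(2 * δ)) * homSol (K i) (F i) y) (Ψ i)) :
    ∃ F' : ι → Phase d → ℝ, HasOrder e (m + (1 - 2 * δ)) F' ∧ (∀ i, IsPeriodic (F' i)) ∧
      ∀ i y, e i ^ (2 * δ) * freeHam (Ψ i 1 y) + W i (Ψ i 1 y) + F i (Ψ i 1 y) =
        e i ^ (2 * δ) * freeHam y + W i y + resPart (K i) (F i) y + F' i y := by
  have hm0 : 0 ≤ m := by linarith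
  have hFb := hF.unifBdd he hb hm0
  set Γ : ι → Phase d → ℝ := fun i y => e i ^ (-(2 * δ)) * homSol (K i) (F i) y with hΓdef
  have hΓ : HasOrder e (m + -(2 * δ)) Γ := (hF.homSol hFp K).rpow_smul he (-(2 * δ))
  have hΓb := hΓ.unifBdd he hb (by linarith)
  have hΓp : ∀ i, IsPeriodic (Γ i) := fun i =>
    isPeriodic_const_mul _ (isPeriodic_homSol (K i) (hFp i))
  have hreg := (IsHamFlow.regularity hΓb hΨ).1
  have hT : HasOrder e (m + (1 - 2 * δ)) (fun i => fourierTail (K i) (F i)) :=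
    hF.fourierTail he hFp hK0 hK
  have hTm := hT.mono he hb (m' := m) (by linarith)
  -- By the homological equation `B` is the rate of change of `ε^{2δ} H₀` along the flow. It
  -- replaces every estimate on the unbounded free Hamiltonian.
  set B : ι → Phase d → ℝ := fun i y =>
    resPart (K i) (F i) y + fourierTail (K i) (F i) y - F i y with hBdef
  have hB : HasOrder e m B := ((hF.resPart hFp K).add hTm).sub hF
  have hWF : HasOrder e 1 (fun i y => W i y + F i y) := hW.add (hF.mono he hb hm)
  have hS : HasOrder e (m + (1 - 2 * δ)) (fun i => poisson (fun y => W i y + F i y) (Γ i)) := by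
    have := hWF.poisson he hΓ
    rwa [show 1 + (m + -(2 * δ)) = m + (1 - 2 * δ) by ring] at this
  -- The order obtained is `m + (m - 2δ)`, and `m ≥ 1` makes it at least `m + (1 - 2δ)`.
  have hQ : HasOrder e (m + (1 - 2 * δ)) (fun i => poisson (B i) (Γ i)) :=
    (hB.poisson he hΓ).mono he hb (by linarith)
  have hcont : ∀ {f : Phase d → ℝ}, Continuous f → ∀ i y, Continuous fun t => f (Ψ i t y) :=
    fun hf i y => hf.comp (continuous_iff_continuousAt.2 fun t => ((hΨ i y).2 t).continuousAt)
  have hD : HasOrder (fun a : ι × Icc (0 : ℝ) 1 => e a.1) (m + (1 - 2 * δ))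
      (fun a y => B a.1 (Ψ a.1 a.2 y) - B a.1 y) :=
    HasOrder.of_hasDerivWithinAt (b := fun i t y => poisson (B i) (Γ i) (Ψ i t y))
      (w := fun i t y => B i (Ψ i t y) - B i y) (hQ.comp Prod.fst hreg)
      (fun i y => (hcont (continuous_poisson (hB.contDiff he i) (hΓ.contDiff he i)) i
        y).continuousOn)
      (fun i y => by rw [(hΨ i y).1, sub_self])
      fun i y t _ => (((hΨ i).hasDerivAt_comp ((hB.contDiff he i).differentiable (by simp)) y
        t).sub_const _).hasDerivWithinAt
  have hom : ∀ i y, e i ^ (2 * δ) * poisson freeHam (Γ i) y = B i y := fun i y => by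
    rw [poisson_freeHam]
    have h1 : ∀ j, coordDeriv (Sum.inr j) (Γ i) y =
        e i ^ (-(2 * δ)) * coordDeriv (Sum.inr j) (homSol (K i) (F i)) y := fun j =>
      coordDeriv_const_mul _ _ (((hF.homSol hFp K).contDiff he i).differentiable (by simp)) y
    have h2 : e i ^ (2 * δ) * e i ^ (-(2 * δ)) = 1 := by
      rw [← Real.rpow_add (he i), add_neg_cancel, Real.rpow_zero]
    simp only [h1, mul_left_comm _ (e i ^ (-(2 * δ)))]
    rw [← Finset.mul_sum, sum_mul_coordDeriv_homSol hFb (hFp i), hBdef]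
    linear_combination
      (resPart (K i) (F i) y + NormalFormLemma.fourierTail (K i) (F i) y - F i y) * h2
  -- Subtracting `t B` from the energy increment leaves a function vanishing at `t = 0` whose
  -- derivative is `(B ∘ Ψ_t - B) + {W + F, Γ} ∘ Ψ_t`, both terms being of the improved order.
  have hE := HasOrder.of_hasDerivWithinAt (e := e) (m := m + (1 - 2 * δ))
    (b := fun i t y => (B i (Ψ i t y) - B i y) +
      poisson (fun y => W i y + F i y) (Γ i) (Ψ i t y))
    (w := fun i t y => e i ^ (2 * δ) * freeHam (Ψ i t y) + (W i (Ψ i t y) + F i (Ψ i t y)) -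
      (e i ^ (2 * δ) * freeHam y + (W i y + F i y)) - t * B i y)
    (hD.add (hS.comp Prod.fst hreg))
    (fun i y => (((hcont (hB.contDiff he i).continuous i y).sub continuous_const).add
      (hcont (continuous_poisson (hWF.contDiff he i) (hΓ.contDiff he i)) i y)).continuousOn)
    (fun i y => by rw [(hΨ i y).1]; ring)
    (fun i y t _ => by
      have h1 := (hΨ i).hasDerivAt_comp (f := freeHam)
        (fun x => (hasFDerivAt_freeHam x).differentiableAt) y t
      have h2 := (hΨ i).hasDerivAt_comp (f := fun y => W i y + F i y)
        ((hWF.contDiff he i).differentiable (by simp)) y t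
      have h3 := (((h1.const_mul (e i ^ (2 * δ))).fun_add h2).sub_const
        (e i ^ (2 * δ) * freeHam y + (W i y + F i y))).fun_sub
        ((hasDerivAt_id t).mul_const (B i y))
      refine (h3.congr_deriv ?_).hasDerivWithinAt
      rw [hom]
      ring)
  have hE1 := hE.reindex (fun i : ι => (i, (⟨1, zero_le_one, le_rfl⟩ : Icc (0 : ℝ) 1)))
  -- At time one `F + B` is the resonant part plus the tail, so the new remainder is the integrated
  -- error plus the tail.
  refine ⟨_, hE1.add hT, fun i k y => ?_, fun i y => ?_⟩
  · have hk : ∀ x : Phase d, freeHam (x + shift k) = freeHam x := fun x => by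
      simp [freeHam, shift]
    simp only [hBdef, (hΨ i).shift hΓb (hΓp i), hk, hWp i k, hFp i k,
      isPeriodic_resPart (K i) (hFp i) k y, isPeriodic_fourierTail (K i) (hFp i) k y]
  · simp only [hBdef]
    ring

/-- The time-one map of a Hamiltonian of order `s` moves a family of order `m` by `m + s`. -/
theorem IsHamFlow.norm_comp_sub_le (he : ∀ i, 0 < e i) {f Γ : ι → Phase d → ℝ}
    (hf : HasOrder e m f) (hΓ : HasOrder e s Γ) {Ψ : ι → ℝ → Phase d → Phase d}
    (hΨ : ∀ i, IsHamFlow (Γ i) (Ψ i)) :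
    ∃ C, 0 ≤ C ∧ ∀ i y, |f i (Ψ i 1 y) - f i y| ≤ C * e i ^ (m + s) := by
  obtain ⟨C, hC0, hC⟩ := (hf.poisson he hΓ).exists_bound he
  refine ⟨C, hC0, fun i y => ?_⟩
  have := norm_image_sub_le_of_norm_deriv_le_segment_01' (f := fun t => f i (Ψ i t y))
    (fun t _ => ((hΨ i).hasDerivAt_comp ((hf.contDiff he i).differentiable (by simp)) y
      t).hasDerivWithinAt) (fun t _ => hC i _)
  simpa [(hΨ i y).1] using this

theorem IsHamFlow.norm_sub_le (he : ∀ i, 0 < e i) {Γ : ι → Phase d → ℝ} (hΓ : HasOrder e s Γ)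
    {Ψ : ι → ℝ → Phase d → Phase d} (hΨ : ∀ i, IsHamFlow (Γ i) (Ψ i)) :
    ∃ C, 0 ≤ C ∧ ∀ i y, ‖Ψ i 1 y - y‖ ≤ C * e i ^ s := by
  obtain ⟨C, hC0, hC⟩ := (hΓ.hamVF he).exists_bound he
  refine ⟨C, hC0, fun i y => ?_⟩
  have := norm_image_sub_le_of_norm_deriv_le_segment_01' (f := fun t => Ψ i t y)
    (fun t _ => ((hΨ i y).2 t).hasDerivWithinAt) (fun t _ => hC i _)
  simpa [(hΨ i y).1] using this

end Order

/-! ### The normal form -/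

section NormalForm

open Set

variable {d : ℕ} {ε₀ δ m m' : ℝ}

theorem IsSymbol.hasOrder {f : ℝ → Phase d → ℝ} (h : IsSymbol ε₀ δ m f) :
    HasOrder (fun ε : Ioo 0 ε₀ => (ε : ℝ)) m (fun ε y => f ε (scale ((ε : ℝ) ^ δ) y)) :=
  (isSymbol_iff_isScaledSymbol.1 h).bound

theorem isSymbol_iff_hasOrder {f : ℝ → Phase d → ℝ} :
    IsSymbol ε₀ δ m f ↔ (∀ ε ∈ Ioo 0 ε₀, IsPeriodic (f ε)) ∧
      HasOrder (fun ε : Ioo 0 ε₀ => (ε : ℝ)) m (fun ε y => f ε (scale ((ε : ℝ) ^ δ) y)) :=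
  ⟨fun h => ⟨h.periodic, h.hasOrder⟩, fun h => isSymbol_iff_isScaledSymbol.2
    ⟨fun ε hε => isPeriodic_comp_scale (h.1 ε hε), h.2⟩⟩

theorem rpow_mul_rpow_neg {ε : ℝ} (hε : 0 < ε) (s : ℝ) : ε ^ s * ε ^ (-s) = 1 := by
  rw [← Real.rpow_add hε, add_neg_cancel, Real.rpow_zero]

theorem isSymbol_comp_scale {G : ℝ → Phase d → ℝ} (hp : ∀ ε ∈ Ioo 0 ε₀, IsPeriodic (G ε))
    (h : HasOrder (fun ε : Ioo 0 ε₀ => (ε : ℝ)) m (fun ε => G ε)) :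
    IsSymbol ε₀ δ m (fun ε x => G ε (scale (ε ^ (-δ)) x)) := by
  refine isSymbol_iff_hasOrder.2 ⟨fun ε hε => isPeriodic_comp_scale (hp ε hε), ?_⟩
  convert h using 3 with ε y
  exact congrArg _ (scale_scale (by rw [mul_comm]; exact rpow_mul_rpow_neg ε.2.1 δ) y)

theorem IsSymbol.mono {f : ℝ → Phase d → ℝ} (h : IsSymbol ε₀ δ m f) (hm : m' ≤ m) :
    IsSymbol ε₀ δ m' f :=
  isSymbol_iff_hasOrder.2 ⟨h.periodic, h.hasOrder.mono (fun ε => ε.2.1) (fun ε => ε.2.2.le) hm⟩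

theorem isSymbol_sum {κ : Type*} {s : Finset κ} {f : κ → ℝ → Phase d → ℝ}
    (h : ∀ k ∈ s, IsSymbol ε₀ δ m (f k)) : IsSymbol ε₀ δ m (fun ε x => ∑ k ∈ s, f k ε x) := by
  refine isSymbol_iff_hasOrder.2 ⟨fun ε hε l x => Finset.sum_congr rfl fun k hk =>
    (h k hk).periodic ε hε l x, fun n => ?_⟩
  simpa only [Finset.smul_sum] using UnifBdd.sum s fun k hk => (h k hk).hasOrder n

theorem rpow_neg_le_cutoff {β ε : ℝ} (hε : 0 < ε) : ε ^ (-β) ≤ cutoff β ε := by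
  rw [Real.rpow_neg hε.le, ← one_div, cutoff]
  push_cast
  exact (Nat.lt_floor_add_one _).le

/-- Since `K(ε) ≥ ε^{-β}`, any `M ≥ a / β` works; the leftover exponent `Mβ - a` is nonnegative, so
`ε₀` bounds that factor. -/
theorem exists_rpow_neg_le_cutoff_pow {β : ℝ} (hβ : 0 < β) (a : ℝ) :
    ∃ (M : ℕ) (C : ℝ), ∀ ε : Ioo 0 ε₀, (ε : ℝ) ^ (-a) ≤ C * (cutoff β ε : ℝ) ^ M := by
  obtain ⟨M, hM⟩ := exists_nat_ge (a / β)
  rw [div_le_iff₀ hβ] at hM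
  refine ⟨M, ε₀ ^ (M * β - a), fun ε => ?_⟩
  have h1 : (ε : ℝ) ^ (-a) = (ε : ℝ) ^ (M * β - a) * ((ε : ℝ) ^ (-β)) ^ M := by
    rw [← Real.rpow_natCast, ← Real.rpow_mul ε.2.1.le, ← Real.rpow_add ε.2.1]
    congr 1
    ring
  have hε := ε.2.1
  rw [h1]
  gcongr
  · exact Real.rpow_nonneg (ε.2.1.trans ε.2.2).le _
  · exact ε.2.2.le
  · exact rpow_neg_le_cutoff ε.2.1

/-- A family of canonical transformations that moves symbols by one power of `ε^{1-2δ}` and the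
actions by `ε^{1-δ}`. -/
structure IsNearIdentity (ε₀ δ : ℝ) (T : ℝ → Phase d → Phase d) : Prop where
  canonical : ∀ ε ∈ Ioo 0 ε₀, IsCanonical (T ε)
  symbol : ∀ (m : ℝ) (f : ℝ → Phase d → ℝ), IsSymbol ε₀ δ m f →
    ∃ C > 0, ∀ ε ∈ Ioo 0 ε₀, ∀ x : Phase d,
      |f ε (T ε x) - f ε x| ≤ C * ε ^ (m + 1 - 2 * δ)
  action : ∀ j : Fin d, ∃ C > 0, ∀ ε ∈ Ioo 0 ε₀, ∀ x : Phase d,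
    |(T ε x).1 j - x.1 j| ≤ C * ε ^ (1 - δ)

theorem isNearIdentity_id : IsNearIdentity ε₀ δ (fun _ : ℝ => (id : Phase d → Phase d)) := by
  refine ⟨fun _ _ => isCanonical_id, fun m f _ => ⟨1, one_pos, fun ε hε x => ?_⟩,
    fun j => ⟨1, one_pos, fun ε hε x => ?_⟩⟩ <;>
  · have := fun s => Real.rpow_nonneg hε.1.le s
    simpa using this _

theorem IsNearIdentity.comp {S T : ℝ → Phase d → Phase d} (hS : IsNearIdentity ε₀ δ S)
    (hT : IsNearIdentity ε₀ δ T) : IsNearIdentity ε₀ δ (fun ε => S ε ∘ T ε) := by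
  refine ⟨fun ε hε => (hS.canonical ε hε).comp (hT.canonical ε hε), fun m f hf => ?_, fun j => ?_⟩
  · obtain ⟨C, hC, h1⟩ := hS.symbol m f hf
    obtain ⟨C', hC', h2⟩ := hT.symbol m f hf
    refine ⟨C + C', by positivity, fun ε hε x => ?_⟩
    rw [add_mul]
    exact (abs_sub_le _ (f ε (T ε x)) _).trans (add_le_add (h1 ε hε _) (h2 ε hε x))
  · obtain ⟨C, hC, h1⟩ := hS.action j
    obtain ⟨C', hC', h2⟩ := hT.action j
    refine ⟨C + C', by positivity, fun ε hε x => ?_⟩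
    rw [add_mul]
    exact (abs_sub_le _ ((T ε x).1 j) _).trans (add_le_add (h1 ε hε _) (h2 ε hε x))

theorem freeHam_scale (r : ℝ) (y : Phase d) : freeHam (scale r y) = r ^ 2 * freeHam y := by
  simp only [freeHam, scale_apply, Pi.smul_apply, smul_eq_mul, Finset.mul_sum]
  exact Finset.sum_congr rfl fun j _ => by ring

/-- One step of the normalization: a remainder `R` of order `m` is replaced by a term in normal
form and a remainder of order `m + (1 - 2δ)`. -/
theorem exists_step {β : ℝ} (hδ : 0 < δ) (hδ' : δ < 1 / 2) (hβ : 0 < β) (hm : 1 ≤ m)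
    {W R : ℝ → Phase d → ℝ} (hW : IsSymbol ε₀ δ 1 W) (hR : IsSymbol ε₀ δ m R) :
    ∃ (g : ℝ → Phase d → ℝ) (L : ℝ → Phase d → Phase d) (Z R' : ℝ → Phase d → ℝ),
      IsSymbol ε₀ δ (m - δ) g ∧ (∀ ε ∈ Ioo 0 ε₀, IsLieTransform (g ε) (L ε)) ∧
      IsNearIdentity ε₀ δ L ∧ IsSymbol ε₀ δ m Z ∧ IsNormalForm ε₀ δ β Z ∧
      IsSymbol ε₀ δ (m + (1 - 2 * δ)) R' ∧
      ∀ ε ∈ Ioo 0 ε₀, ∀ x, freeHam (L ε x) + W ε (L ε x) + R ε (L ε x) =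
        freeHam x + W ε x + Z ε x + R' ε x := by
  set e : Ioo 0 ε₀ → ℝ := fun ε => ε with he_def
  have he : ∀ ε, 0 < e ε := fun ε => ε.2.1
  have hb : ∀ ε, e ε ≤ ε₀ := fun ε => ε.2.2.le
  obtain ⟨M, C, hK⟩ := exists_rpow_neg_le_cutoff_pow (ε₀ := ε₀) hβ (1 - 2 * δ)
  set F : ℝ → Phase d → ℝ := fun ε y => R ε (scale (ε ^ δ) y) with hF_def
  have hF : HasOrder e m (fun ε => F ε) := hR.hasOrder
  have hFp : ∀ ε ∈ Ioo 0 ε₀, IsPeriodic (F ε) := fun ε hε =>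
    isPeriodic_comp_scale (hR.periodic ε hε)
  set Γ : ℝ → Phase d → ℝ := fun ε y => ε ^ (-(2 * δ)) * homSol (cutoff β ε) (F ε) y with hΓ_def
  have hΓ : HasOrder e (m + -(2 * δ)) (fun ε => Γ ε) :=
    (hF.homSol (fun ε => hFp ε ε.2) (fun ε => cutoff β ε)).rpow_smul he (-(2 * δ))
  have hΓb := hΓ.unifBdd he hb (by linarith)
  -- The deformation estimates use only this weaker order, common to all steps because `m ≥ 1`.
  have hΓ1 : HasOrder e (1 - 2 * δ) (fun ε => Γ ε) := hΓ.mono he hb (by linarith)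
  have hΓp : ∀ ε ∈ Ioo 0 ε₀, IsPeriodic (Γ ε) := fun ε hε =>
    isPeriodic_const_mul _ (isPeriodic_homSol _ (hFp ε hε))
  have hflow : ∀ ε, ∃ Ψ, ε ∈ Ioo 0 ε₀ → IsHamFlow (Γ ε) Ψ := fun ε => by
    by_cases hε : ε ∈ Ioo 0 ε₀
    · obtain ⟨Ψ, hΨ⟩ := exists_isHamFlow hΓb ⟨ε, hε⟩
      exact ⟨Ψ, fun _ => hΨ⟩
    · exact ⟨fun _ => id, fun h => absurd h hε⟩
  choose Ψ hΨ using hflow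
  have hΨ' : ∀ ε : Ioo 0 ε₀, IsHamFlow (Γ ε) (Ψ ε) := fun ε => hΨ ε ε.2
  obtain ⟨F', hF', hF'p, hF'eq⟩ := exists_rescaled_step he hb (by linarith) hm
    (K := fun ε => cutoff β ε) (fun ε => Nat.succ_pos _) hK hW.hasOrder
    (fun ε => isPeriodic_comp_scale (hW.periodic ε ε.2)) hF (fun ε => hFp ε ε.2) hΨ'
  -- The remainder is produced only for parameters in `(0, ε₀)`; its extension by zero is never
  -- evaluated elsewhere in the estimates.
  have hext : ∀ ε : Ioo 0 ε₀, Function.extend Subtype.val F' 0 (ε : ℝ) = F' ε := fun ε =>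
    Subtype.val_injective.extend_apply F' 0 ε
  have hinv : ∀ ε ∈ Ioo 0 ε₀, ∀ x : Phase d, scale (ε ^ δ) (scale (ε ^ (-δ)) x) = x :=
    fun ε hε x => scale_scale (rpow_mul_rpow_neg hε.1 δ) x
  refine ⟨fun ε x => ε ^ δ * Γ ε (scale (ε ^ (-δ)) x),
    fun ε x => scale (ε ^ δ) (Ψ ε 1 (scale (ε ^ (-δ)) x)),
    fun ε x => resPart (cutoff β ε) (F ε) (scale (ε ^ (-δ)) x),
    fun ε x => Function.extend Subtype.val F' 0 ε (scale (ε ^ (-δ)) x), ?_, fun ε hε => ?_,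
    ⟨fun ε hε => ?_, fun m' f hf => ?_, fun j => ?_⟩, ?_, ?_, ?_, fun ε hε x => ?_⟩
  · refine isSymbol_comp_scale (G := fun ε y => ε ^ δ * Γ ε y)
      (fun ε hε => isPeriodic_const_mul _ (hΓp ε hε)) ?_
    have := hΓ.rpow_smul he δ
    rwa [show m + -(2 * δ) + δ = m - δ by ring] at this
  · exact ⟨_, (hΨ ε hε).conj_scale ((hΓ.contDiff he ⟨ε, hε⟩).differentiable (by simp))
      (rpow_mul_rpow_neg hε.1 δ), rfl⟩
  · exact (IsHamFlow.isCanonical hΓb (fun ε => hΓp ε ε.2) hΨ' ⟨ε, hε⟩).conj_scale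
      (rpow_mul_rpow_neg hε.1 δ)
  · obtain ⟨C, hC0, hC⟩ := IsHamFlow.norm_comp_sub_le he hf.hasOrder hΓ1 hΨ'
    refine ⟨C + 1, by positivity, fun ε hε x => ?_⟩
    have h1 := hC ⟨ε, hε⟩ (scale (ε ^ (-δ)) x)
    simp only [hinv ε hε, he_def] at h1
    rw [show m' + 1 - 2 * δ = m' + (1 - 2 * δ) by ring]
    refine h1.trans ?_
    have := Real.rpow_nonneg hε.1.le (m' + (1 - 2 * δ))
    gcongr
    linarith
  · obtain ⟨C, hC0, hC⟩ := IsHamFlow.norm_sub_le he hΓ1 hΨ'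
    refine ⟨C + 1, by positivity, fun ε hε x => ?_⟩
    set y := scale (ε ^ (-δ)) x with hy
    have h1 := (norm_le_pi_norm _ j).trans ((norm_fst_le _).trans (hC ⟨ε, hε⟩ y))
    -- An action displacement is `ε^δ` times the rescaled one, so `ε^{1-2δ}` becomes `ε^{1-δ}`.
    have h2 : (scale (ε ^ δ) (Ψ ε 1 y)).1 j - x.1 j = ε ^ δ * ((Ψ ε 1 y).1 j - y.1 j) := by
      conv_lhs => rw [← hinv ε hε x]
      simp only [scale_apply, Pi.smul_apply, smul_eq_mul, ← hy]
      ring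
    have hpos := Real.rpow_pos_of_pos hε.1 δ
    rw [h2, abs_mul, abs_of_pos hpos, show 1 - δ = δ + (1 - 2 * δ) by ring,
      Real.rpow_add hε.1, mul_left_comm]
    have := Real.rpow_nonneg hε.1.le (1 - 2 * δ)
    refine mul_le_mul_of_nonneg_left (h1.trans ?_) hpos.le
    simp only [he_def]
    gcongr
    linarith
  · exact isSymbol_comp_scale (fun ε hε => isPeriodic_resPart _ (hFp ε hε))
      (hF.resPart (fun ε => hFp ε ε.2) fun ε => cutoff β ε)
  · exact isNormalForm_resPart hFp fun ε hε => (hF.contDiff he ⟨ε, hε⟩).continuous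
  · refine isSymbol_comp_scale (fun ε hε => ?_) ?_
    · rw [hext ⟨ε, hε⟩]; exact hF'p _
    · simpa only [hext] using hF'
  · have h1 := hF'eq ⟨ε, hε⟩ (scale (ε ^ (-δ)) x)
    simp only [he_def, hF_def, hinv ε hε] at h1
    have h2 : freeHam x = ε ^ (2 * δ) * freeHam (scale (ε ^ (-δ)) x) := by
      conv_lhs => rw [← hinv ε hε x, freeHam_scale]
      rw [mul_comm 2 δ, Real.rpow_mul hε.1.le, Real.rpow_ofNat]
    beta_reduce
    rw [freeHam_scale, hext ⟨ε, hε⟩, h2]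
    rw [mul_comm 2 δ, Real.rpow_mul hε.1.le, Real.rpow_ofNat] at h1 ⊢
    exact h1

theorem compUpTo_congr {X : Type} {L L' : ℕ → X → X} {n : ℕ}
    (h : ∀ j ∈ Finset.Icc 1 n, L j = L' j) : compUpTo L n = compUpTo L' n := by
  induction n with
  | zero => rfl
  | succ n ih =>
    rw [compUpTo, compUpTo, h (n + 1) (by simp), ih fun j hj => h j ?_]
    rw [Finset.mem_Icc] at hj ⊢
    omega

/-- Induction on `N`, with the full symbol estimates for the remainder so that it can serve as the
next perturbation. The new Lie transform acts on the Hamiltonian already transformed, so it is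
composed on the right. -/
theorem exists_normal_form {β : ℝ} (hδ : 0 < δ) (hδ' : δ < 1 / 2) (hβ : 0 < β)
    {P : ℝ → Phase d → ℝ} (hP : IsSymbol ε₀ δ 1 P) (N : ℕ) :
    ∃ (g : ℕ → ℝ → Phase d → ℝ) (L : ℕ → ℝ → Phase d → Phase d) (Z : ℕ → ℝ → Phase d → ℝ)
      (R : ℝ → Phase d → ℝ),
      (∀ j ∈ Finset.Icc 1 N,
        IsSymbol ε₀ δ (1 + (1 - 2 * δ) * ((j : ℝ) - 1) - δ) (g j) ∧
        ∀ ε ∈ Ioo 0 ε₀, IsLieTransform (g j ε) (L j ε)) ∧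
      IsNearIdentity ε₀ δ (fun ε => compUpTo (fun j => L j ε) N) ∧
      (∀ ε ∈ Ioo 0 ε₀, ∀ x : Phase d,
        freeHam (compUpTo (fun j => L j ε) N x) + P ε (compUpTo (fun j => L j ε) N x) =
          freeHam x + ∑ j ∈ Finset.Icc 1 N, Z j ε x + R ε x) ∧
      (∀ j ∈ Finset.Icc 1 N,
        IsSymbol ε₀ δ (1 + (1 - 2 * δ) * ((j : ℝ) - 1)) (Z j) ∧ IsNormalForm ε₀ δ β (Z j)) ∧
      IsSymbol ε₀ δ (1 + N * (1 - 2 * δ)) R := by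
  induction N with
  | zero =>
    refine ⟨fun _ _ _ => 0, fun _ _ => id, fun _ _ _ => 0, P, by simp, isNearIdentity_id,
      fun ε _ x => by simp [compUpTo], by simp, by simpa using hP⟩
  | succ N ih =>
    obtain ⟨g, L, Z, R, hg, hT, heq, hZ, hR⟩ := ih
    have ha : 0 ≤ 1 - 2 * δ := by linarith
    -- The earlier normal form terms all have order at least `1`, as `j ≥ 1` and `1 - 2δ ≥ 0`. Their
    -- sum is the `W` of the next step, left unchanged up to an error absorbed in the remainder.
    have hW : IsSymbol ε₀ δ 1 (fun ε x => ∑ j ∈ Finset.Icc 1 N, Z j ε x) :=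
      isSymbol_sum fun j hj => (hZ j hj).1.mono (by
        have h1 : (1 : ℝ) ≤ j := by exact_mod_cast (Finset.mem_Icc.1 hj).1
        nlinarith)
    obtain ⟨g₁, L₁, Z₁, R₁, hg₁, hL₁, hT₁, hZ₁, hn₁, hR₁, heq₁⟩ := exists_step hδ hδ' hβ
      (m := 1 + N * (1 - 2 * δ)) (by nlinarith [(Nat.cast_nonneg N : (0 : ℝ) ≤ N)]) hW hR
    have hord : 1 + (1 - 2 * δ) * (((N + 1 : ℕ) : ℝ) - 1) = 1 + N * (1 - 2 * δ) := by
      push_cast; ring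
    have hne : ∀ j ∈ Finset.Icc 1 N, j ≠ N + 1 := fun j hj h => by
      rw [Finset.mem_Icc] at hj; omega
    have hcase : ∀ j ∈ Finset.Icc 1 (N + 1), j = N + 1 ∨ j ∈ Finset.Icc 1 N := fun j hj => by
      rw [Finset.mem_Icc] at hj ⊢; omega
    have hcomp : ∀ ε, compUpTo (fun j => Function.update L (N + 1) L₁ j ε) (N + 1) =
        compUpTo (fun j => L j ε) N ∘ L₁ ε := fun ε => by
      rw [compUpTo, Function.update_self]
      congr 1
      exact compUpTo_congr fun j hj => by rw [Function.update_of_ne (hne j hj)]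
    refine ⟨Function.update g (N + 1) g₁, Function.update L (N + 1) L₁,
      Function.update Z (N + 1) Z₁, R₁, fun j hj => ?_, ?_, fun ε hε x => ?_, fun j hj => ?_, ?_⟩
    · rcases hcase j hj with rfl | hj
      · rw [Function.update_self, Function.update_self, hord]
        exact ⟨hg₁, hL₁⟩
      · rw [Function.update_of_ne (hne j hj), Function.update_of_ne (hne j hj)]
        exact hg j hj
    · simp only [hcomp]
      exact hT.comp hT₁
    · have h1 : ∑ j ∈ Finset.Icc 1 N, Function.update Z (N + 1) Z₁ j ε x =
          ∑ j ∈ Finset.Icc 1 N, Z j ε x :=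
        Finset.sum_congr rfl fun j hj => by rw [Function.update_of_ne (hne j hj)]
      rw [hcomp, Function.comp_apply, heq ε hε, heq₁ ε hε, Finset.sum_Icc_succ_top (by omega),
        Function.update_self, h1]
      ring
    · rcases hcase j hj with rfl | hj
      · rw [Function.update_self, hord]
        exact ⟨hZ₁, hn₁⟩
      · rw [Function.update_of_ne (hne j hj)]
        exact hZ j hj
    · convert hR₁ using 1
      push_cast
      ring

theorem IsSymbol.isRemainder {N : ℕ} {R : ℝ → Phase d → ℝ}
    (h : IsSymbol ε₀ δ (1 + N * (1 - 2 * δ)) R) : IsRemainder ε₀ δ N R := by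
  refine ⟨h.smooth, h.periodic, fun α β _ => ?_⟩
  obtain ⟨C, hC, h1⟩ := h.bound α β
  refine ⟨C, hC, fun ε hε x => ?_⟩
  have h2 := h1 ε hε x
  rwa [abs_mul, abs_of_nonneg (Real.rpow_nonneg hε.1.le _)] at h2

end NormalForm

end

end NormalFormLemma

/-! ### The normal form lemma -/

open NormalFormLemma in
theorem lemma2p1 (d N : ℕ) (δ β ε₀ : ℝ) (hδ : 0 < δ) (hδ' : δ < 1 / 2)
    (hβ : 0 < β) (hβ' : β < 1) (hε₀ : 0 < ε₀)
    (P : ℝ → Phase d → ℝ) (hP : IsSymbol ε₀ δ 1 P) :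
    ∃ (T : ℝ → Phase d → Phase d) (g : ℕ → ℝ → Phase d → ℝ)
      (L : ℕ → ℝ → Phase d → Phase d) (Z : ℕ → ℝ → Phase d → ℝ) (R : ℝ → Phase d → ℝ),
      -- `T ε` is a canonical transformation, a composition of `N` Lie transforms
      (∀ ε ∈ Set.Ioo 0 ε₀, IsCanonical (T ε)) ∧
      (∀ j ∈ Finset.Icc 1 N,
        IsSymbol ε₀ δ (1 + (1 - 2 * δ) * ((j : ℝ) - 1) - δ) (g j) ∧
        ∀ ε ∈ Set.Ioo 0 ε₀, IsLieTransform (g j ε) (L j ε)) ∧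
      (∀ ε ∈ Set.Ioo 0 ε₀, T ε = compUpTo (fun j => L j ε) N) ∧
      -- the normal form
      (∀ ε ∈ Set.Ioo 0 ε₀, ∀ x : Phase d,
        freeHam (T ε x) + P ε (T ε x) = freeHam x + ∑ j ∈ Finset.Icc 1 N, Z j ε x + R ε x) ∧
      (∀ j ∈ Finset.Icc 1 N,
        IsSymbol ε₀ δ (1 + (1 - 2 * δ) * ((j : ℝ) - 1)) (Z j) ∧ IsNormalForm ε₀ δ β (Z j)) ∧
      IsRemainder ε₀ δ N R ∧
      -- the deformation of symbols and of the actions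
      (∀ (m : ℝ) (f : ℝ → Phase d → ℝ), IsSymbol ε₀ δ m f →
        ∃ C > 0, ∀ ε ∈ Set.Ioo 0 ε₀, ∀ x : Phase d,
          |f ε (T ε x) - f ε x| ≤ C * ε ^ (m + 1 - 2 * δ)) ∧
      (∀ j : Fin d, ∃ C > 0, ∀ ε ∈ Set.Ioo 0 ε₀, ∀ x : Phase d,
        |(T ε x).1 j - x.1 j| ≤ C * ε ^ (1 - δ)) := by
  obtain ⟨g, L, Z, R, hg, hT, heq, hZ, hR⟩ := exists_normal_form hδ hδ' hβ hP N
  exact ⟨_, g, L, Z, R, hT.canonical, hg, fun _ _ => rfl, heq, hZ, hR.isRemainder, hT.symbol,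
    hT.action⟩
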